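/- Let $\mathbf k$ be a field of characteristic zero and $V=\bigoplus_{i\in\mathbb Z}V^i$ a graded vector space over $\mathbf k$. Let $\mathrm{Sym}(V)$ be the graded symmetric algebra, i.e. the quotient of the tensor algebra by the two-sided ideal generated by $x\otimes y-(-1)^{|x||y|}y\otimes x$ for homogeneous $x,y\in V$, and let $\overline{\mathrm{Sym}}(V)=\bigoplus_{n\ge1}\mathrm{Sym}^n(V)$. Equip $\mathrm{Sym}(V)$ with its shuffle coproduct (the morphism of algebras to $\mathrm{Sym}(V)\otimes\mathrm{Sym}(V)$, with the Koszul-signed product, such that $v\mapsto v\otimes1+1\otimes v$), written $X\mapsto\sum X_{1}\otimes X_{2}$, and iterated $X\mapsto\sum X_{1}\otimes X_{2}\otimes X_{3}$. Let $\mathrm{ComTrias}^c(V)$ be the graded space $\mathrm{Sym}(V)\otimes\overline{\mathrm{Sym}}(V)$ with the two coproducts $$\Delta(X\otimes Y)=\sum(-1)^{|X_2||Y_1|}(X_1\otimes Y_1)\otimes(X_2\otimes Y_2),\qquad \delta(X\otimes Y)=\sum (X_1\otimes X_2)\otimes(X_3\otimes Y),$$ where in $\Delta$ only the terms with $Y_1,Y_2\in\overline{\mathrm{Sym}}(V)$,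 and in $\delta$ only the terms with $X_2\in\overline{\mathrm{Sym}}(V)$, are kept (this is the cofree conilpotent graded cocommutative cotrialgebra generated by $V$). For $k\in\mathbb Z$ let $\mathrm{Hom}^k(\mathrm{Sym}(V)\otimes\overline{\mathrm{Sym}}(V),V)$ be the space of linear maps of degree $k$, and let $\mathrm{coDer}^k$ be the space of degree $k$ coderivations of $\mathrm{ComTrias}^c(V)$: linear endomorphisms $D$ of degree $k$ with $\Delta D=(D\otimes\mathrm{Id}+\mathrm{Id}\otimes D)\Delta$ and $\delta D=(D\otimes\mathrm{Id}+\mathrm{Id}\otimes D)\delta$, where $(\mathrm{Id}\otimes D)(a\otimes b)=(-1)^{k|a|}a\otimes D(b)$. Write $\mathbb S_{(i_1,\dots,i_r)}$ for the set of $(i_1,\dots,i_r)$-shuffles (empty if some $i_s<0$), and $\varepsilon(\sigma)$ for the Koszul sign, given by $x_1\cdots x_n=\varepsilon(\sigma)\,x_{\sigma(1)}\cdots x_{\sigma(n)}$ in $\mathrm{Sym}(V)$. For $R\in\mathrm{Hom}^k(\mathrm{Sym}(V)\otimes\overline{\mathrm{Sym}}(V),V)$ with components $R_{p,q}:\mathrm{Sym}^p(V)\otimes\mathrm{Sym}^q(V)\to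 V$ ($p\ge0$, $q\ge1$), and homogeneous $x_1,\dots,x_n,y_1,\dots,y_m\in V$ with $n\ge0$, $m\ge1$, put $$\hat R_{p,q}(x_1\cdots x_n\otimes y_1\cdots y_m)=\sum_{\sigma\in\mathbb S_{(p,q,n-p-q)}}\varepsilon(\sigma)\,R_{p,q}\big(x_{\sigma(1)}\cdots x_{\sigma(p)}\otimes x_{\sigma(p+1)}\cdots x_{\sigma(p+q)}\big)x_{\sigma(p+q+1)}\cdots x_{\sigma(n)}\otimes y_1\cdots y_m$$ $$+\sum_{\sigma\in\mathbb S_{(n-p,p)}}\sum_{\tau\in\mathbb S_{(q,m-q)}}\varepsilon(\sigma)\varepsilon(\tau)(-1)^{k(|x_{\sigma(1)}|+\cdots+|x_{\sigma(n-p)}|)}\,x_{\sigma(1)}\cdots x_{\sigma(n-p)}\otimes R_{p,q}\big(x_{\sigma(n-p+1)}\cdots x_{\sigma(n)}\otimes y_{\tau(1)}\cdots y_{\tau(q)}\big)y_{\tau(q+1)}\cdots y_{\tau(m)}.$$ Thus the first sum is zero unless $p+q\le n$, and the second is zero unless $p\le n$ and $q\le m$. Then $$\Psi(R)(x_1\cdots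 x_n\otimes y_1\cdots y_m)=\sum_{p\ge0,\,q\ge1}\hat R_{p,q}(x_1\cdots x_n\otimes y_1\cdots y_m)$$ is a well-defined map and is an isomorphism of graded vector spaces $$\Psi:\ \bigoplus_{k}\mathrm{Hom}^k(\mathrm{Sym}(V)\otimes\overline{\mathrm{Sym}}(V),V)\ \longrightarrow\ \bigoplus_k\mathrm{coDer}^k(\mathrm{ComTrias}^c(V));$$ that is, for every $k$ it defines a linear isomorphism $\mathrm{Hom}^k\to\mathrm{coDer}^k$. -/

import Mathlib

open scoped TensorProduct DirectSum

namespace PostLie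

/-- The sign `(-1)^n` for an integer `n`, as an element of the field `K`. -/
def sgn (K : Type*) [Field K] (n : ℤ) : K := ((n.negOnePow : ℤ) : K)

section Sym

variable {K V : Type*} [Field K] [AddCommGroup V] [Module K V] (𝒱 : ℤ → Submodule K V)

/-- The Koszul commutativity relation `x ⊗ y ∼ (-1)^{|x||y|} y ⊗ x`, for homogeneous `x`, `y`. -/
inductive SymRel : TensorAlgebra K V → TensorAlgebra K V → Prop
  | swap (i j : ℤ) (x y : V) (hx : x ∈ 𝒱 i) (hy : y ∈ 𝒱 j) :
      SymRel (TensorAlgebra.ι K x * TensorAlgebra.ι K y)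
        (sgn K (i * j) • (TensorAlgebra.ι K y * TensorAlgebra.ι K x))

/-- The graded symmetric algebra `Sym(V)`: the quotient of the tensor algebra by the two-sided
ideal generated by `x ⊗ y - (-1)^{|x||y|} y ⊗ x` for homogeneous `x`, `y`. -/
abbrev GSym : Type _ := RingQuot (SymRel 𝒱)

/-- The canonical map `V → Sym(V)`. -/
noncomputable def symι : V →ₗ[K] GSym 𝒱 :=
  (RingQuot.mkAlgHom K (SymRel 𝒱)).toLinearMap ∘ₗ TensorAlgebra.ι K

/-- The monomial `v₁ v₂ ⋯ vₙ` in `Sym(V)`; it is `1` for the empty list. -/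
noncomputable def mon (l : List V) : GSym 𝒱 := (l.map (symι 𝒱)).prod

@[simp] theorem mon_nil : mon 𝒱 [] = 1 := rfl

@[simp] theorem mon_cons (v : V) (l : List V) : mon 𝒱 (v :: l) = symι 𝒱 v * mon 𝒱 l := by
  simp [mon]

theorem mon_append (l l' : List V) : mon 𝒱 (l ++ l') = mon 𝒱 l * mon 𝒱 l' := by
  simp [mon]

theorem symι_mul_symι {i j : ℤ} {x y : V} (hx : x ∈ 𝒱 i) (hy : y ∈ 𝒱 j) :
    symι 𝒱 x * symι 𝒱 y = sgn K (i * j) • (symι 𝒱 y * symι 𝒱 x) := by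
  have h := RingQuot.mkAlgHom_rel K (SymRel.swap i j x y hx hy)
  rw [map_smul, map_mul, map_mul] at h
  exact h

/-- The universal property of `Sym(V)`: a linear map from `V` to an algebra whose values on
homogeneous vectors commute up to the Koszul sign extends to an algebra morphism. -/
noncomputable def symLift {A : Type*} [Semiring A] [Algebra K A] (f : V →ₗ[K] A)
    (hf : ∀ (i j : ℤ) (x y : V), x ∈ 𝒱 i → y ∈ 𝒱 j →
      f x * f y = sgn K (i * j) • (f y * f x)) : GSym 𝒱 →ₐ[K] A :=
  RingQuot.liftAlgHom K ⟨TensorAlgebra.lift K f, by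
    rintro _ _ ⟨i, j, x, y, hx, hy⟩
    rw [map_smul]
    simpa using hf i j x y hx hy⟩

@[simp] theorem symLift_symι {A : Type*} [Semiring A] [Algebra K A] (f : V →ₗ[K] A)
    (hf : ∀ (i j : ℤ) (x y : V), x ∈ 𝒱 i → y ∈ 𝒱 j →
      f x * f y = sgn K (i * j) • (f y * f x)) (v : V) :
    symLift 𝒱 f hf (symι 𝒱 v) = f v := by
  simp [symLift, symι]

theorem gsym_algHom_ext {A : Type*} [Semiring A] [Algebra K A] {f g : GSym 𝒱 →ₐ[K] A}
    (h : ∀ v, f (symι 𝒱 v) = g (symι 𝒱 v)) : f = g := by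
  apply RingQuot.ringQuot_ext'
  apply TensorAlgebra.hom_ext
  ext v
  exact h v

/-- The degree `d` part of `Sym(V)`, spanned by the monomials `v₁ ⋯ vₙ` in homogeneous vectors
with `|v₁| + ⋯ + |vₙ| = d`; a pair `(i, v)` in the list is a vector `v ∈ 𝒱 i`. -/
def symGr (d : ℤ) : Submodule K (GSym 𝒱) :=
  Submodule.span K {s | ∃ l : List (ℤ × V), (∀ p ∈ l, p.2 ∈ 𝒱 p.1) ∧
    (l.map Prod.fst).sum = d ∧ mon 𝒱 (l.map Prod.snd) = s}

theorem symι_mem {i : ℤ} {x : V} (hx : x ∈ 𝒱 i) : symι 𝒱 x ∈ symGr 𝒱 i :=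
  Submodule.subset_span ⟨[(i, x)], by simpa using hx, by simp, by simp⟩

instance symGr.gradedMonoid : SetLike.GradedMonoid (symGr 𝒱) where
  one_mem := Submodule.subset_span ⟨[], by simp, by simp, by simp⟩
  mul_mem i j a b ha hb := by
    have h := Submodule.mul_mem_mul ha hb
    rw [symGr, symGr, Submodule.span_mul_span] at h
    refine Submodule.span_mono ?_ h
    rintro _ ⟨_, ⟨l, hl, rfl, rfl⟩, _, ⟨l', hl', rfl, rfl⟩, rfl⟩
    refine ⟨l ++ l', ?_, by simp, by simp [mon_append]⟩
    intro p hp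
    rcases List.mem_append.1 hp with h | h
    exacts [hl p h, hl' p h]

variable [DirectSum.Decomposition 𝒱]

/-- Auxiliary: the map `V → ⨁ d, Sym(V)_d`. -/
noncomputable def symGrι : V →ₗ[K] ⨁ d, symGr 𝒱 d :=
  DirectSum.lmap (fun i => ((symι 𝒱).comp (𝒱 i).subtype).codRestrict (symGr 𝒱 i)
    fun x => symι_mem 𝒱 x.2) ∘ₗ (DirectSum.decomposeLinearEquiv 𝒱).toLinearMap

theorem symGrι_of_mem {i : ℤ} {x : V} (hx : x ∈ 𝒱 i) :
    symGrι 𝒱 x = DirectSum.of (fun d => symGr 𝒱 d) i ⟨symι 𝒱 x, symι_mem 𝒱 hx⟩ := by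
  simp only [symGrι, LinearMap.comp_apply, LinearEquiv.coe_coe,
    DirectSum.decomposeLinearEquiv_apply]
  rw [DirectSum.decompose_of_mem 𝒱 hx, ← DirectSum.lof_eq_of K, DirectSum.lmap_lof,
    DirectSum.lof_eq_of]
  rfl

/-- `Sym(V)` is a graded algebra for the total degree. -/
noncomputable instance symGr.gradedAlgebra : GradedAlgebra (symGr 𝒱) := by
  refine GradedAlgebra.ofAlgHom (symGr 𝒱) (symLift 𝒱 (symGrι 𝒱) ?_) ?_ ?_
  · intro i j x y hx hy
    rw [symGrι_of_mem 𝒱 hx, symGrι_of_mem 𝒱 hy, DirectSum.of_mul_of, DirectSum.of_mul_of,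
      ← DirectSum.lof_eq_of K, ← DirectSum.lof_eq_of K, ← map_smul, DirectSum.lof_eq_of,
      DirectSum.lof_eq_of]
    refine DirectSum.of_eq_of_gradedMonoid_eq (Sigma.subtype_ext (add_comm i j) ?_)
    exact symι_mul_symι 𝒱 hx hy
  · apply gsym_algHom_ext
    intro v
    simp only [AlgHom.comp_apply, symLift_symι, AlgHom.id_apply]
    induction v using DirectSum.Decomposition.inductionOn 𝒱 with
    | zero => simp
    | homogeneous x => rw [symGrι_of_mem 𝒱 x.2, DirectSum.coeAlgHom_of]
    | add x y hx hy => simp only [map_add, hx, hy]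
  · rintro d ⟨s, hs⟩
    dsimp only
    induction hs using Submodule.span_induction with
    | mem s h =>
      obtain ⟨l, hl, rfl, rfl⟩ := h
      induction l with
      | nil => simp only [List.map_nil, mon_nil, map_one]; rfl
      | cons p l ih =>
        have hp := hl p List.mem_cons_self
        have hl' : ∀ p ∈ l, p.2 ∈ 𝒱 p.1 := fun q hq => hl q (List.mem_cons_of_mem _ hq)
        simp only [List.map_cons, mon_cons, map_mul, symLift_symι]
        rw [ih hl', symGrι_of_mem 𝒱 hp, DirectSum.of_mul_of]
        exact DirectSum.of_eq_of_gradedMonoid_eq (Sigma.subtype_ext List.sum_cons.symm rfl)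
    | zero => rw [map_zero]; exact (map_zero (DirectSum.of (fun d => symGr 𝒱 d) d)).symm
    | add a b ha hb iha ihb =>
      rw [map_add, iha, ihb, ← map_add]; rfl
    | smul r a ha iha =>
      rw [map_smul, iha, ← DirectSum.lof_eq_of K, ← map_smul]; rfl

/-- Mathlib's sign on graded tensor products, written with `sgn`. -/
theorem neg_one_smul_eq {M : Type*} [AddCommGroup M] [Module K M] (n : ℤ) (x : M) :
    ((-1 : ℤˣ) ^ n) • x = sgn K n • x := by
  rw [Units.smul_def, sgn, Int.cast_smul_eq_zsmul]
  rfl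

/-- The coproduct of `Sym(V)` as the algebra morphism `Sym(V) → Sym(V) ⊗ Sym(V)` with
`v ↦ v ⊗ 1 + 1 ⊗ v`, where the target has the Koszul-signed product
`(a ⊗ b)(c ⊗ d) = (-1)^{|b||c|} ac ⊗ bd`. -/
noncomputable def symComulAlg : GSym 𝒱 →ₐ[K] (symGr 𝒱 ᵍ⊗[K] symGr 𝒱) :=
  symLift 𝒱
    ((GradedTensorProduct.includeLeft (symGr 𝒱) (symGr 𝒱)).toLinearMap ∘ₗ symι 𝒱 +
      (GradedTensorProduct.includeRight (symGr 𝒱) (symGr 𝒱)).toLinearMap ∘ₗ symι 𝒱) (by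
    intro i j x y hx hy
    have e1 := GradedTensorProduct.tmul_coe_mul_coe_tmul (R := K) (symGr 𝒱) (symGr 𝒱) 1
      ⟨symι 𝒱 x, symι_mem 𝒱 hx⟩ ⟨symι 𝒱 y, symι_mem 𝒱 hy⟩ 1
    have e2 := GradedTensorProduct.tmul_coe_mul_coe_tmul (R := K) (symGr 𝒱) (symGr 𝒱) 1
      ⟨symι 𝒱 y, symι_mem 𝒱 hy⟩ ⟨symι 𝒱 x, symι_mem 𝒱 hx⟩ 1
    have e3 : ∀ a b : GSym 𝒱,
        ((a ᵍ⊗ₜ[K] (1 : GSym 𝒱)) * ((1 : GSym 𝒱) ᵍ⊗ₜ[K] b) : symGr 𝒱 ᵍ⊗[K] symGr 𝒱)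
          = a ᵍ⊗ₜ[K] b := fun a b =>
      GradedTensorProduct.tmul_one_mul_one_tmul (symGr 𝒱) (symGr 𝒱) a b
    have e4 := map_mul (GradedTensorProduct.includeLeft (R := K) (symGr 𝒱) (symGr 𝒱))
      (symι 𝒱 x) (symι 𝒱 y)
    have e5 := map_mul (GradedTensorProduct.includeRight (R := K) (symGr 𝒱) (symGr 𝒱))
      (symι 𝒱 x) (symι 𝒱 y)
    have e6 := map_mul (GradedTensorProduct.includeLeft (R := K) (symGr 𝒱) (symGr 𝒱))
      (symι 𝒱 y) (symι 𝒱 x)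
    have e7 := map_mul (GradedTensorProduct.includeRight (R := K) (symGr 𝒱) (symGr 𝒱))
      (symι 𝒱 y) (symι 𝒱 x)
    rw [symι_mul_symι 𝒱 hx hy, map_smul] at e4 e5
    have hs : sgn K (i * j) * sgn K (i * j) = 1 := by
      rw [sgn, ← Int.cast_mul, ← Units.val_mul, Int.units_mul_self]; simp
    rw [neg_one_smul_eq (K := K)] at e1 e2
    simp only [GradedTensorProduct.includeLeft_apply, GradedTensorProduct.includeRight_apply,
      one_mul, mul_one] at e1 e2 e4 e5 e6 e7
    simp only [LinearMap.add_apply, LinearMap.comp_apply, AlgHom.toLinearMap_apply,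
      GradedTensorProduct.includeLeft_apply, GradedTensorProduct.includeRight_apply, mul_add,
      add_mul, e1, e2, e3, ← e4, ← e5, ← e6, ← e7, smul_add, smul_smul, mul_comm j i, hs,
      one_smul]
    abel)

/-- The coproduct of `Sym(V)` as a linear map. -/
noncomputable def symComul : GSym 𝒱 →ₗ[K] GSym 𝒱 ⊗[K] GSym 𝒱 :=
  (GradedTensorProduct.of K (symGr 𝒱) (symGr 𝒱)).symm.toLinearMap ∘ₗ
    (symComulAlg 𝒱).toLinearMap

/-- The braiding `a ⊗ b ↦ (-1)^{|a||b|} b ⊗ a` of `Sym(V) ⊗ Sym(V)`. -/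
noncomputable def symBraid : GSym 𝒱 ⊗[K] GSym 𝒱 →ₗ[K] GSym 𝒱 ⊗[K] GSym 𝒱 :=
  (GradedTensorProduct.of K (symGr 𝒱) (symGr 𝒱)).symm.toLinearMap ∘ₗ
    (GradedTensorProduct.comm (R := K) (symGr 𝒱) (symGr 𝒱)).toLinearMap ∘ₗ
      (GradedTensorProduct.of K (symGr 𝒱) (symGr 𝒱)).toLinearMap

theorem symBraid_tmul {i j : ℤ} {a b : GSym 𝒱} (ha : a ∈ symGr 𝒱 i) (hb : b ∈ symGr 𝒱 j) :
    symBraid 𝒱 (a ⊗ₜ b) = sgn K (i * j) • (b ⊗ₜ a) := by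
  have h := GradedTensorProduct.comm_coe_tmul_coe (R := K) (symGr 𝒱) (symGr 𝒱) ⟨a, ha⟩ ⟨b, hb⟩
  rw [neg_one_smul_eq (K := K), mul_comm] at h
  exact h

/-- The operator of multiplication by `(-1)^{k d}` in degree `d`. -/
noncomputable def twist {M : Type*} [AddCommGroup M] [Module K M] (𝒜 : ℤ → Submodule K M)
    [DirectSum.Decomposition 𝒜] (k : ℤ) : M →ₗ[K] M :=
  (DirectSum.decomposeLinearEquiv 𝒜).symm.toLinearMap ∘ₗ
    DirectSum.lmap (fun d => sgn K (k * d) • LinearMap.id) ∘ₗ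
      (DirectSum.decomposeLinearEquiv 𝒜).toLinearMap

theorem twist_of_mem {M : Type*} [AddCommGroup M] [Module K M] (𝒜 : ℤ → Submodule K M)
    [DirectSum.Decomposition 𝒜] (k : ℤ) {d : ℤ} {x : M} (hx : x ∈ 𝒜 d) :
    twist 𝒜 k x = sgn K (k * d) • x := by
  simp only [twist, LinearMap.comp_apply, LinearEquiv.coe_coe,
    DirectSum.decomposeLinearEquiv_apply]
  rw [DirectSum.decompose_of_mem 𝒜 hx, ← DirectSum.lof_eq_of K, DirectSum.lmap_lof,
    DirectSum.lof_eq_of]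
  exact DirectSum.decompose_symm_of 𝒜 _

end Sym

section ComTrias

variable {K V : Type*} [Field K] [AddCommGroup V] [Module K V] (𝒱 : ℤ → Submodule K V)

/-- The augmentation (counit) `Sym(V) → K`, killing `V`. -/
noncomputable def symAug : GSym 𝒱 →ₐ[K] K := symLift 𝒱 0 (by simp)

/-- The reduced symmetric algebra `S̄ym(V) = ⨁_{n ≥ 1} Symⁿ(V)`, the augmentation ideal. -/
noncomputable abbrev SymBar : Submodule K (GSym 𝒱) := LinearMap.ker (symAug 𝒱).toLinearMap

/-- The projection `Sym(V) → S̄ym(V)` along the constants. -/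
noncomputable def symProj : GSym 𝒱 →ₗ[K] SymBar 𝒱 :=
  (LinearMap.id - Algebra.linearMap K (GSym 𝒱) ∘ₗ (symAug 𝒱).toLinearMap).codRestrict _ (by
    intro s
    simp)

theorem coe_symProj (s : GSym 𝒱) :
    (symProj 𝒱 s : GSym 𝒱) = s - algebraMap K (GSym 𝒱) (symAug 𝒱 s) := rfl

theorem symProj_coe (Y : SymBar 𝒱) : symProj 𝒱 (Y : GSym 𝒱) = Y := by
  have h : symAug 𝒱 (Y : GSym 𝒱) = 0 := Y.2
  refine Subtype.ext ?_
  rw [coe_symProj, h, map_zero, sub_zero]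

/-- The monomial `y₁ ⋯ yₘ` in `S̄ym(V)` for `m ≥ 1` (and `0` for the empty list). -/
noncomputable def barMon (l : List V) : SymBar 𝒱 := symProj 𝒱 (mon 𝒱 l)

theorem coe_barMon {l : List V} (hl : l ≠ []) : (barMon 𝒱 l : GSym 𝒱) = mon 𝒱 l := by
  obtain ⟨v, l, rfl⟩ := List.exists_cons_of_ne_nil hl
  simp [barMon, symProj, symAug]

/-- The space `Sym(V) ⊗ S̄ym(V)` underlying the cotrialgebra `ComTriasᶜ(V)`. -/
noncomputable abbrev ComTrias : Type _ := GSym 𝒱 ⊗[K] SymBar 𝒱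

/-- The degree `d` part of `Sym(V) ⊗ S̄ym(V)`. -/
noncomputable def comGr (d : ℤ) : Submodule K (ComTrias 𝒱) :=
  Submodule.span K {c | ∃ (a b : ℤ) (X : GSym 𝒱) (Y : SymBar 𝒱), X ∈ symGr 𝒱 a ∧
    (Y : GSym 𝒱) ∈ symGr 𝒱 b ∧ a + b = d ∧ X ⊗ₜ[K] Y = c}

variable [DirectSum.Decomposition 𝒱]

/-- The exchange of the two middle factors,
`(a ⊗ b) ⊗ (c ⊗ d) ↦ (-1)^{|b||c|} (a ⊗ c) ⊗ (b ⊗ d)`. -/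
noncomputable def midSwap : (GSym 𝒱 ⊗[K] GSym 𝒱) ⊗[K] (GSym 𝒱 ⊗[K] GSym 𝒱) →ₗ[K]
    (GSym 𝒱 ⊗[K] GSym 𝒱) ⊗[K] (GSym 𝒱 ⊗[K] GSym 𝒱) :=
  (TensorProduct.assoc K _ _ _).symm.toLinearMap ∘ₗ
    LinearMap.lTensor (GSym 𝒱) ((TensorProduct.assoc K _ _ _).toLinearMap ∘ₗ
      LinearMap.rTensor (GSym 𝒱) (symBraid 𝒱) ∘ₗ
        (TensorProduct.assoc K _ _ _).symm.toLinearMap) ∘ₗ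
      (TensorProduct.assoc K _ _ _).toLinearMap

theorem midSwap_tmul {i j : ℤ} (a : GSym 𝒱) {b c : GSym 𝒱} (d : GSym 𝒱)
    (hb : b ∈ symGr 𝒱 i) (hc : c ∈ symGr 𝒱 j) :
    midSwap 𝒱 ((a ⊗ₜ b) ⊗ₜ (c ⊗ₜ d)) = sgn K (i * j) • ((a ⊗ₜ c) ⊗ₜ (b ⊗ₜ d)) := by
  simp [midSwap, symBraid_tmul 𝒱 hb hc, TensorProduct.smul_tmul']

/-- The cocommutative coproduct
`Δ(X ⊗ Y) = ∑ (-1)^{|X₂||Y₁|} (X₁ ⊗ Y₁) ⊗ (X₂ ⊗ Y₂)`, the sum running over the terms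
`X₁ ⊗ X₂` of the coproduct of `X` and the terms `Y₁ ⊗ Y₂`, with `Y₁` and `Y₂` in `S̄ym(V)`, of
the coproduct of `Y`. -/
noncomputable def comΔ : ComTrias 𝒱 →ₗ[K] ComTrias 𝒱 ⊗[K] ComTrias 𝒱 :=
  TensorProduct.map (LinearMap.lTensor (GSym 𝒱) (symProj 𝒱))
      (LinearMap.lTensor (GSym 𝒱) (symProj 𝒱)) ∘ₗ
    midSwap 𝒱 ∘ₗ
      TensorProduct.map (symComul 𝒱) (symComul 𝒱 ∘ₗ (SymBar 𝒱).subtype)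

/-- The copermutative coproduct `δ(X ⊗ Y) = ∑ (X₁ ⊗ X₂) ⊗ (X₃ ⊗ Y)`, the sum running over the
terms `X₁ ⊗ X₂ ⊗ X₃`, with `X₂` in `S̄ym(V)`, of the iterated coproduct of `X`. -/
noncomputable def comδ : ComTrias 𝒱 →ₗ[K] ComTrias 𝒱 ⊗[K] ComTrias 𝒱 :=
  LinearMap.rTensor (ComTrias 𝒱) (LinearMap.lTensor (GSym 𝒱) (symProj 𝒱)) ∘ₗ
    (TensorProduct.assoc K _ _ _).toLinearMap ∘ₗ
      LinearMap.rTensor (SymBar 𝒱) (LinearMap.rTensor (GSym 𝒱) (symComul 𝒱) ∘ₗ symComul 𝒱)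

/-- The operator of multiplication by `(-1)^{k d}` on the degree `d` part of
`Sym(V) ⊗ S̄ym(V)`. -/
noncomputable def comTwist (k : ℤ) : ComTrias 𝒱 →ₗ[K] ComTrias 𝒱 :=
  TensorProduct.map (twist (symGr 𝒱) k)
    (symProj 𝒱 ∘ₗ twist (symGr 𝒱) k ∘ₗ (SymBar 𝒱).subtype)

theorem sgn_add (m n : ℤ) : sgn K (m + n) = sgn K m * sgn K n := by
  simp [sgn, Int.negOnePow_add]

theorem comTwist_of_mem (k : ℤ) {d : ℤ} {c : ComTrias 𝒱} (hc : c ∈ comGr 𝒱 d) :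
    comTwist 𝒱 k c = sgn K (k * d) • c := by
  induction hc using Submodule.span_induction with
  | mem c h =>
    obtain ⟨a, b, X, Y, hX, hY, rfl, rfl⟩ := h
    simp only [comTwist, TensorProduct.map_tmul, LinearMap.comp_apply, Submodule.subtype_apply]
    rw [twist_of_mem _ _ hX, twist_of_mem _ _ hY, map_smul, symProj_coe,
      TensorProduct.smul_tmul_smul, mul_add, sgn_add]
  | zero => simp
  | add x y _ _ hx hy => rw [map_add, hx, hy, smul_add]
  | smul r x _ hx => rw [map_smul, hx, smul_comm]

/-- The operator `D ⊗ Id + Id ⊗ D` for `D` of degree `k`, with the Koszul sign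
`(Id ⊗ D)(a ⊗ b) = (-1)^{k|a|} a ⊗ D(b)`. -/
noncomputable def leibniz (k : ℤ) (D : ComTrias 𝒱 →ₗ[K] ComTrias 𝒱) :
    ComTrias 𝒱 ⊗[K] ComTrias 𝒱 →ₗ[K] ComTrias 𝒱 ⊗[K] ComTrias 𝒱 :=
  TensorProduct.map D LinearMap.id + TensorProduct.map (comTwist 𝒱 k) D

/-- `Homᵏ(Sym(V) ⊗ S̄ym(V), V)`: the linear maps that raise the degree by `k`. -/
def HomDeg (k : ℤ) : Submodule K (ComTrias 𝒱 →ₗ[K] V) where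
  carrier := {R | ∀ (d : ℤ), ∀ c ∈ comGr 𝒱 d, R c ∈ 𝒱 (d + k)}
  add_mem' hR hS d c hc := add_mem (hR d c hc) (hS d c hc)
  zero_mem' _ _ _ := zero_mem _
  smul_mem' r _ hR d c hc := Submodule.smul_mem _ r (hR d c hc)

/-- The degree `k` part of the graded vector space of coderivations of `ComTriasᶜ(V)`: the linear
maps `D` of degree `k` with `Δ ∘ D = (D ⊗ Id + Id ⊗ D) ∘ Δ` and
`δ ∘ D = (D ⊗ Id + Id ⊗ D) ∘ δ`. -/
def CoDer (k : ℤ) : Submodule K (ComTrias 𝒱 →ₗ[K] ComTrias 𝒱) where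
  carrier := {D | (∀ (d : ℤ), ∀ c ∈ comGr 𝒱 d, D c ∈ comGr 𝒱 (d + k)) ∧
    comΔ 𝒱 ∘ₗ D = leibniz 𝒱 k D ∘ₗ comΔ 𝒱 ∧ comδ 𝒱 ∘ₗ D = leibniz 𝒱 k D ∘ₗ comδ 𝒱}
  add_mem' {D E} hD hE := by
    have h : leibniz 𝒱 k (D + E) = leibniz 𝒱 k D + leibniz 𝒱 k E := by
      simp only [leibniz, TensorProduct.map_add_left, TensorProduct.map_add_right]; abel
    refine ⟨fun d c hc => add_mem (hD.1 d c hc) (hE.1 d c hc), ?_, ?_⟩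
    · rw [h, LinearMap.comp_add, LinearMap.add_comp, hD.2.1, hE.2.1]
    · rw [h, LinearMap.comp_add, LinearMap.add_comp, hD.2.2, hE.2.2]
  zero_mem' := by
    have h : leibniz 𝒱 k 0 = 0 := by simp [leibniz]
    exact ⟨fun d c hc => zero_mem _, by simp [h], by simp [h]⟩
  smul_mem' r D hD := by
    have h : leibniz 𝒱 k (r • D) = r • leibniz 𝒱 k D := by
      simp only [leibniz, TensorProduct.map_smul_left, TensorProduct.map_smul_right, smul_add]
    refine ⟨fun d c hc => Submodule.smul_mem _ r (hD.1 d c hc), ?_, ?_⟩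
    · rw [h, LinearMap.comp_smul, LinearMap.smul_comp, hD.2.1]
    · rw [h, LinearMap.comp_smul, LinearMap.smul_comp, hD.2.2]

end ComTrias

section Shuffles

/-- The `(i₁, …, iₖ)`-shuffles in the symmetric group on `n` letters, for `L = [i₁, …, iₖ]`: the
permutations that are increasing on each of the consecutive blocks of sizes `i₁, …, iₖ`. Two
positions `a < b` lie in one block when no partial sum `s` of `L` satisfies `a < s ≤ b`. The set is
empty unless `i₁ + ⋯ + iₖ = n`. -/
def IsShuffle {n : ℕ} (L : List ℕ) (σ : Equiv.Perm (Fin n)) : Prop :=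
  L.sum = n ∧ ∀ a b : Fin n, a < b →
    (∀ t : ℕ, ¬ ((a : ℕ) < (L.take t).sum ∧ (L.take t).sum ≤ (b : ℕ))) → σ a < σ b

open Classical in
/-- The set `𝕊_L` of shuffles as a finset. -/
noncomputable def shuffles (n : ℕ) (L : List ℕ) : Finset (Equiv.Perm (Fin n)) :=
  Finset.univ.filter fun σ => IsShuffle L σ

/-- The Koszul sign `ε(σ; x₁, …, xₙ)` for `|xᵢ| = d i`, characterised by
`x₁ ⋯ xₙ = ε(σ; x₁, …, xₙ) x_{σ(1)} ⋯ x_{σ(n)}`: the product of `(-1)^{|x_{σ(a)}||x_{σ(b)}|}` over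
the inversions `a < b`, `σ(b) < σ(a)`. -/
def koszul (K : Type*) [Field K] {n : ℕ} (d : Fin n → ℤ) (σ : Equiv.Perm (Fin n)) : K :=
  ∏ a : Fin n, ∏ b : Fin n, if a < b ∧ σ b < σ a then sgn K (d (σ a) * d (σ b)) else 1

end Shuffles

section Hat

variable {K V : Type*} [Field K] [AddCommGroup V] [Module K V] (𝒱 : ℤ → Submodule K V)

/-- The value `R̂_{p,q}(x₁ ⋯ xₙ ⊗ y₁ ⋯ yₘ)` for `R` of degree `k`, `|xᵢ| = dx i` and `|yⱼ| = dy j`.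
With `xσ = (x_{σ(1)}, …, x_{σ(n)})` and `yτ = (y_{τ(1)}, …, y_{τ(m)})`, it is
`∑_{σ ∈ 𝕊(p,q,n-p-q)} ε(σ)
    R_{p,q}(x_{σ(1)} ⋯ x_{σ(p)} ⊗ x_{σ(p+1)} ⋯ x_{σ(p+q)}) x_{σ(p+q+1)} ⋯ x_{σ(n)} ⊗ y₁ ⋯ yₘ`
plus
`∑_{σ ∈ 𝕊(n-p,p), τ ∈ 𝕊(q,m-q)} ε(σ) ε(τ) (-1)^{k(|x_{σ(1)}| + ⋯ + |x_{σ(n-p)}|)} x_{σ(1)} ⋯ x_{σ(n-p)} ⊗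
    R_{p,q}(x_{σ(n-p+1)} ⋯ x_{σ(n)} ⊗ y_{τ(1)} ⋯ y_{τ(q)}) y_{τ(q+1)} ⋯ y_{τ(m)}`.
The first sum is empty unless `p + q ≤ n`, the second unless `p ≤ n` and `q ≤ m`. The component
`R_{p,q}` is the restriction of `R` to `Symᵖ(V) ⊗ Sym^q(V)`. -/
noncomputable def hat (k : ℤ) (R : ComTrias 𝒱 →ₗ[K] V) (p q : ℕ) {n m : ℕ}
    (x : Fin n → V) (dx : Fin n → ℤ) (y : Fin m → V) (dy : Fin m → ℤ) : ComTrias 𝒱 :=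
  (∑ σ ∈ shuffles n [p, q, n - p - q],
    let xσ : List V := List.ofFn fun i => x (σ i)
    koszul K dx σ •
      (mon 𝒱 (R (mon 𝒱 (xσ.take p) ⊗ₜ barMon 𝒱 ((xσ.drop p).take q)) :: xσ.drop (p + q))
        ⊗ₜ[K] barMon 𝒱 (List.ofFn y))) +
  ∑ σ ∈ shuffles n [n - p, p], ∑ τ ∈ shuffles m [q, m - q],
    let xσ : List V := List.ofFn fun i => x (σ i)
    let yτ : List V := List.ofFn fun j => y (τ j)
    let dσ : List ℤ := List.ofFn fun i => dx (σ i)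
    (koszul K dx σ * koszul K dy τ * sgn K (k * (dσ.take (n - p)).sum)) •
      (mon 𝒱 (xσ.take (n - p)) ⊗ₜ[K]
        barMon 𝒱 (R (mon 𝒱 (xσ.drop (n - p)) ⊗ₜ barMon 𝒱 (yτ.take q)) :: yτ.drop q))

/-- The value `∑_{p ≥ 0, q ≥ 1} R̂_{p,q}(x₁ ⋯ xₙ ⊗ y₁ ⋯ yₘ)`; the summands with `p > n`, or with
`q > n` and `q > m`, are empty sums and are left out. -/
noncomputable def hatSum (k : ℤ) (R : ComTrias 𝒱 →ₗ[K] V) {n m : ℕ}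
    (x : Fin n → V) (dx : Fin n → ℤ) (y : Fin m → V) (dy : Fin m → ℤ) : ComTrias 𝒱 :=
  ∑ p ∈ Finset.range (n + 1), ∑ q ∈ Finset.Icc 1 (max n m), hat 𝒱 k R p q x dx y dy

end Hat

end PostLie

/-!
The isomorphism between `Homᵏ(Sym(V) ⊗ S̄ym(V), V)` and the coderivations of `ComTriasᶜ(V)`.

A linear map `ρ : Sym(V) → V` of degree `k` defines the operator `f_ρ(X) = ∑ ρ(X₁) X₂` of `Sym(V)`
(`symCoder`), and a linear map `ρ : Sym(V) ⊗ Sym(V) → V` defines `G_ρ(X ⊗ Y) = ∑ (-1)^{k|X₁|} X₁ ⊗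
ρ(X₂ ⊗ Y₁) Y₂` (`sndCoder`). Both are coderivations. Indeed multiplication by a vector `v` is
compatible with the coproduct, and commuting `f_ρ` past it gives `f_ρ (v X) = f_{ρ(v · )} X ± v
f_ρ X`; hence the coderivation rule for all `ρ` at `X` implies the rule for all `ρ` at `v X`
(`coder_step`), and one concludes by induction from `X = 1`. For `R` given, extended by zero to
`Sym(V) ⊗ 1`, put `D(X ⊗ Y) = f_{RΔ}(X) ⊗ Y + G_R(X ⊗ Y)` (`tensCoder`). It is a coderivation of
`Sym(V) ⊗ Sym(V)`. It is also one for `δ`, because `δ = (φ ⊗ 1) Δ` with `φ(X ⊗ Y) = ε(Y) Δ(X)`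
(`tensδ_eq`), and `D` commutes with `φ` (`augComul_comp_tensCoder`). As `D` preserves `Sym(V) ⊗
S̄ym(V)` and `Sym(V) ⊗ 1`, it gives a coderivation `Ψ(R)` of `ComTriasᶜ(V)` (`psi_mem`).

The projection `pr` of `Ψ(R)` to the cogenerators `V` is `R` (`comPr_comp_psi`), so `Ψ` is
injective. For surjectivity it is enough that a coderivation `D` with `pr ∘ D = 0` vanishes
(`coDer_eq_zero`). This follows by induction on the length of monomials once an element killed by
`Δ`, `δ` and `pr` is known to be zero (`eq_zero_of_comul_eq_zero`): an element killed by `δ` has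
the form `1 ⊗ Y`; if `Δ` kills it then `Y` is primitive in `Sym(V)`; and primitive elements are
vectors in characteristic zero, since `μ ∘ Δ` is multiplication by `2ⁿ` on `Symⁿ(V)` and by `2` on
primitive elements (`eq_symι_of_primitive`).

Finally, the coproduct of a monomial is a sum over all colourings of its letters, each with the
sign of its inversions (`symComul_mon`), so that `Ψ(R)` of a monomial is a sum over colourings
(`psi_mon`). Shuffles are the stable sorts of colourings with prescribed sizes of the colour
classes (`sum_blockShuffle`), which turns this sum into the sum over shuffles
(`hatSum_eq_sum_colourings`).
-/

namespace PostLie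

/-! ### The shuffle coproduct of `Sym(V)` -/

section Coproduct

variable {K V : Type*} [Field K] [AddCommGroup V] [Module K V] (𝒱 : ℤ → Submodule K V)

theorem sgn_mul_self (n : ℤ) : sgn K n * sgn K n = 1 := by
  rw [sgn, ← Int.cast_mul, ← Units.val_mul, Int.units_mul_self]; simp

@[simp] theorem sgn_zero : sgn K 0 = 1 := by simp [sgn]

theorem sgn_mul_sum_cons (k a b : ℤ) : sgn K (k * (a + b)) = sgn K (k * a) * sgn K (k * b) := by
  rw [mul_add, sgn_add]

/-- Induction on `Sym(V)`: a subspace that contains `1` and is stable under left multiplication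
by homogeneous vectors is everything. -/
theorem gsym_induction [DirectSum.Decomposition 𝒱] {S : Submodule K (GSym 𝒱)} (one : 1 ∈ S)
    (mul : ∀ (i : ℤ) (v : V), v ∈ 𝒱 i → ∀ a ∈ S, symι 𝒱 v * a ∈ S) (a : GSym 𝒱) : a ∈ S := by
  have mul' : ∀ (v : V), ∀ a ∈ S, symι 𝒱 v * a ∈ S := by
    intro v
    induction v using DirectSum.Decomposition.inductionOn 𝒱 with
    | zero => simp
    | homogeneous x => exact mul _ _ x.2
    | add x y hx hy =>
      intro a ha
      rw [map_add, add_mul]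
      exact add_mem (hx a ha) (hy a ha)
  obtain ⟨t, rfl⟩ := RingQuot.mkAlgHom_surjective K (SymRel 𝒱) a
  suffices h : ∀ a ∈ S, RingQuot.mkAlgHom K (SymRel 𝒱) t * a ∈ S by
    simpa using h 1 one
  induction t using TensorAlgebra.induction with
  | algebraMap r =>
    intro a ha
    rw [AlgHom.commutes, ← Algebra.smul_def]
    exact S.smul_mem r ha
  | ι v => exact mul' v
  | mul s t hs ht =>
    intro a ha
    rw [map_mul, mul_assoc]
    exact hs _ (ht a ha)
  | add s t hs ht =>
    intro a ha
    rw [map_add, add_mul]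
    exact add_mem (hs a ha) (ht a ha)

/-- Two linear maps on `Sym(V)` agree if they agree at `1` and if agreement at `a` implies
agreement at `v a` for `v` homogeneous. -/
theorem gsym_linearMap_ext [DirectSum.Decomposition 𝒱] {M : Type*} [AddCommMonoid M] [Module K M]
    {f g : GSym 𝒱 →ₗ[K] M} (one : f 1 = g 1)
    (mul : ∀ (i : ℤ) (v : V), v ∈ 𝒱 i → ∀ a, f a = g a → f (symι 𝒱 v * a) = g (symι 𝒱 v * a)) :
    f = g := by
  ext a
  exact gsym_induction 𝒱 (S := LinearMap.eqLocus f g) one (fun i v hv a ha => mul i v hv a ha) a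

/-- The operator `f ⊗ 1 + τ ⊗ f`. For `f` of degree `k` and `τ` the sign operator
`c ↦ (-1)^{k|c|} c` it is the graded extension of `f` to the tensor square. -/
noncomputable def coact {K C : Type*} [Field K] [AddCommMonoid C] [Module K C] (τ f : C →ₗ[K] C) :
    C ⊗[K] C →ₗ[K] C ⊗[K] C :=
  TensorProduct.map f LinearMap.id + TensorProduct.map τ f

@[simp] theorem coact_tmul {K C : Type*} [Field K] [AddCommMonoid C] [Module K C]
    (τ f : C →ₗ[K] C) (a b : C) : coact τ f (a ⊗ₜ b) = f a ⊗ₜ b + τ a ⊗ₜ f b := rfl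

/-- Left multiplication by the vector `v` on `Sym(V)`. -/
noncomputable def lmul (v : V) : GSym 𝒱 →ₗ[K] GSym 𝒱 := LinearMap.mulLeft K (symι 𝒱 v)

@[simp] theorem lmul_apply (v : V) (a : GSym 𝒱) : lmul 𝒱 v a = symι 𝒱 v * a := rfl

theorem lmul_mem {i d : ℤ} {v : V} (hv : v ∈ 𝒱 i) {a : GSym 𝒱} (ha : a ∈ symGr 𝒱 d) :
    lmul 𝒱 v a ∈ symGr 𝒱 (d + i) :=
  add_comm i d ▸ SetLike.mul_mem_graded (symι_mem 𝒱 hv) ha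

theorem symAug_symι_mul (v : V) (a : GSym 𝒱) : symAug 𝒱 (symι 𝒱 v * a) = 0 := by
  simp [symAug]

variable [DirectSum.Decomposition 𝒱]

/-- A linear map on `Sym(V)` is determined by its values on homogeneous elements. -/
theorem gsym_hom_ext_of_mem {M : Type*} [AddCommMonoid M] [Module K M]
    {f g : GSym 𝒱 →ₗ[K] M} (h : ∀ (d : ℤ), ∀ a ∈ symGr 𝒱 d, f a = g a) : f = g := by
  ext a
  induction a using DirectSum.Decomposition.inductionOn (symGr 𝒱) with
  | zero => simp
  | homogeneous x => exact h _ _ x.2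
  | add x y hx hy => rw [map_add, map_add, hx, hy]

/-- The operator `a ↦ (-1)^{k|a|} a` of `Sym(V)`. -/
noncomputable abbrev tw (k : ℤ) : GSym 𝒱 →ₗ[K] GSym 𝒱 := twist (symGr 𝒱) k

theorem tw_of_mem (k : ℤ) {d : ℤ} {a : GSym 𝒱} (ha : a ∈ symGr 𝒱 d) :
    tw 𝒱 k a = sgn K (k * d) • a := twist_of_mem _ _ ha

theorem tw_mem (k : ℤ) {d : ℤ} {a : GSym 𝒱} (ha : a ∈ symGr 𝒱 d) : tw 𝒱 k a ∈ symGr 𝒱 d := by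
  rw [tw_of_mem 𝒱 k ha]; exact Submodule.smul_mem _ _ ha

@[simp] theorem tw_one (k : ℤ) : tw 𝒱 k 1 = 1 := by
  rw [tw_of_mem 𝒱 k (SetLike.GradedOne.one_mem (A := symGr 𝒱))]; simp

theorem tw_symι_mul (k : ℤ) {i : ℤ} {v : V} (hv : v ∈ 𝒱 i) (a : GSym 𝒱) :
    tw 𝒱 k (symι 𝒱 v * a) = sgn K (k * i) • (symι 𝒱 v * tw 𝒱 k a) := by
  suffices h : tw 𝒱 k ∘ₗ lmul 𝒱 v = sgn K (k * i) • (lmul 𝒱 v ∘ₗ tw 𝒱 k) from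
    LinearMap.congr_fun h a
  refine gsym_hom_ext_of_mem 𝒱 fun d a ha => ?_
  simp only [LinearMap.comp_apply, LinearMap.smul_apply]
  rw [tw_of_mem 𝒱 k ha, tw_of_mem 𝒱 k (lmul_mem 𝒱 hv ha), map_smul, smul_smul, add_comm d i,
    sgn_mul_sum_cons]

theorem tw_comp_lmul (k : ℤ) {i : ℤ} {v : V} (hv : v ∈ 𝒱 i) :
    tw 𝒱 k ∘ₗ lmul 𝒱 v = sgn K (k * i) • (lmul 𝒱 v ∘ₗ tw 𝒱 k) :=
  LinearMap.ext fun a => tw_symι_mul 𝒱 k hv a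

theorem tw_tw (k l : ℤ) (a : GSym 𝒱) : tw 𝒱 k (tw 𝒱 l a) = tw 𝒱 (k + l) a := by
  suffices h : tw 𝒱 k ∘ₗ tw 𝒱 l = tw 𝒱 (k + l) from LinearMap.congr_fun h a
  refine gsym_hom_ext_of_mem 𝒱 fun d a ha => ?_
  rw [LinearMap.comp_apply, tw_of_mem 𝒱 l ha, map_smul, tw_of_mem 𝒱 k ha, tw_of_mem 𝒱 _ ha,
    smul_smul, add_mul, sgn_add, mul_comm]

theorem tw_comp_tw (k l : ℤ) : tw 𝒱 k ∘ₗ tw 𝒱 l = tw 𝒱 (k + l) :=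
  LinearMap.ext fun a => tw_tw 𝒱 k l a

theorem tw_comm (k l : ℤ) (a : GSym 𝒱) : tw 𝒱 k (tw 𝒱 l a) = tw 𝒱 l (tw 𝒱 k a) := by
  rw [tw_tw, tw_tw, add_comm]

/-- The counit vanishes in nonzero degrees. -/
theorem symAug_tw (k : ℤ) (a : GSym 𝒱) : symAug 𝒱 (tw 𝒱 k a) = symAug 𝒱 a := by
  suffices h : (symAug 𝒱).toLinearMap ∘ₗ tw 𝒱 k = (symAug 𝒱).toLinearMap from
    LinearMap.congr_fun h a
  refine gsym_linearMap_ext 𝒱 (by simp) fun i v hv a ha => ?_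
  simp only [LinearMap.comp_apply, AlgHom.toLinearMap_apply] at ha ⊢
  rw [tw_symι_mul 𝒱 k hv, map_smul, symAug_symι_mul, symAug_symι_mul, smul_zero]

@[simp] theorem symComul_one : symComul 𝒱 1 = 1 ⊗ₜ 1 := by
  simp only [symComul, LinearMap.comp_apply, AlgHom.toLinearMap_apply, map_one]
  rfl

/-- The recursion for the coproduct: `Δ(v a) = (v ⊗ 1 + 1 ⊗ v) Δ(a)`. -/
theorem symComul_symι_mul {i : ℤ} {v : V} (hv : v ∈ 𝒱 i) (a : GSym 𝒱) :
    symComul 𝒱 (symι 𝒱 v * a) =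
      coact (tw 𝒱 i) (lmul 𝒱 v) (symComul 𝒱 a) := by
  simp only [symComul, LinearMap.comp_apply, AlgHom.toLinearMap_apply, map_mul]
  generalize symComulAlg 𝒱 a = t
  rw [show symComulAlg 𝒱 (symι 𝒱 v) =
    GradedTensorProduct.includeLeft (R := K) (symGr 𝒱) (symGr 𝒱) (symι 𝒱 v) +
    GradedTensorProduct.includeRight (R := K) (symGr 𝒱) (symGr 𝒱) (symι 𝒱 v) from
      symLift_symι _ _ _ _]
  obtain ⟨t, rfl⟩ := (GradedTensorProduct.of K (symGr 𝒱) (symGr 𝒱)).surjective t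
  simp only [LinearEquiv.coe_coe, GradedTensorProduct.of_symm_of]
  induction t using TensorProduct.induction_on with
  | zero => simp
  | add x y hx hy => simp only [map_add, mul_add, hx, hy]
  | tmul a b =>
    induction a using DirectSum.Decomposition.inductionOn (symGr 𝒱) with
    | zero => simp
    | add x y hx hy => simp only [TensorProduct.add_tmul, map_add, mul_add, hx, hy]
    | @homogeneous d x =>
      have e1 := GradedTensorProduct.tmul_one_mul_coe_tmul (R := K) (symGr 𝒱) (symGr 𝒱)
        (symι 𝒱 v) x b
      have e2 := GradedTensorProduct.tmul_coe_mul_coe_tmul (R := K) (symGr 𝒱) (symGr 𝒱) 1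
        ⟨symι 𝒱 v, symι_mem 𝒱 hv⟩ x b
      rw [neg_one_smul_eq (K := K), one_mul] at e2
      simp only [GradedTensorProduct.includeLeft_apply, GradedTensorProduct.includeRight_apply,
        add_mul]
      refine (congrArg (GradedTensorProduct.of K (symGr 𝒱) (symGr 𝒱)).symm
        (congrArg₂ (· + ·) e1 e2)).trans ?_
      simp only [coact_tmul, lmul_apply,
        tw_of_mem 𝒱 i x.2, map_add, map_smul, ← TensorProduct.smul_tmul']
      rfl

theorem symComul_comp_lmul {i : ℤ} {v : V} (hv : v ∈ 𝒱 i) :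
    symComul 𝒱 ∘ₗ lmul 𝒱 v =
      coact (tw 𝒱 i) (lmul 𝒱 v) ∘ₗ symComul 𝒱 :=
  LinearMap.ext fun a => symComul_symι_mul 𝒱 hv a

theorem symComul_comp_tw (k : ℤ) :
    symComul 𝒱 ∘ₗ tw 𝒱 k = TensorProduct.map (tw 𝒱 k) (tw 𝒱 k) ∘ₗ symComul 𝒱 := by
  refine gsym_linearMap_ext 𝒱 (by simp) fun i v hv a ha => ?_
  simp only [LinearMap.comp_apply] at ha ⊢
  rw [tw_symι_mul 𝒱 k hv, map_smul, symComul_symι_mul 𝒱 hv, symComul_symι_mul 𝒱 hv, ha]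
  generalize symComul 𝒱 a = t
  induction t using TensorProduct.induction_on with
  | zero => simp
  | add x y hx hy => simp only [map_add, smul_add, hx, hy]
  | tmul a b =>
    simp only [coact_tmul, TensorProduct.map_tmul, lmul_apply,
      map_add, tw_symι_mul 𝒱 k hv, smul_add, TensorProduct.smul_tmul', TensorProduct.tmul_smul,
      tw_comm 𝒱 i k]

theorem symComul_tw (k : ℤ) (a : GSym 𝒱) :
    symComul 𝒱 (tw 𝒱 k a) = TensorProduct.map (tw 𝒱 k) (tw 𝒱 k) (symComul 𝒱 a) :=
  LinearMap.congr_fun (symComul_comp_tw 𝒱 k) a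

/-- Coassociativity of the shuffle coproduct. -/
theorem symComul_coassoc :
    (TensorProduct.assoc K _ _ _).toLinearMap ∘ₗ LinearMap.rTensor (GSym 𝒱) (symComul 𝒱) ∘ₗ
      symComul 𝒱 = LinearMap.lTensor (GSym 𝒱) (symComul 𝒱) ∘ₗ symComul 𝒱 := by
  refine gsym_linearMap_ext 𝒱 (by simp) fun i v hv a ha => ?_
  -- the action of `v` on `Sym(V) ⊗ Sym(V) ⊗ Sym(V)`
  let T : GSym 𝒱 ⊗[K] (GSym 𝒱 ⊗[K] GSym 𝒱) →ₗ[K] GSym 𝒱 ⊗[K] (GSym 𝒱 ⊗[K] GSym 𝒱) :=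
    TensorProduct.map (lmul 𝒱 v) LinearMap.id +
      TensorProduct.map (tw 𝒱 i) (coact (tw 𝒱 i) (lmul 𝒱 v))
  have h1 : (TensorProduct.assoc K _ _ _).toLinearMap ∘ₗ
      LinearMap.rTensor (GSym 𝒱) (symComul 𝒱) ∘ₗ coact (tw 𝒱 i) (lmul 𝒱 v) =
      T ∘ₗ (TensorProduct.assoc K _ _ _).toLinearMap ∘ₗ
        LinearMap.rTensor (GSym 𝒱) (symComul 𝒱) := by
    ext a b
    simp only [TensorProduct.AlgebraTensorModule.curry_apply, LinearMap.restrictScalars_self,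
      TensorProduct.curry_apply, LinearMap.comp_apply, coact_tmul, lmul_apply,
      LinearMap.rTensor_tmul, map_add, symComul_symι_mul 𝒱 hv, symComul_tw]
    generalize symComul 𝒱 a = t
    induction t using TensorProduct.induction_on with
    | zero => simp
    | add x y hx hy =>
      simp only [map_add, TensorProduct.add_tmul] at hx hy ⊢
      rw [← hx, ← hy]
      abel
    | tmul c d => simp [T, TensorProduct.add_tmul, TensorProduct.tmul_add, add_assoc]
  have h2 : LinearMap.lTensor (GSym 𝒱) (symComul 𝒱) ∘ₗ coact (tw 𝒱 i) (lmul 𝒱 v) =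
      T ∘ₗ LinearMap.lTensor (GSym 𝒱) (symComul 𝒱) := by
    ext a b
    simp [T, symComul_symι_mul 𝒱 hv]
  have e1 := LinearMap.congr_fun h1 (symComul 𝒱 a)
  have e2 := LinearMap.congr_fun h2 (symComul 𝒱 a)
  simp only [LinearMap.comp_apply] at e1 e2 ha ⊢
  rw [symComul_symι_mul 𝒱 hv, e1, e2, ha]

theorem symAug_rTensor_comul :
    LinearMap.rTensor (GSym 𝒱) (symAug 𝒱).toLinearMap ∘ₗ symComul 𝒱 =
      (TensorProduct.lid K (GSym 𝒱)).symm.toLinearMap := by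
  refine gsym_linearMap_ext 𝒱 (by simp) fun i v hv a ha => ?_
  simp only [LinearMap.comp_apply] at ha ⊢
  rw [symComul_symι_mul 𝒱 hv]
  have : LinearMap.rTensor (GSym 𝒱) (symAug 𝒱).toLinearMap ∘ₗ
      coact (tw 𝒱 i) (lmul 𝒱 v) =
      LinearMap.lTensor K (lmul 𝒱 v) ∘ₗ LinearMap.rTensor (GSym 𝒱) (symAug 𝒱).toLinearMap := by
    ext a b
    simp [symAug_symι_mul, symAug_tw]
  refine (LinearMap.congr_fun this (symComul 𝒱 a)).trans ?_
  rw [LinearMap.comp_apply, ha]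
  simp

theorem symAug_lTensor_comul :
    LinearMap.lTensor (GSym 𝒱) (symAug 𝒱).toLinearMap ∘ₗ symComul 𝒱 =
      (TensorProduct.rid K (GSym 𝒱)).symm.toLinearMap := by
  refine gsym_linearMap_ext 𝒱 (by simp) fun i v hv a ha => ?_
  simp only [LinearMap.comp_apply] at ha ⊢
  rw [symComul_symι_mul 𝒱 hv]
  have : LinearMap.lTensor (GSym 𝒱) (symAug 𝒱).toLinearMap ∘ₗ
      coact (tw 𝒱 i) (lmul 𝒱 v) =
      LinearMap.rTensor K (lmul 𝒱 v) ∘ₗ LinearMap.lTensor (GSym 𝒱) (symAug 𝒱).toLinearMap := by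
    ext a b
    simp [symAug_symι_mul]
  refine (LinearMap.congr_fun this (symComul 𝒱 a)).trans ?_
  rw [LinearMap.comp_apply, ha]
  simp

end Coproduct

/-! ### Coderivations of `Sym(V)` -/

section SymCoderivation

variable {K V : Type*} [Field K] [AddCommGroup V] [Module K V] (𝒱 : ℤ → Submodule K V)

variable [DirectSum.Decomposition 𝒱]

omit [DirectSum.Decomposition 𝒱] in
/-- Graded induction on `Sym(V)`. -/
theorem symGr_induction {S : ℤ → Submodule K (GSym 𝒱)} (one : 1 ∈ S 0)
    (mul : ∀ (i : ℤ) (v : V), v ∈ 𝒱 i → ∀ (d : ℤ), ∀ a ∈ S d, symι 𝒱 v * a ∈ S (d + i)) {d : ℤ}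
    {a : GSym 𝒱} (ha : a ∈ symGr 𝒱 d) : a ∈ S d := by
  refine (Submodule.span_le (p := S d)).2 ?_ ha
  clear ha
  rintro _ ⟨l, hl, rfl, rfl⟩
  induction l with
  | nil => simpa using one
  | cons p l ih =>
    simp only [List.map_cons, mon_cons, List.sum_cons]
    rw [add_comm p.1]
    exact mul _ _ (hl p List.mem_cons_self) _ _
      (ih fun q hq => hl q (List.mem_cons_of_mem _ hq))

@[simp] theorem tw_zero : tw 𝒱 0 = LinearMap.id := by
  refine gsym_hom_ext_of_mem 𝒱 fun d a ha => ?_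
  rw [tw_of_mem 𝒱 0 ha]; simp

theorem tw_comp_self (k : ℤ) : tw 𝒱 k ∘ₗ tw 𝒱 k = LinearMap.id := by
  refine gsym_hom_ext_of_mem 𝒱 fun d a ha => ?_
  rw [LinearMap.comp_apply, tw_of_mem 𝒱 k ha, map_smul, tw_of_mem 𝒱 k ha, smul_smul,
    sgn_mul_self, one_smul, LinearMap.id_apply]

/-- The degree `d` part of `Sym(V) ⊗ Sym(V)`. -/
def tensGr (d : ℤ) : Submodule K (GSym 𝒱 ⊗[K] GSym 𝒱) :=
  Submodule.span K {c | ∃ (a b : ℤ) (X Y : GSym 𝒱), X ∈ symGr 𝒱 a ∧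
    Y ∈ symGr 𝒱 b ∧ a + b = d ∧ X ⊗ₜ[K] Y = c}

omit [DirectSum.Decomposition 𝒱] in
theorem tmul_mem_tensGr {a b : ℤ} {X Y : GSym 𝒱} (hX : X ∈ symGr 𝒱 a) (hY : Y ∈ symGr 𝒱 b) :
    X ⊗ₜ[K] Y ∈ tensGr 𝒱 (a + b) :=
  Submodule.subset_span ⟨a, b, X, Y, hX, hY, rfl, rfl⟩

theorem tens_ext_of_mem {M : Type*} [AddCommMonoid M] [Module K M]
    {f g : GSym 𝒱 ⊗[K] GSym 𝒱 →ₗ[K] M}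
    (h : ∀ (i j : ℤ), ∀ a ∈ symGr 𝒱 i, ∀ b ∈ symGr 𝒱 j, f (a ⊗ₜ b) = g (a ⊗ₜ b)) : f = g := by
  apply TensorProduct.ext
  refine gsym_hom_ext_of_mem 𝒱 fun i a ha => ?_
  refine gsym_hom_ext_of_mem 𝒱 fun j b hb => ?_
  exact h i j a ha b hb

theorem quad_ext_of_mem {M : Type*} [AddCommMonoid M] [Module K M]
    {f g : (GSym 𝒱 ⊗[K] GSym 𝒱) ⊗[K] (GSym 𝒱 ⊗[K] GSym 𝒱) →ₗ[K] M}
    (h : ∀ (p q r s : ℤ), ∀ a ∈ symGr 𝒱 p, ∀ b ∈ symGr 𝒱 q, ∀ c ∈ symGr 𝒱 r, ∀ d ∈ symGr 𝒱 s,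
      f ((a ⊗ₜ b) ⊗ₜ (c ⊗ₜ d)) = g ((a ⊗ₜ b) ⊗ₜ (c ⊗ₜ d))) : f = g := by
  apply TensorProduct.ext
  refine tens_ext_of_mem 𝒱 fun p q a ha b hb => ?_
  refine tens_ext_of_mem 𝒱 fun r s c hc d hd => ?_
  exact h p q r s a ha b hb c hc d hd

/-- The operator `c ↦ (-1)^{k|c|} c` of `Sym(V) ⊗ Sym(V)`. -/
noncomputable def twC (k : ℤ) : GSym 𝒱 ⊗[K] GSym 𝒱 →ₗ[K] GSym 𝒱 ⊗[K] GSym 𝒱 :=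
  TensorProduct.map (tw 𝒱 k) (tw 𝒱 k)

theorem twC_of_mem (k : ℤ) {d : ℤ} {c : GSym 𝒱 ⊗[K] GSym 𝒱} (hc : c ∈ tensGr 𝒱 d) :
    twC 𝒱 k c = sgn K (k * d) • c := by
  induction hc using Submodule.span_induction with
  | mem c h =>
    obtain ⟨a, b, X, Y, hX, hY, rfl, rfl⟩ := h
    rw [twC, TensorProduct.map_tmul, tw_of_mem 𝒱 k hX, tw_of_mem 𝒱 k hY,
      TensorProduct.smul_tmul_smul, sgn_mul_sum_cons]
  | zero => simp
  | add x y _ _ hx hy => rw [map_add, hx, hy, smul_add]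
  | smul r x _ hx => rw [map_smul, hx, smul_comm]

theorem twC_comp_twC (k l : ℤ) : twC 𝒱 k ∘ₗ twC 𝒱 l = twC 𝒱 (k + l) := by
  rw [twC, twC, ← TensorProduct.map_comp, tw_comp_tw, twC]

/-- A linear map of degree `k` on `Sym(V)` commutes with the sign operators up to sign. -/
theorem comp_tw_of_degree {k : ℤ} {f : GSym 𝒱 →ₗ[K] GSym 𝒱}
    (hf : ∀ d, ∀ a ∈ symGr 𝒱 d, f a ∈ symGr 𝒱 (d + k)) (w : ℤ) :
    f ∘ₗ tw 𝒱 w = sgn K (k * w) • (tw 𝒱 w ∘ₗ f) := by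
  refine gsym_hom_ext_of_mem 𝒱 fun d a ha => ?_
  simp only [LinearMap.comp_apply, LinearMap.smul_apply]
  rw [tw_of_mem 𝒱 w ha, map_smul, tw_of_mem 𝒱 w (hf d a ha), smul_smul, sgn_mul_sum_cons,
    mul_left_comm, mul_comm w k, sgn_mul_self, mul_one]

theorem comp_twC_of_degree {k : ℤ} {f : GSym 𝒱 ⊗[K] GSym 𝒱 →ₗ[K] GSym 𝒱 ⊗[K] GSym 𝒱}
    (hf : ∀ d, ∀ a ∈ tensGr 𝒱 d, f a ∈ tensGr 𝒱 (d + k)) (w : ℤ) :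
    f ∘ₗ twC 𝒱 w = sgn K (k * w) • (twC 𝒱 w ∘ₗ f) := by
  refine tens_ext_of_mem 𝒱 fun i j a ha b hb => ?_
  have h := tmul_mem_tensGr 𝒱 ha hb
  simp only [LinearMap.comp_apply, LinearMap.smul_apply]
  rw [twC_of_mem 𝒱 w h, map_smul, twC_of_mem 𝒱 w (hf _ _ h), smul_smul,
    sgn_mul_sum_cons w (i + j) k,
    mul_left_comm, mul_comm w k, sgn_mul_self, mul_one]

section Step

variable {C : Type*} [AddCommMonoid C] [Module K C]

/-- If `f M = f' ± M f`, where `τₖ`, `τᵢ`, `τₖᵢ` are the sign operators belonging to the degrees of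
`f`, `M`, `f'`, then the extensions to the tensor square satisfy the same relation. -/
theorem coact_comp_coact {τk τi τki M f f' : C →ₗ[K] C} {s : K} (h1 : f ∘ₗ M = f' + s • (M ∘ₗ f))
    (h2 : τk ∘ₗ M = s • (M ∘ₗ τk)) (h3 : f ∘ₗ τi = s • (τi ∘ₗ f)) (h4 : τk ∘ₗ τi = τki)
    (h5 : τi ∘ₗ τk = τki) :
    coact τk f ∘ₗ coact τi M = coact τki f' + s • (coact τi M ∘ₗ coact τk f) := by
  simp only [coact, LinearMap.add_comp, LinearMap.comp_add, ← TensorProduct.map_comp, h1, h2, h3,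
    h4, h5, LinearMap.id_comp, LinearMap.comp_id, TensorProduct.map_add_left,
    TensorProduct.map_add_right, TensorProduct.map_smul_left, TensorProduct.map_smul_right,
    smul_add]
  abel

/-- The induction step for the coderivation property: if `f M = f' ± M f` and `M` is compatible with
`Δ`, then the coderivation rules for `f` and `f'` at `c` give the rule for `f` at `M c`. -/
theorem coder_step {Δ : C →ₗ[K] C ⊗[K] C} {τk τi τki M f f' : C →ₗ[K] C} {s : K}
    (hM : Δ ∘ₗ M = coact τi M ∘ₗ Δ) (h1 : f ∘ₗ M = f' + s • (M ∘ₗ f))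
    (h2 : τk ∘ₗ M = s • (M ∘ₗ τk)) (h3 : f ∘ₗ τi = s • (τi ∘ₗ f)) (h4 : τk ∘ₗ τi = τki)
    (h5 : τi ∘ₗ τk = τki) {c : C} (hf : Δ (f c) = coact τk f (Δ c))
    (hf' : Δ (f' c) = coact τki f' (Δ c)) : Δ (f (M c)) = coact τk f (Δ (M c)) := by
  have e1 := LinearMap.congr_fun h1 c
  have e2 := LinearMap.congr_fun (coact_comp_coact h1 h2 h3 h4 h5) (Δ c)
  have e3 := LinearMap.congr_fun hM c
  have e4 := LinearMap.congr_fun hM (f c)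
  simp only [LinearMap.comp_apply, LinearMap.add_apply, LinearMap.smul_apply] at e1 e2 e3 e4
  rw [e1, e3, e2, map_add, map_smul, e4, hf, hf']

end Step

/-- The map `f_ρ : X ↦ ∑ ρ(X₁) X₂` of `Sym(V)` defined by a linear map `ρ : Sym(V) → V`; it is the
coderivation of `Sym(V)` with corestriction `ρ`. -/
noncomputable def symCoder (ρ : GSym 𝒱 →ₗ[K] V) : GSym 𝒱 →ₗ[K] GSym 𝒱 :=
  LinearMap.mul' K (GSym 𝒱) ∘ₗ LinearMap.rTensor (GSym 𝒱) (symι 𝒱 ∘ₗ ρ) ∘ₗ symComul 𝒱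

/-- The linear maps `Sym(V) → V` of degree `k`. -/
def SymHomDeg (k : ℤ) (ρ : GSym 𝒱 →ₗ[K] V) : Prop := ∀ d, ∀ a ∈ symGr 𝒱 d, ρ a ∈ 𝒱 (d + k)

variable {𝒱} in
omit [DirectSum.Decomposition 𝒱] in
theorem SymHomDeg.comp_lmul {k i : ℤ} {ρ : GSym 𝒱 →ₗ[K] V} (hρ : SymHomDeg 𝒱 k ρ) {v : V}
    (hv : v ∈ 𝒱 i) : SymHomDeg 𝒱 (k + i) (ρ ∘ₗ lmul 𝒱 v) := fun d a ha => by
  have := hρ _ _ (lmul_mem 𝒱 hv ha)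
  rwa [add_assoc, add_comm i k] at this

theorem symCoder_one (ρ : GSym 𝒱 →ₗ[K] V) : symCoder 𝒱 ρ 1 = symι 𝒱 (ρ 1) := by
  simp [symCoder]

theorem symCoder_comp_lmul {k i : ℤ} {ρ : GSym 𝒱 →ₗ[K] V} (hρ : SymHomDeg 𝒱 k ρ) {v : V}
    (hv : v ∈ 𝒱 i) : symCoder 𝒱 ρ ∘ₗ lmul 𝒱 v =
      symCoder 𝒱 (ρ ∘ₗ lmul 𝒱 v) + sgn K (k * i) • (lmul 𝒱 v ∘ₗ symCoder 𝒱 ρ) := by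
  have h : LinearMap.mul' K (GSym 𝒱) ∘ₗ LinearMap.rTensor (GSym 𝒱) (symι 𝒱 ∘ₗ ρ) ∘ₗ
      coact (tw 𝒱 i) (lmul 𝒱 v) =
      LinearMap.mul' K (GSym 𝒱) ∘ₗ LinearMap.rTensor (GSym 𝒱) (symι 𝒱 ∘ₗ ρ ∘ₗ lmul 𝒱 v) +
      sgn K (k * i) • (lmul 𝒱 v ∘ₗ
        LinearMap.mul' K (GSym 𝒱) ∘ₗ LinearMap.rTensor (GSym 𝒱) (symι 𝒱 ∘ₗ ρ)) := by
    refine tens_ext_of_mem 𝒱 fun p q a ha b hb => ?_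
    simp only [LinearMap.comp_apply, coact_tmul, map_add, LinearMap.rTensor_tmul,
      LinearMap.mul'_apply, LinearMap.add_apply, LinearMap.smul_apply, lmul_apply,
      tw_of_mem 𝒱 i ha, map_smul, smul_mul_assoc]
    rw [← mul_assoc, symι_mul_symι 𝒱 (hρ _ _ ha) hv, smul_mul_assoc, smul_smul, mul_assoc,
      mul_comm (p + k) i, sgn_mul_sum_cons, ← mul_assoc, sgn_mul_self, one_mul, mul_comm i k]
  rw [symCoder, LinearMap.comp_assoc, LinearMap.comp_assoc, symComul_comp_lmul 𝒱 hv]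
  have := congrArg (fun t => t ∘ₗ symComul 𝒱) h
  simpa only [symCoder, LinearMap.comp_assoc, LinearMap.add_comp, LinearMap.smul_comp] using this

theorem symCoder_mem {k : ℤ} {ρ : GSym 𝒱 →ₗ[K] V} (hρ : SymHomDeg 𝒱 k ρ) {d : ℤ} {a : GSym 𝒱}
    (ha : a ∈ symGr 𝒱 d) : symCoder 𝒱 ρ a ∈ symGr 𝒱 (d + k) := by
  let S : ℤ → Submodule K (GSym 𝒱) := fun d =>
    ⨅ (k : ℤ) (ρ : GSym 𝒱 →ₗ[K] V) (_ : SymHomDeg 𝒱 k ρ),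
      (symGr 𝒱 (d + k)).comap (symCoder 𝒱 ρ)
  have : a ∈ S d := by
    refine symGr_induction 𝒱 ?_ ?_ ha
    · simp only [S, Submodule.mem_iInf, Submodule.mem_comap]
      intro k ρ hρ
      rw [symCoder_one]
      exact symι_mem 𝒱 (hρ 0 1 (SetLike.GradedOne.one_mem (A := symGr 𝒱)))
    · simp only [S, Submodule.mem_iInf, Submodule.mem_comap]
      intro i v hv d a ih k ρ hρ
      have e := LinearMap.congr_fun (symCoder_comp_lmul 𝒱 hρ hv) a
      simp only [LinearMap.comp_apply, lmul_apply, LinearMap.add_apply, LinearMap.smul_apply] at e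
      rw [e]
      refine add_mem ?_ (Submodule.smul_mem _ _ ?_)
      · have := ih _ _ (hρ.comp_lmul hv)
        rwa [← add_assoc, add_right_comm] at this
      · have := lmul_mem 𝒱 hv (ih _ _ hρ)
        rwa [add_right_comm] at this
  simp only [S, Submodule.mem_iInf, Submodule.mem_comap] at this
  exact this k ρ hρ

/-- `f_ρ` is a coderivation of `Sym(V)`. -/
theorem symComul_comp_symCoder {k : ℤ} {ρ : GSym 𝒱 →ₗ[K] V} (hρ : SymHomDeg 𝒱 k ρ) :
    symComul 𝒱 ∘ₗ symCoder 𝒱 ρ = coact (tw 𝒱 k) (symCoder 𝒱 ρ) ∘ₗ symComul 𝒱 := by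
  let S : Submodule K (GSym 𝒱) := ⨅ (k : ℤ) (ρ : GSym 𝒱 →ₗ[K] V) (_ : SymHomDeg 𝒱 k ρ),
    LinearMap.eqLocus (symComul 𝒱 ∘ₗ symCoder 𝒱 ρ)
      (coact (tw 𝒱 k) (symCoder 𝒱 ρ) ∘ₗ symComul 𝒱)
  have : ∀ a, a ∈ S := by
    refine gsym_induction 𝒱 ?_ ?_
    · simp only [S, Submodule.mem_iInf, LinearMap.mem_eqLocus, LinearMap.comp_apply]
      intro k ρ hρ
      have h1 : ρ 1 ∈ 𝒱 (0 + k) := hρ 0 1 (SetLike.GradedOne.one_mem (A := symGr 𝒱))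
      have := symComul_symι_mul 𝒱 h1 1
      rw [symCoder_one]
      rw [mul_one] at this
      simp [this, symCoder_one]
    · simp only [S, Submodule.mem_iInf, LinearMap.mem_eqLocus, LinearMap.comp_apply]
      intro i v hv a ih k ρ hρ
      refine coder_step (symComul_comp_lmul 𝒱 hv) (symCoder_comp_lmul 𝒱 hρ hv)
        (tw_comp_lmul 𝒱 k hv) (comp_tw_of_degree 𝒱 (fun d a ha => symCoder_mem 𝒱 hρ ha) i)
        (tw_comp_tw 𝒱 k i) ?_ (ih k ρ hρ) (ih _ _ (hρ.comp_lmul hv))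
      rw [tw_comp_tw, add_comm]
  ext a
  have h := this a
  simp only [S, Submodule.mem_iInf, LinearMap.mem_eqLocus] at h
  exact h k ρ hρ

end SymCoderivation

/-! ### Coderivations of `Sym(V) ⊗ Sym(V)` -/

section TensorCoderivation

variable {K V : Type*} [Field K] [AddCommGroup V] [Module K V] (𝒱 : ℤ → Submodule K V)

variable [DirectSum.Decomposition 𝒱]

/-- The multiplication by a vector `v` of the first copy of `V` on `Sym(V) ⊗ Sym(V)`:
`X ⊗ Y ↦ v X ⊗ Y`. -/
noncomputable def lmulFst (v : V) : GSym 𝒱 ⊗[K] GSym 𝒱 →ₗ[K] GSym 𝒱 ⊗[K] GSym 𝒱 :=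
  LinearMap.rTensor (GSym 𝒱) (lmul 𝒱 v)

/-- The multiplication by a vector `v` of degree `i` of the second copy of `V` on
`Sym(V) ⊗ Sym(V)`: `X ⊗ Y ↦ (-1)^{i|X|} X ⊗ v Y`. -/
noncomputable def lmulSnd (i : ℤ) (v : V) : GSym 𝒱 ⊗[K] GSym 𝒱 →ₗ[K] GSym 𝒱 ⊗[K] GSym 𝒱 :=
  TensorProduct.map (tw 𝒱 i) (lmul 𝒱 v)

omit [DirectSum.Decomposition 𝒱] in
@[simp] theorem lmulFst_tmul (v : V) (X Y : GSym 𝒱) :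
    lmulFst 𝒱 v (X ⊗ₜ Y) = (symι 𝒱 v * X) ⊗ₜ Y := rfl

@[simp] theorem lmulSnd_tmul (i : ℤ) (v : V) (X Y : GSym 𝒱) :
    lmulSnd 𝒱 i v (X ⊗ₜ Y) = tw 𝒱 i X ⊗ₜ (symι 𝒱 v * Y) := rfl

omit [DirectSum.Decomposition 𝒱] in
/-- A linear map that sends `X ⊗ Y` into degree `|X| + |Y| + k` has degree `k`. -/
theorem tensGr_le_comap {M : Type*} [AddCommMonoid M] [Module K M] {ℳ : ℤ → Submodule K M} {k : ℤ}
    {f : GSym 𝒱 ⊗[K] GSym 𝒱 →ₗ[K] M}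
    (hf : ∀ (i j : ℤ), ∀ a ∈ symGr 𝒱 i, ∀ b ∈ symGr 𝒱 j, f (a ⊗ₜ b) ∈ ℳ (i + j + k)) {d : ℤ}
    {c : GSym 𝒱 ⊗[K] GSym 𝒱} (hc : c ∈ tensGr 𝒱 d) : f c ∈ ℳ (d + k) := by
  refine (Submodule.span_le (p := (ℳ (d + k)).comap f)).2 ?_ hc
  rintro _ ⟨a, b, X, Y, hX, hY, rfl, rfl⟩
  exact hf a b X hX Y hY

omit [DirectSum.Decomposition 𝒱] in
theorem lmulFst_mem {i d : ℤ} {v : V} (hv : v ∈ 𝒱 i) {c : GSym 𝒱 ⊗[K] GSym 𝒱}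
    (hc : c ∈ tensGr 𝒱 d) : lmulFst 𝒱 v c ∈ tensGr 𝒱 (d + i) := by
  refine tensGr_le_comap 𝒱 (ℳ := tensGr 𝒱) (fun p q a ha b hb => ?_) hc
  rw [add_right_comm]
  exact tmul_mem_tensGr 𝒱 (lmul_mem 𝒱 hv ha) hb

theorem lmulSnd_mem {i d : ℤ} {v : V} (hv : v ∈ 𝒱 i) {c : GSym 𝒱 ⊗[K] GSym 𝒱}
    (hc : c ∈ tensGr 𝒱 d) : lmulSnd 𝒱 i v c ∈ tensGr 𝒱 (d + i) := by
  refine tensGr_le_comap 𝒱 (ℳ := tensGr 𝒱) (fun p q a ha b hb => ?_) hc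
  rw [add_assoc]
  exact tmul_mem_tensGr 𝒱 (tw_mem 𝒱 i ha) (lmul_mem 𝒱 hv hb)

theorem twC_comp_lmulFst (k : ℤ) {i : ℤ} {v : V} (hv : v ∈ 𝒱 i) :
    twC 𝒱 k ∘ₗ lmulFst 𝒱 v = sgn K (k * i) • (lmulFst 𝒱 v ∘ₗ twC 𝒱 k) := by
  ext a b
  simp [twC, tw_symι_mul 𝒱 k hv, TensorProduct.smul_tmul']

theorem twC_comp_lmulSnd (k : ℤ) {i : ℤ} {v : V} (hv : v ∈ 𝒱 i) :
    twC 𝒱 k ∘ₗ lmulSnd 𝒱 i v = sgn K (k * i) • (lmulSnd 𝒱 i v ∘ₗ twC 𝒱 k) := by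
  ext a b
  simp [twC, tw_symι_mul 𝒱 k hv, tw_comm 𝒱 k i]

/-- Graded induction on `Sym(V) ⊗ Sym(V)`, which is generated from `1 ⊗ 1` by the multiplications
by the vectors of the two copies of `V`. -/
theorem tensGr_induction {S : ℤ → Submodule K (GSym 𝒱 ⊗[K] GSym 𝒱)} (one : 1 ⊗ₜ 1 ∈ S 0)
    (fst : ∀ (i : ℤ) (v : V), v ∈ 𝒱 i → ∀ (d : ℤ), ∀ c ∈ S d, lmulFst 𝒱 v c ∈ S (d + i))
    (snd : ∀ (i : ℤ) (v : V), v ∈ 𝒱 i → ∀ (d : ℤ), ∀ c ∈ S d, lmulSnd 𝒱 i v c ∈ S (d + i)) {d : ℤ}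
    {c : GSym 𝒱 ⊗[K] GSym 𝒱} (hc : c ∈ tensGr 𝒱 d) : c ∈ S d := by
  have h1 : ∀ j, ∀ Y ∈ symGr 𝒱 j, (1 : GSym 𝒱) ⊗ₜ[K] Y ∈ S j := fun j Y hY =>
    symGr_induction 𝒱 (S := fun j => (S j).comap (TensorProduct.mk K _ (GSym 𝒱) 1)) one
      (fun i v hv d a ha => by simpa using snd i v hv d _ ha) hY
  have h2 : ∀ j, ∀ Y ∈ symGr 𝒱 j, ∀ i, ∀ X ∈ symGr 𝒱 i, X ⊗ₜ[K] Y ∈ S (i + j) :=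
    fun j Y hY i X hX => symGr_induction 𝒱
      (S := fun i => (S (i + j)).comap ((TensorProduct.mk K (GSym 𝒱) _).flip Y))
      (by simpa using h1 j Y hY)
      (fun i v hv d a ha => by
        have := fst i v hv _ _ ha
        rwa [add_right_comm] at this) hX
  have := tensGr_le_comap 𝒱 (ℳ := S) (f := LinearMap.id) (k := 0)
    (fun i j a ha b hb => by rw [add_zero]; exact h2 j b hb i a ha) hc
  simpa using this

/-- Induction on `Sym(V) ⊗ Sym(V)`. -/
theorem tens_induction {S : Submodule K (GSym 𝒱 ⊗[K] GSym 𝒱)} (one : 1 ⊗ₜ 1 ∈ S)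
    (fst : ∀ (i : ℤ) (v : V), v ∈ 𝒱 i → ∀ c ∈ S, lmulFst 𝒱 v c ∈ S)
    (snd : ∀ (i : ℤ) (v : V), v ∈ 𝒱 i → ∀ c ∈ S, lmulSnd 𝒱 i v c ∈ S)
    (c : GSym 𝒱 ⊗[K] GSym 𝒱) : c ∈ S := by
  have h1 : ∀ Y : GSym 𝒱, (1 : GSym 𝒱) ⊗ₜ[K] Y ∈ S :=
    gsym_induction 𝒱 (S := S.comap (TensorProduct.mk K _ (GSym 𝒱) 1)) one
      (fun i v hv a ha => by simpa using snd i v hv _ ha)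
  induction c using TensorProduct.induction_on with
  | zero => exact zero_mem _
  | add x y hx hy => exact add_mem hx hy
  | tmul X Y =>
    exact gsym_induction 𝒱 (S := S.comap ((TensorProduct.mk K (GSym 𝒱) _).flip Y)) (h1 Y)
      (fun i v hv a ha => fst i v hv _ ha) X

/-- The exchange of the two middle factors is natural up to Koszul signs. -/
theorem midSwap_comp_map {w u : ℤ} (A : GSym 𝒱 →ₗ[K] GSym 𝒱) {B C : GSym 𝒱 →ₗ[K] GSym 𝒱}
    (D : GSym 𝒱 →ₗ[K] GSym 𝒱) (hB : ∀ d, ∀ a ∈ symGr 𝒱 d, B a ∈ symGr 𝒱 (d + w))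
    (hC : ∀ d, ∀ a ∈ symGr 𝒱 d, C a ∈ symGr 𝒱 (d + u)) :
    midSwap 𝒱 ∘ₗ TensorProduct.map (TensorProduct.map A B) (TensorProduct.map C D) =
      sgn K (w * u) • (TensorProduct.map (TensorProduct.map A (C ∘ₗ tw 𝒱 w))
        (TensorProduct.map (B ∘ₗ tw 𝒱 u) D) ∘ₗ midSwap 𝒱) := by
  refine quad_ext_of_mem 𝒱 fun p q r s a ha b hb c hc d hd => ?_
  simp only [LinearMap.comp_apply, LinearMap.smul_apply, TensorProduct.map_tmul]
  rw [midSwap_tmul 𝒱 _ _ (hB _ _ hb) (hC _ _ hc), midSwap_tmul 𝒱 _ _ hb hc, map_smul,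
    TensorProduct.map_tmul, TensorProduct.map_tmul, TensorProduct.map_tmul, LinearMap.comp_apply,
    LinearMap.comp_apply, tw_of_mem 𝒱 _ hc, tw_of_mem 𝒱 _ hb, map_smul, map_smul,
    TensorProduct.tmul_smul, ← TensorProduct.smul_tmul', ← TensorProduct.smul_tmul',
    TensorProduct.tmul_smul, smul_smul, smul_smul, smul_smul]
  congr 1
  rw [add_mul, mul_add, mul_add, sgn_add, sgn_add, sgn_add, mul_comm u q]
  ring

/-- The coproduct `∑ (-1)^{|X₂||Y₁|} (X₁ ⊗ Y₁) ⊗ (X₂ ⊗ Y₂)` of `Sym(V) ⊗ Sym(V)`. -/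
noncomputable def tensComul : GSym 𝒱 ⊗[K] GSym 𝒱 →ₗ[K]
    (GSym 𝒱 ⊗[K] GSym 𝒱) ⊗[K] (GSym 𝒱 ⊗[K] GSym 𝒱) :=
  midSwap 𝒱 ∘ₗ TensorProduct.map (symComul 𝒱) (symComul 𝒱)

omit [DirectSum.Decomposition 𝒱] in
theorem one_mem_symGr : (1 : GSym 𝒱) ∈ symGr 𝒱 0 := SetLike.GradedOne.one_mem (A := symGr 𝒱)

theorem tensComul_one : tensComul 𝒱 (1 ⊗ₜ 1) = (1 ⊗ₜ 1) ⊗ₜ (1 ⊗ₜ 1) := by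
  rw [tensComul, LinearMap.comp_apply, TensorProduct.map_tmul, symComul_one,
    midSwap_tmul 𝒱 _ _ (one_mem_symGr 𝒱) (one_mem_symGr 𝒱)]
  simp

omit [DirectSum.Decomposition 𝒱] in
theorem id_mem_symGr : ∀ d, ∀ a ∈ symGr 𝒱 d, (LinearMap.id : GSym 𝒱 →ₗ[K] GSym 𝒱) a ∈
    symGr 𝒱 (d + 0) := fun d a ha => by simpa using ha

theorem tw_mem_symGr (k : ℤ) : ∀ d, ∀ a ∈ symGr 𝒱 d, tw 𝒱 k a ∈ symGr 𝒱 (d + 0) :=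
  fun d a ha => by simpa using tw_mem 𝒱 k ha

/-- If `f` is a coderivation of `Sym(V)` then `f ⊗ 1` is a coderivation of `Sym(V) ⊗ Sym(V)`. -/
theorem tensComul_comp_rTensor {k : ℤ} {f : GSym 𝒱 →ₗ[K] GSym 𝒱}
    (hf : ∀ d, ∀ a ∈ symGr 𝒱 d, f a ∈ symGr 𝒱 (d + k))
    (h : symComul 𝒱 ∘ₗ f = coact (tw 𝒱 k) f ∘ₗ symComul 𝒱) :
    tensComul 𝒱 ∘ₗ LinearMap.rTensor (GSym 𝒱) f =
      coact (twC 𝒱 k) (LinearMap.rTensor (GSym 𝒱) f) ∘ₗ tensComul 𝒱 := by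
  have e : TensorProduct.map (symComul 𝒱) (symComul 𝒱) ∘ₗ LinearMap.rTensor (GSym 𝒱) f =
      TensorProduct.map (coact (tw 𝒱 k) f) (TensorProduct.map LinearMap.id LinearMap.id) ∘ₗ
        TensorProduct.map (symComul 𝒱) (symComul 𝒱) := by
    rw [LinearMap.rTensor, ← TensorProduct.map_comp, ← TensorProduct.map_comp, h,
      TensorProduct.map_id, LinearMap.id_comp, LinearMap.comp_id]
  have e1 := midSwap_comp_map 𝒱 (A := f) (D := LinearMap.id) (id_mem_symGr 𝒱) (id_mem_symGr 𝒱)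
  have e2 := midSwap_comp_map 𝒱 (A := tw 𝒱 k) (D := LinearMap.id) hf (id_mem_symGr 𝒱)
  simp only [mul_zero, sgn_zero, one_smul, tw_zero, LinearMap.comp_id, LinearMap.id_comp]
    at e1 e2
  rw [tensComul, LinearMap.comp_assoc, e, ← LinearMap.comp_assoc, coact,
    TensorProduct.map_add_left, LinearMap.comp_add, e1, e2, ← LinearMap.comp_assoc,
    ← LinearMap.add_comp, coact, twC, LinearMap.rTensor, TensorProduct.map_id]

theorem tensComul_comp_lmulFst {i : ℤ} {v : V} (hv : v ∈ 𝒱 i) :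
    tensComul 𝒱 ∘ₗ lmulFst 𝒱 v = coact (twC 𝒱 i) (lmulFst 𝒱 v) ∘ₗ tensComul 𝒱 :=
  tensComul_comp_rTensor 𝒱 (fun _ _ ha => lmul_mem 𝒱 hv ha) (symComul_comp_lmul 𝒱 hv)

theorem tensComul_comp_lmulSnd {i : ℤ} {v : V} (hv : v ∈ 𝒱 i) :
    tensComul 𝒱 ∘ₗ lmulSnd 𝒱 i v = coact (twC 𝒱 i) (lmulSnd 𝒱 i v) ∘ₗ tensComul 𝒱 := by
  have e : TensorProduct.map (symComul 𝒱) (symComul 𝒱) ∘ₗ lmulSnd 𝒱 i v =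
      TensorProduct.map (TensorProduct.map (tw 𝒱 i) (tw 𝒱 i)) (coact (tw 𝒱 i) (lmul 𝒱 v)) ∘ₗ
        TensorProduct.map (symComul 𝒱) (symComul 𝒱) := by
    rw [lmulSnd, ← TensorProduct.map_comp, ← TensorProduct.map_comp, symComul_comp_tw,
      symComul_comp_lmul 𝒱 hv]
  have e1 := midSwap_comp_map 𝒱 (A := tw 𝒱 i) (D := LinearMap.id) (tw_mem_symGr 𝒱 i)
    (fun _ _ ha => lmul_mem 𝒱 hv ha)
  have e2 := midSwap_comp_map 𝒱 (A := tw 𝒱 i) (D := lmul 𝒱 v) (tw_mem_symGr 𝒱 i)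
    (tw_mem_symGr 𝒱 i)
  simp only [mul_zero, zero_mul, sgn_zero, one_smul, tw_zero, LinearMap.comp_id, tw_comp_self]
    at e1 e2
  rw [tensComul, LinearMap.comp_assoc, e, ← LinearMap.comp_assoc, coact,
    TensorProduct.map_add_right, LinearMap.comp_add, e1, e2, ← LinearMap.comp_assoc,
    ← LinearMap.add_comp, coact, twC, lmulSnd, TensorProduct.map_id]

/-- The linear maps `Sym(V) ⊗ Sym(V) → V` of degree `k`. -/
def TensHomDeg (k : ℤ) (ρ : GSym 𝒱 ⊗[K] GSym 𝒱 →ₗ[K] V) : Prop :=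
  ∀ d, ∀ c ∈ tensGr 𝒱 d, ρ c ∈ 𝒱 (d + k)

variable {𝒱} in
omit [DirectSum.Decomposition 𝒱] in
theorem TensHomDeg.comp {k i : ℤ} {ρ : GSym 𝒱 ⊗[K] GSym 𝒱 →ₗ[K] V} (hρ : TensHomDeg 𝒱 k ρ)
    {M : GSym 𝒱 ⊗[K] GSym 𝒱 →ₗ[K] GSym 𝒱 ⊗[K] GSym 𝒱}
    (hM : ∀ d, ∀ c ∈ tensGr 𝒱 d, M c ∈ tensGr 𝒱 (d + i)) : TensHomDeg 𝒱 (k + i) (ρ ∘ₗ M) :=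
  fun d c hc => by
    have := hρ _ _ (hM d c hc)
    rwa [add_assoc, add_comm i k] at this

/-- The map `((x₁ ⊗ x₂) ⊗ (y₁ ⊗ y₂)) ↦ (-1)^{k|x₁|} x₁ ⊗ ρ(x₂ ⊗ y₁) y₂`. -/
noncomputable def sndInsert (k : ℤ) (ρ : GSym 𝒱 ⊗[K] GSym 𝒱 →ₗ[K] V) :
    (GSym 𝒱 ⊗[K] GSym 𝒱) ⊗[K] (GSym 𝒱 ⊗[K] GSym 𝒱) →ₗ[K] GSym 𝒱 ⊗[K] GSym 𝒱 :=
  TensorProduct.map (tw 𝒱 k)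
      (LinearMap.mul' K (GSym 𝒱) ∘ₗ LinearMap.rTensor (GSym 𝒱) (symι 𝒱 ∘ₗ ρ)) ∘ₗ
    LinearMap.lTensor (GSym 𝒱) (TensorProduct.assoc K _ _ _).symm.toLinearMap ∘ₗ
      (TensorProduct.assoc K _ _ _).toLinearMap

@[simp] theorem sndInsert_tmul (k : ℤ) (ρ : GSym 𝒱 ⊗[K] GSym 𝒱 →ₗ[K] V)
    (x₁ x₂ y₁ y₂ : GSym 𝒱) : sndInsert 𝒱 k ρ ((x₁ ⊗ₜ x₂) ⊗ₜ (y₁ ⊗ₜ y₂)) =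
      tw 𝒱 k x₁ ⊗ₜ (symι 𝒱 (ρ (x₂ ⊗ₜ y₁)) * y₂) := by
  simp [sndInsert]

/-- The map `G_ρ : X ⊗ Y ↦ ∑ (-1)^{k|X₁|} X₁ ⊗ ρ(X₂ ⊗ Y₁) Y₂` of `Sym(V) ⊗ Sym(V)` defined by a
linear map `ρ : Sym(V) ⊗ Sym(V) → V` of degree `k`; it is the coderivation whose corestriction to
the second copy of `V` is `ρ` and whose corestriction to the first copy is zero. -/
noncomputable def sndCoder (k : ℤ) (ρ : GSym 𝒱 ⊗[K] GSym 𝒱 →ₗ[K] V) :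
    GSym 𝒱 ⊗[K] GSym 𝒱 →ₗ[K] GSym 𝒱 ⊗[K] GSym 𝒱 :=
  sndInsert 𝒱 k ρ ∘ₗ TensorProduct.map (symComul 𝒱) (symComul 𝒱)

theorem sndCoder_one (k : ℤ) (ρ : GSym 𝒱 ⊗[K] GSym 𝒱 →ₗ[K] V) :
    sndCoder 𝒱 k ρ (1 ⊗ₜ 1) = 1 ⊗ₜ symι 𝒱 (ρ (1 ⊗ₜ 1)) := by
  simp [sndCoder]

theorem sndCoder_comp_lmulFst {k i : ℤ} (ρ : GSym 𝒱 ⊗[K] GSym 𝒱 →ₗ[K] V) {v : V} (hv : v ∈ 𝒱 i) :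
    sndCoder 𝒱 k ρ ∘ₗ lmulFst 𝒱 v = sndCoder 𝒱 (k + i) (ρ ∘ₗ lmulFst 𝒱 v) +
      sgn K (k * i) • (lmulFst 𝒱 v ∘ₗ sndCoder 𝒱 k ρ) := by
  have e : TensorProduct.map (symComul 𝒱) (symComul 𝒱) ∘ₗ lmulFst 𝒱 v =
      TensorProduct.map (coact (tw 𝒱 i) (lmul 𝒱 v)) LinearMap.id ∘ₗ
        TensorProduct.map (symComul 𝒱) (symComul 𝒱) := by
    rw [lmulFst, LinearMap.rTensor, ← TensorProduct.map_comp, ← TensorProduct.map_comp,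
      symComul_comp_lmul 𝒱 hv, LinearMap.id_comp, LinearMap.comp_id]
  have h : sndInsert 𝒱 k ρ ∘ₗ TensorProduct.map (coact (tw 𝒱 i) (lmul 𝒱 v)) LinearMap.id =
      sndInsert 𝒱 (k + i) (ρ ∘ₗ lmulFst 𝒱 v) +
        sgn K (k * i) • (lmulFst 𝒱 v ∘ₗ sndInsert 𝒱 k ρ) := by
    refine quad_ext_of_mem 𝒱 fun p q r s a ha b hb c hc d hd => ?_
    simp only [LinearMap.comp_apply, TensorProduct.map_tmul, coact_tmul, lmul_apply,
      LinearMap.id_apply, TensorProduct.add_tmul, map_add, sndInsert_tmul, LinearMap.add_apply,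
      LinearMap.smul_apply, lmulFst_tmul, tw_tw, tw_symι_mul 𝒱 k hv, ← TensorProduct.smul_tmul']
    rw [add_comm]
  rw [sndCoder, LinearMap.comp_assoc, e, ← LinearMap.comp_assoc, h, LinearMap.add_comp,
    LinearMap.smul_comp, LinearMap.comp_assoc, ← sndCoder, ← sndCoder]

theorem sndCoder_comp_lmulSnd {k i : ℤ} {ρ : GSym 𝒱 ⊗[K] GSym 𝒱 →ₗ[K] V}
    (hρ : TensHomDeg 𝒱 k ρ) {v : V} (hv : v ∈ 𝒱 i) :
    sndCoder 𝒱 k ρ ∘ₗ lmulSnd 𝒱 i v = sndCoder 𝒱 (k + i) (ρ ∘ₗ lmulSnd 𝒱 i v) +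
      sgn K (k * i) • (lmulSnd 𝒱 i v ∘ₗ sndCoder 𝒱 k ρ) := by
  have e : TensorProduct.map (symComul 𝒱) (symComul 𝒱) ∘ₗ lmulSnd 𝒱 i v =
      TensorProduct.map (TensorProduct.map (tw 𝒱 i) (tw 𝒱 i)) (coact (tw 𝒱 i) (lmul 𝒱 v)) ∘ₗ
        TensorProduct.map (symComul 𝒱) (symComul 𝒱) := by
    rw [lmulSnd, ← TensorProduct.map_comp, ← TensorProduct.map_comp, symComul_comp_tw,
      symComul_comp_lmul 𝒱 hv]
  have h : sndInsert 𝒱 k ρ ∘ₗ TensorProduct.map (TensorProduct.map (tw 𝒱 i) (tw 𝒱 i))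
      (coact (tw 𝒱 i) (lmul 𝒱 v)) =
      sndInsert 𝒱 (k + i) (ρ ∘ₗ lmulSnd 𝒱 i v) +
        sgn K (k * i) • (lmulSnd 𝒱 i v ∘ₗ sndInsert 𝒱 k ρ) := by
    refine quad_ext_of_mem 𝒱 fun p q r s a ha b hb c hc d hd => ?_
    simp only [LinearMap.comp_apply, TensorProduct.map_tmul, coact_tmul, lmul_apply,
      TensorProduct.tmul_add, map_add, sndInsert_tmul, LinearMap.add_apply,
      LinearMap.smul_apply, lmulSnd_tmul, tw_tw]
    congr 1
    have hbc := hρ _ _ (tmul_mem_tensGr 𝒱 hb hc)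
    rw [tw_of_mem 𝒱 i hb, tw_of_mem 𝒱 i hc, TensorProduct.smul_tmul_smul, map_smul, map_smul,
      smul_mul_assoc, ← mul_assoc, symι_mul_symι 𝒱 hbc hv, smul_mul_assoc, mul_assoc, smul_smul,
      TensorProduct.tmul_smul, add_comm k i]
    congr 1
    rw [← sgn_mul_sum_cons, mul_comm _ i, sgn_mul_sum_cons i (q + r) k, ← mul_assoc, sgn_mul_self,
      one_mul, mul_comm]
  rw [sndCoder, LinearMap.comp_assoc, e, ← LinearMap.comp_assoc, h, LinearMap.add_comp,
    LinearMap.smul_comp, LinearMap.comp_assoc, ← sndCoder, ← sndCoder]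

theorem sndCoder_mem {k : ℤ} {ρ : GSym 𝒱 ⊗[K] GSym 𝒱 →ₗ[K] V} (hρ : TensHomDeg 𝒱 k ρ) {d : ℤ}
    {c : GSym 𝒱 ⊗[K] GSym 𝒱} (hc : c ∈ tensGr 𝒱 d) : sndCoder 𝒱 k ρ c ∈ tensGr 𝒱 (d + k) := by
  let S : ℤ → Submodule K (GSym 𝒱 ⊗[K] GSym 𝒱) := fun d =>
    ⨅ (k : ℤ) (ρ : GSym 𝒱 ⊗[K] GSym 𝒱 →ₗ[K] V) (_ : TensHomDeg 𝒱 k ρ),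
      (tensGr 𝒱 (d + k)).comap (sndCoder 𝒱 k ρ)
  have : c ∈ S d := by
    refine tensGr_induction 𝒱 ?_ ?_ ?_ hc
    · simp only [S, Submodule.mem_iInf, Submodule.mem_comap]
      intro k ρ hρ
      rw [sndCoder_one]
      have h1 := tmul_mem_tensGr 𝒱 (one_mem_symGr 𝒱) (one_mem_symGr 𝒱)
      have := tmul_mem_tensGr 𝒱 (one_mem_symGr 𝒱) (symι_mem 𝒱 (hρ _ _ h1))
      simpa using this
    · simp only [S, Submodule.mem_iInf, Submodule.mem_comap]
      intro i v hv d c ih k ρ hρ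
      have e := LinearMap.congr_fun (sndCoder_comp_lmulFst 𝒱 (k := k) ρ hv) c
      simp only [LinearMap.comp_apply, LinearMap.add_apply, LinearMap.smul_apply] at e
      rw [e]
      refine add_mem ?_ (Submodule.smul_mem _ _ ?_)
      · have := ih _ _ (hρ.comp fun _ _ hc => lmulFst_mem 𝒱 hv hc)
        rwa [← add_assoc, add_right_comm] at this
      · have := lmulFst_mem 𝒱 hv (ih _ _ hρ)
        rwa [add_right_comm] at this
    · simp only [S, Submodule.mem_iInf, Submodule.mem_comap]
      intro i v hv d c ih k ρ hρ
      have e := LinearMap.congr_fun (sndCoder_comp_lmulSnd 𝒱 hρ hv) c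
      simp only [LinearMap.comp_apply, LinearMap.add_apply, LinearMap.smul_apply] at e
      rw [e]
      refine add_mem ?_ (Submodule.smul_mem _ _ ?_)
      · have := ih _ _ (hρ.comp fun _ _ hc => lmulSnd_mem 𝒱 hv hc)
        rwa [← add_assoc, add_right_comm] at this
      · have := lmulSnd_mem 𝒱 hv (ih _ _ hρ)
        rwa [add_right_comm] at this
  simp only [S, Submodule.mem_iInf, Submodule.mem_comap] at this
  exact this k ρ hρ

/-- `G_ρ` is a coderivation of `Sym(V) ⊗ Sym(V)`. -/
theorem tensComul_comp_sndCoder {k : ℤ} {ρ : GSym 𝒱 ⊗[K] GSym 𝒱 →ₗ[K] V}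
    (hρ : TensHomDeg 𝒱 k ρ) :
    tensComul 𝒱 ∘ₗ sndCoder 𝒱 k ρ = coact (twC 𝒱 k) (sndCoder 𝒱 k ρ) ∘ₗ tensComul 𝒱 := by
  let S : Submodule K (GSym 𝒱 ⊗[K] GSym 𝒱) :=
    ⨅ (k : ℤ) (ρ : GSym 𝒱 ⊗[K] GSym 𝒱 →ₗ[K] V) (_ : TensHomDeg 𝒱 k ρ),
    LinearMap.eqLocus (tensComul 𝒱 ∘ₗ sndCoder 𝒱 k ρ)
      (coact (twC 𝒱 k) (sndCoder 𝒱 k ρ) ∘ₗ tensComul 𝒱)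
  have : ∀ c, c ∈ S := by
    refine tens_induction 𝒱 ?_ ?_ ?_
    · simp only [S, Submodule.mem_iInf, LinearMap.mem_eqLocus, LinearMap.comp_apply]
      intro k ρ hρ
      have h1 := hρ _ _ (tmul_mem_tensGr 𝒱 (one_mem_symGr 𝒱) (one_mem_symGr 𝒱))
      rw [zero_add, zero_add] at h1
      have := LinearMap.congr_fun (tensComul_comp_lmulSnd 𝒱 h1) (1 ⊗ₜ 1)
      simp only [LinearMap.comp_apply, lmulSnd_tmul, tw_one, mul_one, tensComul_one] at this
      rw [sndCoder_one, this, tensComul_one]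
      simp [sndCoder_one, twC]
    · simp only [S, Submodule.mem_iInf, LinearMap.mem_eqLocus, LinearMap.comp_apply]
      intro i v hv c ih k ρ hρ
      refine coder_step (tensComul_comp_lmulFst 𝒱 hv) (sndCoder_comp_lmulFst 𝒱 ρ hv)
        (twC_comp_lmulFst 𝒱 k hv) (comp_twC_of_degree 𝒱 (fun d a ha => sndCoder_mem 𝒱 hρ ha) i)
        (twC_comp_twC 𝒱 k i) ?_ (ih k ρ hρ)
        (ih _ _ (hρ.comp fun _ _ hc => lmulFst_mem 𝒱 hv hc))
      rw [twC_comp_twC, add_comm]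
    · simp only [S, Submodule.mem_iInf, LinearMap.mem_eqLocus, LinearMap.comp_apply]
      intro i v hv c ih k ρ hρ
      refine coder_step (tensComul_comp_lmulSnd 𝒱 hv) (sndCoder_comp_lmulSnd 𝒱 hρ hv)
        (twC_comp_lmulSnd 𝒱 k hv) (comp_twC_of_degree 𝒱 (fun d a ha => sndCoder_mem 𝒱 hρ ha) i)
        (twC_comp_twC 𝒱 k i) ?_ (ih k ρ hρ)
        (ih _ _ (hρ.comp fun _ _ hc => lmulSnd_mem 𝒱 hv hc))
      rw [twC_comp_twC, add_comm]
  refine LinearMap.ext fun a => ?_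
  have h := this a
  simp only [S, Submodule.mem_iInf, LinearMap.mem_eqLocus] at h
  exact h k ρ hρ

end TensorCoderivation

/-! ### Coderivations of `ComTriasᶜ(V)` -/

section Coderivation

variable {K V : Type*} [Field K] [AddCommGroup V] [Module K V] (𝒱 : ℤ → Submodule K V)

variable [DirectSum.Decomposition 𝒱]

/-- The coproduct of `Sym(V)` has degree zero. -/
theorem symComul_mem {d : ℤ} {a : GSym 𝒱} (ha : a ∈ symGr 𝒱 d) :
    symComul 𝒱 a ∈ tensGr 𝒱 d := by
  refine symGr_induction 𝒱 (S := fun d => (tensGr 𝒱 d).comap (symComul 𝒱)) ?_ ?_ ha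
  · simpa using tmul_mem_tensGr 𝒱 (one_mem_symGr 𝒱) (one_mem_symGr 𝒱)
  · intro i v hv d a ha
    rw [Submodule.mem_comap, symComul_symι_mul 𝒱 hv]
    exact add_mem (lmulFst_mem 𝒱 hv ha) (lmulSnd_mem 𝒱 hv ha)

omit [DirectSum.Decomposition 𝒱] in
/-- The augmentation is homogeneous: it vanishes in nonzero degrees. -/
theorem algebraMap_symAug_mem {d : ℤ} {a : GSym 𝒱} (ha : a ∈ symGr 𝒱 d) :
    algebraMap K (GSym 𝒱) (symAug 𝒱 a) ∈ symGr 𝒱 d := by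
  refine symGr_induction 𝒱 (S := fun d => (symGr 𝒱 d).comap
    (Algebra.linearMap K (GSym 𝒱) ∘ₗ (symAug 𝒱).toLinearMap)) ?_ ?_ ha
  · simpa using one_mem_symGr 𝒱
  · intro i v hv d a ha
    simp [symAug_symι_mul]

/-- The inclusion `Sym(V) ⊗ S̄ym(V) → Sym(V) ⊗ Sym(V)`. -/
noncomputable def comIncl : ComTrias 𝒱 →ₗ[K] GSym 𝒱 ⊗[K] GSym 𝒱 :=
  LinearMap.lTensor (GSym 𝒱) (SymBar 𝒱).subtype

/-- The projection `Sym(V) ⊗ Sym(V) → Sym(V) ⊗ S̄ym(V)`. -/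
noncomputable def comProj : GSym 𝒱 ⊗[K] GSym 𝒱 →ₗ[K] ComTrias 𝒱 :=
  LinearMap.lTensor (GSym 𝒱) (symProj 𝒱)

omit [DirectSum.Decomposition 𝒱] in
@[simp] theorem comIncl_tmul (X : GSym 𝒱) (Y : SymBar 𝒱) :
    comIncl 𝒱 (X ⊗ₜ Y) = X ⊗ₜ (Y : GSym 𝒱) := rfl

omit [DirectSum.Decomposition 𝒱] in
@[simp] theorem comProj_tmul (X Y : GSym 𝒱) : comProj 𝒱 (X ⊗ₜ Y) = X ⊗ₜ symProj 𝒱 Y := rfl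

omit [DirectSum.Decomposition 𝒱] in
@[simp] theorem symProj_one : symProj 𝒱 1 = 0 := Subtype.ext (by simp [coe_symProj])

omit [DirectSum.Decomposition 𝒱] in
@[simp] theorem coe_symProj_symι_mul (v : V) (a : GSym 𝒱) :
    (symProj 𝒱 (symι 𝒱 v * a) : GSym 𝒱) = symι 𝒱 v * a := by
  rw [coe_symProj, symAug_symι_mul, map_zero, sub_zero]

omit [DirectSum.Decomposition 𝒱] in
theorem comProj_comp_comIncl : comProj 𝒱 ∘ₗ comIncl 𝒱 = LinearMap.id := by
  apply TensorProduct.ext'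
  intro X Y
  simp [symProj_coe]

omit [DirectSum.Decomposition 𝒱] in
theorem comIncl_mem {d : ℤ} {c : ComTrias 𝒱} (hc : c ∈ comGr 𝒱 d) : comIncl 𝒱 c ∈ tensGr 𝒱 d := by
  refine (Submodule.span_le (p := (tensGr 𝒱 d).comap (comIncl 𝒱))).2 ?_ hc
  rintro _ ⟨a, b, X, Y, hX, hY, rfl, rfl⟩
  exact tmul_mem_tensGr 𝒱 hX hY

omit [DirectSum.Decomposition 𝒱] in
theorem comProj_mem {d : ℤ} {c : GSym 𝒱 ⊗[K] GSym 𝒱} (hc : c ∈ tensGr 𝒱 d) :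
    comProj 𝒱 c ∈ comGr 𝒱 d := by
  refine (Submodule.span_le (p := (comGr 𝒱 d).comap (comProj 𝒱))).2 ?_ hc
  rintro _ ⟨a, b, X, Y, hX, hY, rfl, rfl⟩
  refine Submodule.subset_span ⟨a, b, X, symProj 𝒱 Y, hX, ?_, rfl, rfl⟩
  rw [coe_symProj]
  exact sub_mem hY (algebraMap_symAug_mem 𝒱 hY)

theorem comTwist_comp_comProj (k : ℤ) : comTwist 𝒱 k ∘ₗ comProj 𝒱 = comProj 𝒱 ∘ₗ twC 𝒱 k := by
  apply TensorProduct.ext'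
  intro X Y
  refine congrArg (fun t => tw 𝒱 k X ⊗ₜ[K] t) (Subtype.ext ?_)
  simp [coe_symProj, Algebra.algebraMap_eq_smul_one, symAug_tw]

/-- `Δ` is the coproduct of `Sym(V) ⊗ Sym(V)` with the terms outside `S̄ym(V)` dropped. -/
theorem comΔ_eq : comΔ 𝒱 =
    TensorProduct.map (comProj 𝒱) (comProj 𝒱) ∘ₗ tensComul 𝒱 ∘ₗ comIncl 𝒱 := by
  apply TensorProduct.ext'
  intro X Y
  rfl

/-- The map `X ⊗ Y ↦ ∑ (X₁ ⊗ X₂) ⊗ (X₃ ⊗ Y)` on `Sym(V) ⊗ Sym(V)`. -/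
noncomputable def tensδ : GSym 𝒱 ⊗[K] GSym 𝒱 →ₗ[K]
    (GSym 𝒱 ⊗[K] GSym 𝒱) ⊗[K] (GSym 𝒱 ⊗[K] GSym 𝒱) :=
  (TensorProduct.assoc K _ _ _).toLinearMap ∘ₗ
    LinearMap.rTensor (GSym 𝒱) (LinearMap.rTensor (GSym 𝒱) (symComul 𝒱) ∘ₗ symComul 𝒱)

/-- `δ` is `tensδ` with the terms outside `S̄ym(V)` dropped. -/
theorem comδ_eq : comδ 𝒱 =
    TensorProduct.map (comProj 𝒱) (comProj 𝒱) ∘ₗ tensδ 𝒱 ∘ₗ comIncl 𝒱 := by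
  apply TensorProduct.ext'
  intro X Y
  simp only [comδ, tensδ, LinearMap.comp_apply, comIncl_tmul, LinearMap.rTensor_tmul]
  generalize LinearMap.rTensor (GSym 𝒱) (symComul 𝒱) (symComul 𝒱 X) = t
  induction t using TensorProduct.induction_on with
  | zero => simp
  | add x y hx hy => simp only [TensorProduct.add_tmul, map_add, hx, hy]
  | tmul a b => simp [symProj_coe, comProj]

/-- The map `X ⊗ Y ↦ ε(Y) Δ(X)` of `Sym(V) ⊗ Sym(V)`. -/
noncomputable def augComul : GSym 𝒱 ⊗[K] GSym 𝒱 →ₗ[K] GSym 𝒱 ⊗[K] GSym 𝒱 :=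
  symComul 𝒱 ∘ₗ (TensorProduct.rid K (GSym 𝒱)).toLinearMap ∘ₗ
    LinearMap.lTensor (GSym 𝒱) (symAug 𝒱).toLinearMap

@[simp] theorem augComul_tmul (X Y : GSym 𝒱) :
    augComul 𝒱 (X ⊗ₜ Y) = symAug 𝒱 Y • symComul 𝒱 X := by
  simp [augComul]

/-- `tensδ` is obtained from the coproduct of `Sym(V) ⊗ Sym(V)` by applying
`X ⊗ Y ↦ ε(Y) Δ(X)` to its first leg. -/
theorem tensδ_eq :
    tensδ 𝒱 = LinearMap.rTensor (GSym 𝒱 ⊗[K] GSym 𝒱) (augComul 𝒱) ∘ₗ tensComul 𝒱 := by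
  have h : LinearMap.rTensor (GSym 𝒱 ⊗[K] GSym 𝒱) (augComul 𝒱) ∘ₗ midSwap 𝒱 =
      (TensorProduct.assoc K _ _ _).toLinearMap ∘ₗ
        TensorProduct.map (LinearMap.rTensor (GSym 𝒱) (symComul 𝒱))
          ((TensorProduct.lid K (GSym 𝒱)).toLinearMap ∘ₗ
            LinearMap.rTensor (GSym 𝒱) (symAug 𝒱).toLinearMap) := by
    refine quad_ext_of_mem 𝒱 fun p q r s a ha b hb c hc d hd => ?_
    simp only [LinearMap.comp_apply, midSwap_tmul 𝒱 _ _ hb hc, TensorProduct.map_tmul,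
      LinearMap.rTensor_tmul, map_smul, augComul_tmul, AlgHom.toLinearMap_apply,
      LinearEquiv.coe_coe, TensorProduct.lid_tmul, ← TensorProduct.smul_tmul', smul_smul,
      TensorProduct.tmul_smul]
    -- the sign is trivial since the augmentation vanishes in nonzero degrees
    have : sgn K (q * r) * symAug 𝒱 c = symAug 𝒱 c := by
      have := symAug_tw 𝒱 q c
      rwa [tw_of_mem 𝒱 q hc, map_smul, smul_eq_mul] at this
    rw [this]
    congr 1
  have e : ((TensorProduct.lid K (GSym 𝒱)).toLinearMap ∘ₗ
      LinearMap.rTensor (GSym 𝒱) (symAug 𝒱).toLinearMap) ∘ₗ symComul 𝒱 = LinearMap.id := by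
    rw [LinearMap.comp_assoc, symAug_rTensor_comul]
    ext a
    simp
  rw [tensComul, ← LinearMap.comp_assoc, h, LinearMap.comp_assoc, ← TensorProduct.map_comp, e]
  rfl

/-- If `ρ` has degree `k` then so has `X ↦ ρ(Δ X)`. -/
theorem TensHomDeg.comp_symComul {k : ℤ} {ρ : GSym 𝒱 ⊗[K] GSym 𝒱 →ₗ[K] V}
    (hρ : TensHomDeg 𝒱 k ρ) : SymHomDeg 𝒱 k (ρ ∘ₗ symComul 𝒱) :=
  fun d _ ha => hρ d _ (symComul_mem 𝒱 ha)

/-- The coderivation `X ⊗ Y ↦ ∑ ρ(X₁ ⊗ X₂) X₃ ⊗ Y + ∑ (-1)^{k|X₁|} X₁ ⊗ ρ(X₂ ⊗ Y₁) Y₂` of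
`Sym(V) ⊗ Sym(V)`. -/
noncomputable def tensCoder (k : ℤ) (ρ : GSym 𝒱 ⊗[K] GSym 𝒱 →ₗ[K] V) :
    GSym 𝒱 ⊗[K] GSym 𝒱 →ₗ[K] GSym 𝒱 ⊗[K] GSym 𝒱 :=
  LinearMap.rTensor (GSym 𝒱) (symCoder 𝒱 (ρ ∘ₗ symComul 𝒱)) + sndCoder 𝒱 k ρ

theorem tensCoder_mem {k : ℤ} {ρ : GSym 𝒱 ⊗[K] GSym 𝒱 →ₗ[K] V} (hρ : TensHomDeg 𝒱 k ρ) {d : ℤ}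
    {c : GSym 𝒱 ⊗[K] GSym 𝒱} (hc : c ∈ tensGr 𝒱 d) : tensCoder 𝒱 k ρ c ∈ tensGr 𝒱 (d + k) := by
  refine add_mem (tensGr_le_comap 𝒱 (ℳ := tensGr 𝒱) (fun p q a ha b hb => ?_) hc)
    (sndCoder_mem 𝒱 hρ hc)
  rw [add_right_comm]
  exact tmul_mem_tensGr 𝒱 (symCoder_mem 𝒱 (TensHomDeg.comp_symComul 𝒱 hρ) ha) hb

omit [DirectSum.Decomposition 𝒱] in
theorem coact_add {C : Type*} [AddCommMonoid C] [Module K C] (τ f g : C →ₗ[K] C) :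
    coact τ (f + g) = coact τ f + coact τ g := by
  simp only [coact, TensorProduct.map_add_left, TensorProduct.map_add_right]
  abel

theorem tensComul_comp_tensCoder {k : ℤ} {ρ : GSym 𝒱 ⊗[K] GSym 𝒱 →ₗ[K] V}
    (hρ : TensHomDeg 𝒱 k ρ) :
    tensComul 𝒱 ∘ₗ tensCoder 𝒱 k ρ = coact (twC 𝒱 k) (tensCoder 𝒱 k ρ) ∘ₗ tensComul 𝒱 := by
  have h := TensHomDeg.comp_symComul 𝒱 hρ
  rw [tensCoder, LinearMap.comp_add, tensComul_comp_sndCoder 𝒱 hρ, coact_add, LinearMap.add_comp,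
    tensComul_comp_rTensor 𝒱 (fun _ _ ha => symCoder_mem 𝒱 h ha) (symComul_comp_symCoder 𝒱 h)]

/-- Coassociativity for four factors: `(Δ ⊗ Δ) Δ`, bracketed as `X₁ ⊗ ((X₂ ⊗ X₃) ⊗ X₄)`, is
`(1 ⊗ (Δ ⊗ 1) Δ) Δ`. -/
theorem symComul_four : LinearMap.lTensor (GSym 𝒱) (TensorProduct.assoc K _ _ _).symm.toLinearMap ∘ₗ
      (TensorProduct.assoc K _ _ _).toLinearMap ∘ₗ
        TensorProduct.map (symComul 𝒱) (symComul 𝒱) ∘ₗ symComul 𝒱 =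
      LinearMap.lTensor (GSym 𝒱) (LinearMap.rTensor (GSym 𝒱) (symComul 𝒱) ∘ₗ symComul 𝒱) ∘ₗ
        symComul 𝒱 := by
  have h1 : (TensorProduct.assoc K _ _ _).toLinearMap ∘ₗ
      TensorProduct.map (symComul 𝒱) (symComul 𝒱) =
      LinearMap.lTensor (GSym 𝒱) (LinearMap.lTensor (GSym 𝒱) (symComul 𝒱)) ∘ₗ
        (TensorProduct.assoc K _ _ _).toLinearMap ∘ₗ
          LinearMap.rTensor (GSym 𝒱) (symComul 𝒱) := by
    apply TensorProduct.ext'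
    intro a b
    simp only [LinearMap.comp_apply, TensorProduct.map_tmul, LinearMap.rTensor_tmul]
    generalize symComul 𝒱 a = t
    induction t using TensorProduct.induction_on with
    | zero => simp
    | add x y hx hy => simp only [TensorProduct.add_tmul, map_add, hx, hy]
    | tmul a b => rfl
  have h2 : LinearMap.rTensor (GSym 𝒱) (symComul 𝒱) ∘ₗ symComul 𝒱 =
      (TensorProduct.assoc K _ _ _).symm.toLinearMap ∘ₗ
        LinearMap.lTensor (GSym 𝒱) (symComul 𝒱) ∘ₗ symComul 𝒱 := by
    rw [← symComul_coassoc]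
    refine LinearMap.ext fun x => ?_
    simp
  rw [h2, ← LinearMap.comp_assoc (symComul 𝒱), h1]
  simp only [LinearMap.comp_assoc, symComul_coassoc, LinearMap.lTensor_comp]

/-- `G_ρ Δ = (τ ⊗ f_{ρΔ}) Δ`, where `τ` is the sign operator of degree `k`. -/
theorem sndCoder_comp_symComul (k : ℤ) (ρ : GSym 𝒱 ⊗[K] GSym 𝒱 →ₗ[K] V) :
    sndCoder 𝒱 k ρ ∘ₗ symComul 𝒱 =
      TensorProduct.map (tw 𝒱 k) (symCoder 𝒱 (ρ ∘ₗ symComul 𝒱)) ∘ₗ symComul 𝒱 := by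
  have e : symCoder 𝒱 (ρ ∘ₗ symComul 𝒱) =
      (LinearMap.mul' K (GSym 𝒱) ∘ₗ LinearMap.rTensor (GSym 𝒱) (symι 𝒱 ∘ₗ ρ)) ∘ₗ
        LinearMap.rTensor (GSym 𝒱) (symComul 𝒱) ∘ₗ symComul 𝒱 := by
    rw [symCoder, ← LinearMap.comp_assoc _ _ (symι 𝒱), LinearMap.rTensor_comp]
    rfl
  have e' := congrArg (fun t => TensorProduct.map (tw 𝒱 k)
    (LinearMap.mul' K (GSym 𝒱) ∘ₗ LinearMap.rTensor (GSym 𝒱) (symι 𝒱 ∘ₗ ρ)) ∘ₗ t)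
    (symComul_four 𝒱)
  rw [e, ← LinearMap.comp_id (tw 𝒱 k), TensorProduct.map_comp, sndCoder, sndInsert]
  exact e'

/-- The coderivation commutes with `X ⊗ Y ↦ ε(Y) Δ(X)`; this is what makes it compatible
with `δ`. -/
theorem augComul_comp_tensCoder {k : ℤ} {ρ : GSym 𝒱 ⊗[K] GSym 𝒱 →ₗ[K] V}
    (hρ : TensHomDeg 𝒱 k ρ) :
    augComul 𝒱 ∘ₗ tensCoder 𝒱 k ρ = tensCoder 𝒱 k ρ ∘ₗ augComul 𝒱 := by
  have h := TensHomDeg.comp_symComul 𝒱 hρ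
  have h0 : augComul 𝒱 ∘ₗ sndInsert 𝒱 k ρ = 0 := by
    refine quad_ext_of_mem 𝒱 fun p q r s a ha b hb c hc d hd => ?_
    simp [symAug_symι_mul]
  apply TensorProduct.ext'
  intro X Y
  have e0 : augComul 𝒱 (sndCoder 𝒱 k ρ (X ⊗ₜ Y)) = 0 := LinearMap.congr_fun h0 _
  have e1 := LinearMap.congr_fun (sndCoder_comp_symComul 𝒱 k ρ) X
  have e2 := LinearMap.congr_fun (symComul_comp_symCoder 𝒱 h) X
  simp only [LinearMap.comp_apply, coact, LinearMap.add_apply] at e1 e2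
  simp only [LinearMap.comp_apply, tensCoder, LinearMap.add_apply, map_add, e0, add_zero,
    LinearMap.rTensor_tmul, augComul_tmul, map_smul, e1, e2]
  rfl

theorem augComul_comp_twC (k : ℤ) : augComul 𝒱 ∘ₗ twC 𝒱 k = twC 𝒱 k ∘ₗ augComul 𝒱 := by
  apply TensorProduct.ext'
  intro X Y
  simp only [twC, LinearMap.comp_apply, TensorProduct.map_tmul, augComul_tmul, symAug_tw,
    symComul_tw, map_smul]

theorem tensδ_comp_tensCoder {k : ℤ} {ρ : GSym 𝒱 ⊗[K] GSym 𝒱 →ₗ[K] V} (hρ : TensHomDeg 𝒱 k ρ) :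
    tensδ 𝒱 ∘ₗ tensCoder 𝒱 k ρ = coact (twC 𝒱 k) (tensCoder 𝒱 k ρ) ∘ₗ tensδ 𝒱 := by
  rw [tensδ_eq, LinearMap.comp_assoc, tensComul_comp_tensCoder 𝒱 hρ, ← LinearMap.comp_assoc,
    ← LinearMap.comp_assoc]
  congr 1
  simp only [coact, LinearMap.rTensor, LinearMap.comp_add, LinearMap.add_comp,
    ← TensorProduct.map_comp, augComul_comp_tensCoder 𝒱 hρ, augComul_comp_twC, LinearMap.comp_id,
    LinearMap.id_comp]

/-- The map `Ψ(R)` of `Sym(V) ⊗ S̄ym(V)`: the restriction of the coderivation `tensCoder` of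
`Sym(V) ⊗ Sym(V)` defined by `R`, extended by zero to `Sym(V) ⊗ 1`. -/
noncomputable def psi (k : ℤ) (R : ComTrias 𝒱 →ₗ[K] V) : ComTrias 𝒱 →ₗ[K] ComTrias 𝒱 :=
  comProj 𝒱 ∘ₗ tensCoder 𝒱 k (R ∘ₗ comProj 𝒱) ∘ₗ comIncl 𝒱

omit [DirectSum.Decomposition 𝒱] in
theorem HomDeg.tensHomDeg {k : ℤ} {R : ComTrias 𝒱 →ₗ[K] V} (hR : R ∈ HomDeg 𝒱 k) :
    TensHomDeg 𝒱 k (R ∘ₗ comProj 𝒱) := fun d _ hc => hR d _ (comProj_mem 𝒱 hc)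

/-- The values of `G_ρ` lie in `Sym(V) ⊗ S̄ym(V)`: their second factors are products
with a vector. -/
theorem comIncl_comp_comProj_comp_sndCoder (k : ℤ) (ρ : GSym 𝒱 ⊗[K] GSym 𝒱 →ₗ[K] V) :
    comIncl 𝒱 ∘ₗ comProj 𝒱 ∘ₗ sndCoder 𝒱 k ρ = sndCoder 𝒱 k ρ := by
  have h : comIncl 𝒱 ∘ₗ comProj 𝒱 ∘ₗ sndInsert 𝒱 k ρ = sndInsert 𝒱 k ρ := by
    refine quad_ext_of_mem 𝒱 fun p q r s a ha b hb c hc d hd => ?_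
    simp
  exact congrArg (fun t => t ∘ₗ TensorProduct.map (symComul 𝒱) (symComul 𝒱)) h

/-- The coderivation of `Sym(V) ⊗ Sym(V)` preserves the subspace `Sym(V) ⊗ S̄ym(V)`, where it is
`Ψ(R)`. -/
theorem comIncl_comp_psi (k : ℤ) (R : ComTrias 𝒱 →ₗ[K] V) :
    comIncl 𝒱 ∘ₗ psi 𝒱 k R = tensCoder 𝒱 k (R ∘ₗ comProj 𝒱) ∘ₗ comIncl 𝒱 := by
  apply TensorProduct.ext'
  intro X Y
  have h := LinearMap.congr_fun
    (comIncl_comp_comProj_comp_sndCoder 𝒱 k (R ∘ₗ comProj 𝒱)) (X ⊗ₜ (Y : GSym 𝒱))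
  simp only [LinearMap.comp_apply] at h
  simp only [psi, tensCoder, LinearMap.comp_apply, comIncl_tmul, LinearMap.add_apply, map_add, h,
    LinearMap.rTensor_tmul, comProj_tmul, symProj_coe]

/-- `G_ρ` kills `Sym(V) ⊗ 1` because `R` is extended by zero there. -/
theorem sndCoder_tmul_one (k : ℤ) (R : ComTrias 𝒱 →ₗ[K] V) (X : GSym 𝒱) :
    sndCoder 𝒱 k (R ∘ₗ comProj 𝒱) (X ⊗ₜ 1) = 0 := by
  simp only [sndCoder, LinearMap.comp_apply, TensorProduct.map_tmul, symComul_one]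
  generalize symComul 𝒱 X = t
  induction t using TensorProduct.induction_on with
  | zero => simp
  | add x y hx hy => simp only [TensorProduct.add_tmul, map_add, hx, hy, add_zero]
  | tmul a b => simp

/-- The coderivation of `Sym(V) ⊗ Sym(V)` also descends to the quotient `Sym(V) ⊗ S̄ym(V)` by
`Sym(V) ⊗ 1`. -/
theorem psi_comp_comProj (k : ℤ) (R : ComTrias 𝒱 →ₗ[K] V) :
    psi 𝒱 k R ∘ₗ comProj 𝒱 = comProj 𝒱 ∘ₗ tensCoder 𝒱 k (R ∘ₗ comProj 𝒱) := by
  apply TensorProduct.ext'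
  intro X Y
  have h : X ⊗ₜ[K] (symProj 𝒱 Y : GSym 𝒱) = X ⊗ₜ Y - symAug 𝒱 Y • (X ⊗ₜ[K] (1 : GSym 𝒱)) := by
    rw [coe_symProj, TensorProduct.tmul_sub, Algebra.algebraMap_eq_smul_one,
      TensorProduct.tmul_smul]
  simp only [psi, LinearMap.comp_apply, comProj_tmul, comIncl_tmul, h, map_sub, map_smul]
  rw [tensCoder, LinearMap.add_apply, LinearMap.add_apply, sndCoder_tmul_one]
  simp

omit [DirectSum.Decomposition 𝒱] in
/-- A linear map that intertwines the operators intertwines their extensions to the tensor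
square. -/
theorem map_comp_coact {C D : Type*} [AddCommMonoid C] [Module K C] [AddCommMonoid D] [Module K D]
    {p : C →ₗ[K] D} {τ f : C →ₗ[K] C} {τ' f' : D →ₗ[K] D} (hτ : τ' ∘ₗ p = p ∘ₗ τ)
    (hf : f' ∘ₗ p = p ∘ₗ f) :
    TensorProduct.map p p ∘ₗ coact τ f = coact τ' f' ∘ₗ TensorProduct.map p p := by
  simp only [coact, LinearMap.comp_add, LinearMap.add_comp, ← TensorProduct.map_comp, hτ, hf,
    LinearMap.comp_id, LinearMap.id_comp]

/-- `Ψ(R)` is a coderivation of degree `k`. -/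
theorem psi_mem {k : ℤ} {R : ComTrias 𝒱 →ₗ[K] V} (hR : R ∈ HomDeg 𝒱 k) :
    psi 𝒱 k R ∈ CoDer 𝒱 k := by
  have hρ := HomDeg.tensHomDeg 𝒱 hR
  have hc := map_comp_coact (comTwist_comp_comProj 𝒱 k) (psi_comp_comProj 𝒱 k R)
  refine ⟨fun d c hc => comProj_mem 𝒱 (tensCoder_mem 𝒱 hρ (comIncl_mem 𝒱 hc)), ?_, ?_⟩
  · change _ = coact (comTwist 𝒱 k) (psi 𝒱 k R) ∘ₗ _
    rw [comΔ_eq, LinearMap.comp_assoc, LinearMap.comp_assoc, comIncl_comp_psi,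
      ← LinearMap.comp_assoc (comIncl 𝒱), tensComul_comp_tensCoder 𝒱 hρ]
    exact congrArg (fun t => t ∘ₗ tensComul 𝒱 ∘ₗ comIncl 𝒱) hc
  · change _ = coact (comTwist 𝒱 k) (psi 𝒱 k R) ∘ₗ _
    rw [comδ_eq, LinearMap.comp_assoc, LinearMap.comp_assoc, comIncl_comp_psi,
      ← LinearMap.comp_assoc (comIncl 𝒱), tensδ_comp_tensCoder 𝒱 hρ]
    exact congrArg (fun t => t ∘ₗ tensδ 𝒱 ∘ₗ comIncl 𝒱) hc

end Coderivation

/-! ### Primitive elements of `Sym(V)` -/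

section Primitives

variable {K V : Type*} [Field K] [AddCommGroup V] [Module K V] (𝒱 : ℤ → Submodule K V)

section MonomialExt

/-- A list of pairs `(i, v)` is homogeneous if `v ∈ 𝒱 i` for all of them. -/
def HomogList (l : List (ℤ × V)) : Prop := ∀ p ∈ l, p.2 ∈ 𝒱 p.1

/-- The monomial of a list of vectors with degrees. -/
noncomputable abbrev lmon (l : List (ℤ × V)) : GSym 𝒱 := mon 𝒱 (l.map Prod.snd)

variable {𝒱} in
theorem HomogList.lmon_mem {l : List (ℤ × V)} (hl : HomogList 𝒱 l) :
    lmon 𝒱 l ∈ symGr 𝒱 (l.map Prod.fst).sum :=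
  Submodule.subset_span ⟨l, hl, rfl, rfl⟩

variable {𝒱} in
theorem HomogList.cons {i : ℤ} {v : V} (hv : v ∈ 𝒱 i) {l : List (ℤ × V)} (hl : HomogList 𝒱 l) :
    HomogList 𝒱 ((i, v) :: l) := by
  intro p hp
  rcases List.mem_cons.1 hp with rfl | h
  exacts [hv, hl p h]

/-- Linear maps that agree on homogeneous monomials are equal. -/
theorem gsym_ext_lmon [DirectSum.Decomposition 𝒱] {M : Type*} [AddCommMonoid M] [Module K M]
    {f g : GSym 𝒱 →ₗ[K] M} (h : ∀ l, HomogList 𝒱 l → f (lmon 𝒱 l) = g (lmon 𝒱 l)) : f = g := by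
  refine gsym_hom_ext_of_mem 𝒱 fun d a ha => ?_
  refine (Submodule.span_le (p := LinearMap.eqLocus f g)).2 ?_ ha
  rintro _ ⟨l, hl, -, rfl⟩
  exact h l hl

/-- Linear maps on `Sym(V) ⊗ S̄ym(V)` that agree on the tensors of homogeneous monomials are
equal. -/
theorem comTrias_ext_lmon [DirectSum.Decomposition 𝒱] {M : Type*} [AddCommMonoid M] [Module K M]
    {f g : ComTrias 𝒱 →ₗ[K] M} (h : ∀ l l', HomogList 𝒱 l → HomogList 𝒱 l' → l' ≠ [] →
      f (lmon 𝒱 l ⊗ₜ barMon 𝒱 (l'.map Prod.snd)) = g (lmon 𝒱 l ⊗ₜ barMon 𝒱 (l'.map Prod.snd))) :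
    f = g := by
  have e : f ∘ₗ comProj 𝒱 = g ∘ₗ comProj 𝒱 := by
    apply TensorProduct.ext
    refine gsym_ext_lmon 𝒱 fun l hl => ?_
    refine gsym_ext_lmon 𝒱 fun l' hl' => ?_
    by_cases hn : l' = []
    · subst hn
      simp [lmon]
    · exact h l l' hl hl' hn
  have e' := congrArg (fun t => t ∘ₗ comIncl 𝒱) e
  simpa only [LinearMap.comp_assoc, comProj_comp_comIncl, LinearMap.comp_id] using e'

end MonomialExt

/-- The action of `Sym(V)` on `K × V` in which `v` sends `(r, w)` to `(0, r v)`; it exhibits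
the component of word length one. -/
noncomputable def symAct : GSym 𝒱 →ₐ[K] Module.End K (K × V) :=
  symLift 𝒱 (LinearMap.lcomp K (K × V) (LinearMap.fst K K V) ∘ₗ
    LinearMap.llcomp K K V (K × V) (LinearMap.inr K K V) ∘ₗ
      (LinearMap.ringLmapEquivSelf K K V).symm.toLinearMap) (by
    intro i j x y _ _
    ext <;> simp)

theorem symAct_symι_mul (v : V) (a : GSym 𝒱) (z : K × V) :
    symAct 𝒱 (symι 𝒱 v * a) z = (0, (symAct 𝒱 a z).1 • v) := by
  simp [symAct]

/-- The projection `Sym(V) → V` onto the component of word length one. -/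
noncomputable def symPr : GSym 𝒱 →ₗ[K] V :=
  LinearMap.snd K K V ∘ₗ LinearMap.applyₗ (1, 0) ∘ₗ (symAct 𝒱).toLinearMap

@[simp] theorem symPr_one : symPr 𝒱 1 = 0 := by simp [symPr]

variable [DirectSum.Decomposition 𝒱]

@[simp] theorem symPr_symι_mul (v : V) (a : GSym 𝒱) :
    symPr 𝒱 (symι 𝒱 v * a) = symAug 𝒱 a • v := by
  have h : LinearMap.fst K K V ∘ₗ LinearMap.applyₗ (1, 0) ∘ₗ (symAct 𝒱).toLinearMap =
      (symAug 𝒱).toLinearMap := by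
    refine gsym_linearMap_ext 𝒱 (by simp) fun i v hv a ha => ?_
    simp only [LinearMap.comp_apply, LinearMap.applyₗ_apply_apply, AlgHom.toLinearMap_apply,
      LinearMap.fst_apply, symAct_symι_mul, symAug_symι_mul]
  have h' : (symAct 𝒱 a (1, 0)).1 = symAug 𝒱 a := LinearMap.congr_fun h a
  simp only [symPr, LinearMap.comp_apply, LinearMap.applyₗ_apply_apply, AlgHom.toLinearMap_apply,
    LinearMap.snd_apply, symAct_symι_mul, h']

theorem symPr_mem {d : ℤ} {a : GSym 𝒱} (ha : a ∈ symGr 𝒱 d) : symPr 𝒱 a ∈ 𝒱 d := by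
  refine symGr_induction 𝒱 (S := fun d => symGr 𝒱 d ⊓ (𝒱 d).comap (symPr 𝒱)) ?_ ?_ ha |>.2
  · simpa using one_mem_symGr 𝒱
  · rintro i v hv d a ⟨h1, h2⟩
    refine ⟨lmul_mem 𝒱 hv h1, ?_⟩
    rw [SetLike.mem_coe, Submodule.mem_comap, symPr_symι_mul]
    refine symGr_induction 𝒱 (S := fun d => (𝒱 (d + i)).comap
      ((LinearMap.toSpanSingleton K V v) ∘ₗ (symAug 𝒱).toLinearMap)) ?_ ?_ h1
    · simpa using hv
    · intro j w hw d a ha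
      simp [symAug_symι_mul]

theorem symAug_smul_mem {d e : ℤ} {a : GSym 𝒱} (ha : a ∈ symGr 𝒱 d) {v : V} (hv : v ∈ 𝒱 e) :
    symAug 𝒱 a • v ∈ 𝒱 (d + e) := by
  have := symPr_mem 𝒱 (lmul_mem 𝒱 hv ha)
  rwa [lmul_apply, symPr_symι_mul] at this

/-- The projection `X ⊗ Y ↦ ε(X) pr(Y)` of `Sym(V) ⊗ Sym(V)` onto the second copy of `V`. -/
noncomputable def tensPr : GSym 𝒱 ⊗[K] GSym 𝒱 →ₗ[K] V :=
  (TensorProduct.lid K V).toLinearMap ∘ₗ TensorProduct.map (symAug 𝒱).toLinearMap (symPr 𝒱)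

omit [DirectSum.Decomposition 𝒱] in
@[simp] theorem tensPr_tmul (X Y : GSym 𝒱) : tensPr 𝒱 (X ⊗ₜ Y) = symAug 𝒱 X • symPr 𝒱 Y := by
  simp [tensPr]

/-- The projection of `Sym(V) ⊗ S̄ym(V)` onto its cogenerators `V = Sym⁰(V) ⊗ Sym¹(V)`. -/
noncomputable def comPr : ComTrias 𝒱 →ₗ[K] V := tensPr 𝒱 ∘ₗ comIncl 𝒱

theorem comPr_mem {d : ℤ} {c : ComTrias 𝒱} (hc : c ∈ comGr 𝒱 d) : comPr 𝒱 c ∈ 𝒱 d := by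
  refine (Submodule.span_le (p := (𝒱 d).comap (comPr 𝒱))).2 ?_ hc
  rintro _ ⟨a, b, X, Y, hX, hY, rfl, rfl⟩
  simpa [comPr] using symAug_smul_mem 𝒱 hX (symPr_mem 𝒱 hY)

/-- The counit contraction `x₁ ⊗ x₂ ↦ ε(x₁) x₂`. -/
noncomputable def augLeft : GSym 𝒱 ⊗[K] GSym 𝒱 →ₗ[K] GSym 𝒱 :=
  (TensorProduct.lid K (GSym 𝒱)).toLinearMap ∘ₗ
    LinearMap.rTensor (GSym 𝒱) (symAug 𝒱).toLinearMap

/-- The counit contraction `x₁ ⊗ x₂ ↦ x₁ ε(x₂)`. -/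
noncomputable def augRight : GSym 𝒱 ⊗[K] GSym 𝒱 →ₗ[K] GSym 𝒱 :=
  (TensorProduct.rid K (GSym 𝒱)).toLinearMap ∘ₗ
    LinearMap.lTensor (GSym 𝒱) (symAug 𝒱).toLinearMap

omit [DirectSum.Decomposition 𝒱] in
@[simp] theorem augLeft_tmul (X Y : GSym 𝒱) : augLeft 𝒱 (X ⊗ₜ Y) = symAug 𝒱 X • Y := by
  simp [augLeft]

omit [DirectSum.Decomposition 𝒱] in
@[simp] theorem augRight_tmul (X Y : GSym 𝒱) : augRight 𝒱 (X ⊗ₜ Y) = symAug 𝒱 Y • X := by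
  simp [augRight]

theorem augLeft_comp_symComul : augLeft 𝒱 ∘ₗ symComul 𝒱 = LinearMap.id := by
  rw [augLeft, LinearMap.comp_assoc, symAug_rTensor_comul]
  ext a
  simp

theorem augRight_comp_symComul : augRight 𝒱 ∘ₗ symComul 𝒱 = LinearMap.id := by
  rw [augRight, LinearMap.comp_assoc, symAug_lTensor_comul]
  ext a
  simp

/-- The corestriction of `Ψ(R)` to the cogenerators is `R`. -/
theorem comPr_comp_psi (k : ℤ) (R : ComTrias 𝒱 →ₗ[K] V) : comPr 𝒱 ∘ₗ psi 𝒱 k R = R := by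
  have h1 : tensPr 𝒱 ∘ₗ sndInsert 𝒱 k (R ∘ₗ comProj 𝒱) =
      R ∘ₗ comProj 𝒱 ∘ₗ TensorProduct.map (augLeft 𝒱) (augRight 𝒱) := by
    refine quad_ext_of_mem 𝒱 fun p q r s a _ b _ c _ d _ => ?_
    simp [symAug_tw, smul_smul, ← TensorProduct.smul_tmul', mul_comm]
  have h2 : tensPr 𝒱 ∘ₗ sndCoder 𝒱 k (R ∘ₗ comProj 𝒱) = R ∘ₗ comProj 𝒱 := by
    rw [sndCoder, ← LinearMap.comp_assoc, h1, LinearMap.comp_assoc, LinearMap.comp_assoc,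
      ← TensorProduct.map_comp, augLeft_comp_symComul, augRight_comp_symComul,
      TensorProduct.map_id, LinearMap.comp_id]
  have h3 : ∀ ρ : GSym 𝒱 →ₗ[K] V, (symAug 𝒱).toLinearMap ∘ₗ symCoder 𝒱 ρ = 0 := by
    intro ρ
    have : (symAug 𝒱).toLinearMap ∘ₗ LinearMap.mul' K (GSym 𝒱) ∘ₗ
        LinearMap.rTensor (GSym 𝒱) (symι 𝒱 ∘ₗ ρ) = 0 := by
      apply TensorProduct.ext'
      intro a b
      simp [symAug_symι_mul]
    exact congrArg (fun t => t ∘ₗ symComul 𝒱) this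
  have h4 : tensPr 𝒱 ∘ₗ tensCoder 𝒱 k (R ∘ₗ comProj 𝒱) = R ∘ₗ comProj 𝒱 := by
    rw [tensCoder, LinearMap.comp_add, h2]
    convert zero_add _
    apply TensorProduct.ext'
    intro X Y
    have := LinearMap.congr_fun (h3 ((R ∘ₗ comProj 𝒱) ∘ₗ symComul 𝒱)) X
    simp only [LinearMap.comp_apply, AlgHom.toLinearMap_apply, LinearMap.zero_apply] at this
    simp [this]
  rw [comPr, LinearMap.comp_assoc, comIncl_comp_psi, ← LinearMap.comp_assoc, h4,
    LinearMap.comp_assoc, comProj_comp_comIncl, LinearMap.comp_id]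

omit [DirectSum.Decomposition 𝒱] in
/-- Graded commutativity of `Sym(V)` against a vector. -/
theorem mul_symι {d i : ℤ} {a : GSym 𝒱} (ha : a ∈ symGr 𝒱 d) {v : V} (hv : v ∈ 𝒱 i) :
    a * symι 𝒱 v = sgn K (i * d) • (symι 𝒱 v * a) := by
  refine symGr_induction 𝒱 (S := fun d => LinearMap.eqLocus (LinearMap.mulRight K (symι 𝒱 v))
    (sgn K (i * d) • LinearMap.mulLeft K (symι 𝒱 v))) ?_ ?_ ha
  · simp
  · intro j w hw d a ih
    simp only [LinearMap.mem_eqLocus, LinearMap.mulRight_apply, LinearMap.smul_apply,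
      LinearMap.mulLeft_apply] at ih ⊢
    rw [mul_assoc, ih, mul_smul_comm, ← mul_assoc, symι_mul_symι 𝒱 hw hv, smul_mul_assoc, smul_smul,
      mul_assoc, sgn_mul_sum_cons, mul_comm j i]

/-- Multiplication after comultiplication, `μ ∘ Δ`, doubles every vector of a monomial. -/
theorem mul'_symComul_symι_mul {i : ℤ} {v : V} (hv : v ∈ 𝒱 i) (a : GSym 𝒱) :
    LinearMap.mul' K (GSym 𝒱) (symComul 𝒱 (symι 𝒱 v * a)) =
      (2 : K) • (symι 𝒱 v * LinearMap.mul' K (GSym 𝒱) (symComul 𝒱 a)) := by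
  have h : LinearMap.mul' K (GSym 𝒱) ∘ₗ coact (tw 𝒱 i) (lmul 𝒱 v) =
      (2 : K) • (lmul 𝒱 v ∘ₗ LinearMap.mul' K (GSym 𝒱)) := by
    refine tens_ext_of_mem 𝒱 fun p q a ha b hb => ?_
    simp only [LinearMap.comp_apply, coact_tmul, lmul_apply, map_add, LinearMap.mul'_apply,
      LinearMap.smul_apply, tw_of_mem 𝒱 i ha, smul_mul_assoc]
    rw [← mul_assoc a, mul_symι 𝒱 ha hv, smul_mul_assoc, smul_smul, sgn_mul_self, one_smul,
      two_smul, mul_assoc]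
  rw [symComul_symι_mul 𝒱 hv]
  exact LinearMap.congr_fun h _

open Polynomial in
/-- The algebra morphism `Sym(V) → Sym(V)[t]` with `v ↦ v t`; the coefficient of `tⁿ` is the
projection onto `Symⁿ(V)`. -/
noncomputable def symWeight : GSym 𝒱 →ₐ[K] (GSym 𝒱)[X] :=
  symLift 𝒱 ((LinearMap.mulRight K (X : (GSym 𝒱)[X])) ∘ₗ
    (Polynomial.CAlgHom (R := K) (A := GSym 𝒱)).toLinearMap ∘ₗ symι 𝒱) (by
    intro i j x y hx hy
    have h : ∀ a b : GSym 𝒱, (C a * X) * (C b * X) = C (a * b) * X ^ 2 := by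
      intro a b
      rw [mul_assoc, ← mul_assoc X, X_mul, map_mul, mul_assoc, mul_assoc, pow_two]
    simp only [LinearMap.comp_apply, LinearMap.mulRight_apply, AlgHom.toLinearMap_apply,
      Polynomial.CAlgHom_apply, h]
    rw [symι_mul_symι 𝒱 hx hy, ← Polynomial.smul_C, smul_mul_assoc])

omit [DirectSum.Decomposition 𝒱] in
open Polynomial in
theorem symWeight_symι_mul (v : V) (a : GSym 𝒱) :
    symWeight 𝒱 (symι 𝒱 v * a) = C (symι 𝒱 v) * symWeight 𝒱 a * X := by
  have : symWeight 𝒱 (symι 𝒱 v) = C (symι 𝒱 v) * X := by simp [symWeight]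
  rw [map_mul, this, mul_assoc, X_mul, mul_assoc]

open Polynomial in
theorem eval_one_symWeight (a : GSym 𝒱) : (symWeight 𝒱 a).eval 1 = a := by
  have : (Polynomial.leval (1 : GSym 𝒱)).restrictScalars K ∘ₗ (symWeight 𝒱).toLinearMap =
      LinearMap.id := by
    refine gsym_linearMap_ext 𝒱 (by simp) fun i v hv a ha => ?_
    simp only [LinearMap.comp_apply, LinearMap.restrictScalars_apply, AlgHom.toLinearMap_apply,
      Polynomial.leval_apply, LinearMap.id_apply] at ha ⊢
    rw [symWeight_symι_mul, Polynomial.eval_mul_X, Polynomial.eval_C_mul, ha, mul_one]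
  exact LinearMap.congr_fun this a

/-- `μ ∘ Δ` is multiplication by `2ⁿ` on `Symⁿ(V)`. -/
theorem coeff_symWeight_mul' (n : ℕ) (a : GSym 𝒱) :
    (symWeight 𝒱 (LinearMap.mul' K (GSym 𝒱) (symComul 𝒱 a))).coeff n =
      (2 : K) ^ n • (symWeight 𝒱 a).coeff n := by
  let S : Submodule K (GSym 𝒱) := ⨅ n : ℕ, LinearMap.eqLocus
    ((Polynomial.lcoeff (GSym 𝒱) n).restrictScalars K ∘ₗ (symWeight 𝒱).toLinearMap ∘ₗ
      LinearMap.mul' K (GSym 𝒱) ∘ₗ symComul 𝒱)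
    ((2 : K) ^ n • ((Polynomial.lcoeff (GSym 𝒱) n).restrictScalars K ∘ₗ
      (symWeight 𝒱).toLinearMap))
  have : a ∈ S := by
    refine gsym_induction 𝒱 ?_ ?_ a
    · simp only [S, Submodule.mem_iInf, LinearMap.mem_eqLocus, LinearMap.comp_apply,
        LinearMap.smul_apply, LinearMap.restrictScalars_apply, AlgHom.toLinearMap_apply,
        Polynomial.lcoeff_apply, symComul_one, LinearMap.mul'_apply, mul_one, map_one]
      intro n
      rcases n with _ | n <;> simp [Polynomial.coeff_one]
    · simp only [S, Submodule.mem_iInf, LinearMap.mem_eqLocus, LinearMap.comp_apply,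
        LinearMap.smul_apply, LinearMap.restrictScalars_apply, AlgHom.toLinearMap_apply,
        Polynomial.lcoeff_apply]
      intro i v hv a ih n
      rw [mul'_symComul_symι_mul 𝒱 hv, map_smul, symWeight_symι_mul, symWeight_symι_mul]
      rcases n with _ | n
      · simp
      · rw [Polynomial.coeff_smul, Polynomial.coeff_mul_X, Polynomial.coeff_mul_X,
          Polynomial.coeff_C_mul, Polynomial.coeff_C_mul, ih, mul_smul_comm, smul_smul, pow_succ']
  simp only [S, Submodule.mem_iInf, LinearMap.mem_eqLocus] at this
  exact this n

theorem coeff_zero_symWeight (a : GSym 𝒱) :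
    (symWeight 𝒱 a).coeff 0 = algebraMap K (GSym 𝒱) (symAug 𝒱 a) := by
  have : (Polynomial.lcoeff (GSym 𝒱) 0).restrictScalars K ∘ₗ (symWeight 𝒱).toLinearMap =
      Algebra.linearMap K (GSym 𝒱) ∘ₗ (symAug 𝒱).toLinearMap := by
    refine gsym_linearMap_ext 𝒱 (by simp) fun i v hv a ha => ?_
    simp [symWeight_symι_mul, symAug_symι_mul]
  exact LinearMap.congr_fun this a

theorem coeff_one_symWeight (a : GSym 𝒱) :
    (symWeight 𝒱 a).coeff 1 = symι 𝒱 (symPr 𝒱 a) := by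
  have : (Polynomial.lcoeff (GSym 𝒱) 1).restrictScalars K ∘ₗ (symWeight 𝒱).toLinearMap =
      symι 𝒱 ∘ₗ symPr 𝒱 := by
    refine gsym_linearMap_ext 𝒱 (by simp [Polynomial.coeff_one]) fun i v hv a ha => ?_
    simp [symWeight_symι_mul, coeff_zero_symWeight, Algebra.algebraMap_eq_smul_one,
      Polynomial.coeff_mul_X (n := 0)]
  exact LinearMap.congr_fun this a

/-- In characteristic zero the eigenspace of `μ ∘ Δ` for the eigenvalue `2` is `V`. -/
theorem eq_symι_of_mul'_symComul [CharZero K] {a : GSym 𝒱}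
    (ha : LinearMap.mul' K (GSym 𝒱) (symComul 𝒱 a) = (2 : K) • a) : a = symι 𝒱 (symPr 𝒱 a) := by
  have h : ∀ n, n ≠ 1 → (symWeight 𝒱 a).coeff n = 0 := by
    intro n hn
    have e := coeff_symWeight_mul' 𝒱 n a
    rw [ha, map_smul, Polynomial.coeff_smul, ← sub_eq_zero, ← sub_smul] at e
    refine (smul_eq_zero.1 e).resolve_left fun h0 => hn ?_
    have h1 : (2 : K) ^ 1 = 2 ^ n := by rw [pow_one]; exact sub_eq_zero.1 h0
    have h2 : (2 : ℕ) ^ 1 = 2 ^ n := by exact_mod_cast h1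
    exact (Nat.pow_right_injective le_rfl h2).symm
  have e : symWeight 𝒱 a = Polynomial.monomial 1 (symι 𝒱 (symPr 𝒱 a)) := by
    ext n
    by_cases hn : n = 1
    · subst hn
      rw [coeff_one_symWeight, Polynomial.coeff_monomial, if_pos rfl]
    · rw [h n hn, Polynomial.coeff_monomial, if_neg (Ne.symm hn)]
  have := eval_one_symWeight 𝒱 a
  rw [e, Polynomial.eval_monomial, one_pow, mul_one] at this
  exact this.symm

/-- In characteristic zero the primitive elements of `Sym(V)` are the vectors: an element of the
augmentation ideal with vanishing reduced coproduct lies in `V`. -/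
theorem eq_symι_of_primitive [CharZero K] {Y : GSym 𝒱} (hY : symAug 𝒱 Y = 0)
    (h : TensorProduct.map (symProj 𝒱) (symProj 𝒱) (symComul 𝒱 Y) = 0) :
    Y = symι 𝒱 (symPr 𝒱 Y) := by
  apply eq_symι_of_mul'_symComul
  -- `a b = ā b̄ + ε(a) b + a ε(b) - ε(a) ε(b)`, so on `Δ(Y)` the product is `0 + Y + Y - 0`
  have key : LinearMap.mul' K (GSym 𝒱) =
      LinearMap.mul' K (GSym 𝒱) ∘ₗ TensorProduct.map (SymBar 𝒱).subtype (SymBar 𝒱).subtype ∘ₗ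
        TensorProduct.map (symProj 𝒱) (symProj 𝒱) + augLeft 𝒱 + augRight 𝒱 -
        Algebra.linearMap K (GSym 𝒱) ∘ₗ (symAug 𝒱).toLinearMap ∘ₗ augLeft 𝒱 := by
    apply TensorProduct.ext'
    intro a b
    simp only [LinearMap.mul'_apply, LinearMap.sub_apply, LinearMap.add_apply,
      LinearMap.comp_apply, TensorProduct.map_tmul, Submodule.subtype_apply, coe_symProj,
      augLeft_tmul, augRight_tmul, Algebra.algebraMap_eq_smul_one, Algebra.linearMap_apply,
      AlgHom.toLinearMap_apply, map_smul, mul_sub, sub_mul, smul_mul_assoc, mul_smul_comm, one_mul,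
      mul_one, smul_eq_mul, smul_sub, smul_smul]
    rw [mul_comm (symAug 𝒱 b)]
    abel
  have e1 := LinearMap.congr_fun (augLeft_comp_symComul 𝒱) Y
  have e2 := LinearMap.congr_fun (augRight_comp_symComul 𝒱) Y
  simp only [LinearMap.comp_apply, LinearMap.id_apply] at e1 e2
  rw [key]
  simp only [LinearMap.sub_apply, LinearMap.add_apply, LinearMap.comp_apply, h, e1, e2, map_zero,
    AlgHom.toLinearMap_apply, hY, two_smul, zero_add, sub_zero]

end Primitives

/-! ### Cogeneration by `V` -/

section Cogeneration

variable {K V : Type*} [Field K] [AddCommGroup V] [Module K V] (𝒱 : ℤ → Submodule K V)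

variable [DirectSum.Decomposition 𝒱]

/-- An element `Z` killed by `δ` lies in `1 ⊗ S̄ym(V)`: contracting the outer legs of
`∑ (X₁ ⊗ X₂) ⊗ (X₃ ⊗ Y)` with the counit leaves the part of `Z` outside `1 ⊗ S̄ym(V)`. -/
theorem eq_one_tmul_of_comδ_eq_zero {Z : ComTrias 𝒱} (hZ : comδ 𝒱 Z = 0) :
    ∃ Y : SymBar 𝒱, Z = 1 ⊗ₜ Y := by
  -- `θ : (X₁ ⊗ X₂) ⊗ (X₃ ⊗ Y) ↦ ε(X₁) ε(X₃) X₂ ⊗ Y`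
  let θ : ComTrias 𝒱 ⊗[K] ComTrias 𝒱 →ₗ[K] ComTrias 𝒱 :=
    TensorProduct.map ((SymBar 𝒱).subtype ∘ₗ (TensorProduct.lid K (SymBar 𝒱)).toLinearMap ∘ₗ
        LinearMap.rTensor (SymBar 𝒱) (symAug 𝒱).toLinearMap)
      ((TensorProduct.lid K (SymBar 𝒱)).toLinearMap ∘ₗ
        LinearMap.rTensor (SymBar 𝒱) (symAug 𝒱).toLinearMap)
  have h1 : ∀ (t : (GSym 𝒱 ⊗[K] GSym 𝒱) ⊗[K] GSym 𝒱) (Y : SymBar 𝒱),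
      θ (LinearMap.rTensor (ComTrias 𝒱) (LinearMap.lTensor (GSym 𝒱) (symProj 𝒱))
        (TensorProduct.assoc K _ _ _ (t ⊗ₜ Y))) =
      ((SymBar 𝒱).subtype (symProj 𝒱 (augLeft 𝒱 ((TensorProduct.rid K _).toLinearMap
        (LinearMap.lTensor _ (symAug 𝒱).toLinearMap t))))) ⊗ₜ Y := by
    intro t Y
    induction t using TensorProduct.induction_on with
    | zero => simp
    | add x y hx hy => simp only [TensorProduct.add_tmul, map_add, hx, hy]
    | tmul u c =>
      induction u using TensorProduct.induction_on with
      | zero => simp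
      | add x y hx hy => simp only [TensorProduct.add_tmul, map_add, hx, hy]
      | tmul a b => simp [θ, smul_smul, TensorProduct.smul_tmul']
  have h2 : (TensorProduct.rid K _).toLinearMap ∘ₗ
      LinearMap.lTensor (GSym 𝒱 ⊗[K] GSym 𝒱) (symAug 𝒱).toLinearMap ∘ₗ
        LinearMap.rTensor (GSym 𝒱) (symComul 𝒱) = symComul 𝒱 ∘ₗ augRight 𝒱 := by
    apply TensorProduct.ext'
    intro a b
    simp
  have h3 : θ ∘ₗ comδ 𝒱 = LinearMap.rTensor (SymBar 𝒱) ((SymBar 𝒱).subtype ∘ₗ symProj 𝒱) := by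
    apply TensorProduct.ext'
    intro X Y
    have e1 := LinearMap.congr_fun h2 (symComul 𝒱 X)
    have e2 := LinearMap.congr_fun (augRight_comp_symComul 𝒱) X
    have e3 := LinearMap.congr_fun (augLeft_comp_symComul 𝒱) X
    simp only [LinearMap.comp_apply, LinearMap.id_apply] at e1 e2 e3
    have := h1 (LinearMap.rTensor (GSym 𝒱) (symComul 𝒱) (symComul 𝒱 X)) Y
    rw [e1, e2, e3] at this
    exact this
  have h4 : ∀ Z : ComTrias 𝒱,
      Z = LinearMap.rTensor (SymBar 𝒱) ((SymBar 𝒱).subtype ∘ₗ symProj 𝒱) Z +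
        1 ⊗ₜ (TensorProduct.lid K (SymBar 𝒱) (LinearMap.rTensor (SymBar 𝒱)
          (symAug 𝒱).toLinearMap Z)) := by
    intro Z
    induction Z using TensorProduct.induction_on with
    | zero => simp
    | add x y hx hy =>
      rw [map_add, map_add, map_add, TensorProduct.tmul_add, add_add_add_comm, ← hx, ← hy]
    | tmul X Y =>
      simp [coe_symProj, TensorProduct.sub_tmul, Algebra.algebraMap_eq_smul_one,
        TensorProduct.smul_tmul']
  refine ⟨TensorProduct.lid K (SymBar 𝒱) (LinearMap.rTensor (SymBar 𝒱)
    (symAug 𝒱).toLinearMap Z), (h4 Z).trans ?_⟩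
  have := LinearMap.congr_fun h3 Z
  rw [LinearMap.comp_apply, hZ, map_zero] at this
  rw [← this, zero_add]

/-- `ComTriasᶜ(V)` is cogenerated by `V`: in characteristic zero an element killed by both
coproducts and by the projection to `V` is zero. -/
theorem eq_zero_of_comul_eq_zero [CharZero K] {Z : ComTrias 𝒱} (hΔ : comΔ 𝒱 Z = 0)
    (hδ : comδ 𝒱 Z = 0) (hpr : comPr 𝒱 Z = 0) : Z = 0 := by
  obtain ⟨Y, rfl⟩ := eq_one_tmul_of_comδ_eq_zero 𝒱 hδ
  -- contracting the `Sym(V)`-factors with the counit turns `Δ(1 ⊗ Y)` into the reduced coproduct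
  -- of `Y`
  have h : ∀ t : GSym 𝒱 ⊗[K] GSym 𝒱, TensorProduct.map
      ((TensorProduct.lid K (SymBar 𝒱)).toLinearMap ∘ₗ
        LinearMap.rTensor (SymBar 𝒱) (symAug 𝒱).toLinearMap)
      ((TensorProduct.lid K (SymBar 𝒱)).toLinearMap ∘ₗ
        LinearMap.rTensor (SymBar 𝒱) (symAug 𝒱).toLinearMap)
      (TensorProduct.map (LinearMap.lTensor (GSym 𝒱) (symProj 𝒱))
        (LinearMap.lTensor (GSym 𝒱) (symProj 𝒱)) (midSwap 𝒱 ((1 ⊗ₜ 1) ⊗ₜ t))) =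
      TensorProduct.map (symProj 𝒱) (symProj 𝒱) t := by
    intro t
    induction t using TensorProduct.induction_on with
    | zero => simp
    | add x y hx hy => simp only [TensorProduct.tmul_add, map_add, hx, hy]
    | tmul a b =>
      induction a using DirectSum.Decomposition.inductionOn (symGr 𝒱) with
      | zero => simp
      | add x y hx hy => simp only [TensorProduct.tmul_add, TensorProduct.add_tmul, map_add, hx, hy]
      | homogeneous x =>
        rw [midSwap_tmul 𝒱 _ _ (one_mem_symGr 𝒱) x.2]
        simp
  have hY := h (symComul 𝒱 (Y : GSym 𝒱))
  have e : comΔ 𝒱 (1 ⊗ₜ Y) = TensorProduct.map (LinearMap.lTensor (GSym 𝒱) (symProj 𝒱))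
      (LinearMap.lTensor (GSym 𝒱) (symProj 𝒱))
        (midSwap 𝒱 ((1 ⊗ₜ 1) ⊗ₜ symComul 𝒱 (Y : GSym 𝒱))) := by
    simp [comΔ]
  rw [← e, hΔ, map_zero] at hY
  have hY' := eq_symι_of_primitive 𝒱 Y.2 hY.symm
  have hpr' : symPr 𝒱 (Y : GSym 𝒱) = 0 := by simpa [comPr] using hpr
  rw [hpr', map_zero] at hY'
  rw [Subtype.ext (a1 := Y) (a2 := 0) hY', TensorProduct.tmul_zero]

/-- The span of the tensors of homogeneous monomials of total length `n`. -/
def lenTens (n : ℕ) : Submodule K (GSym 𝒱 ⊗[K] GSym 𝒱) :=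
  Submodule.span K {t | ∃ a b : List (ℤ × V), HomogList 𝒱 a ∧ HomogList 𝒱 b ∧
    a.length + b.length = n ∧ lmon 𝒱 a ⊗ₜ[K] lmon 𝒱 b = t}

/-- The coproduct preserves the total length. -/
theorem symComul_lmon_mem {l : List (ℤ × V)} (hl : HomogList 𝒱 l) :
    symComul 𝒱 (lmon 𝒱 l) ∈ lenTens 𝒱 l.length := by
  induction l with
  | nil => exact Submodule.subset_span ⟨[], [], hl, hl, rfl, by simp [lmon]⟩
  | cons p l ih =>
    obtain ⟨i, v⟩ := p
    have hv : v ∈ 𝒱 i := hl _ List.mem_cons_self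
    have hl' : HomogList 𝒱 l := fun q hq => hl q (List.mem_cons_of_mem _ hq)
    have e : lmon 𝒱 ((i, v) :: l) = symι 𝒱 v * lmon 𝒱 l := by simp [lmon]
    rw [e, symComul_symι_mul 𝒱 hv]
    refine (Submodule.span_le (p := (lenTens 𝒱 (l.length + 1)).comap
      (coact (tw 𝒱 i) (lmul 𝒱 v)))).2 ?_ (ih hl')
    rintro _ ⟨a, b, ha, hb, hab, rfl⟩
    rw [SetLike.mem_coe, Submodule.mem_comap, coact_tmul]
    refine add_mem (Submodule.subset_span ⟨(i, v) :: a, b, HomogList.cons hv ha, hb, ?_, ?_⟩) ?_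
    · simp only [List.length_cons]; omega
    · simp [lmon]
    · rw [tw_of_mem 𝒱 i ha.lmon_mem, ← TensorProduct.smul_tmul']
      refine Submodule.smul_mem _ _ (Submodule.subset_span ⟨a, (i, v) :: b, ha,
        HomogList.cons hv hb, ?_, ?_⟩)
      · simp only [List.length_cons]; omega
      · simp [lmon]

/-- A coderivation `D` whose corestriction to `V` vanishes is zero. By induction on the total
length of a monomial `Z`: the factors of the terms of `Δ(Z)` and `δ(Z)` are shorter, so both
coproducts of `D(Z)` vanish, and `D(Z) = 0` by `eq_zero_of_comul_eq_zero`. -/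
theorem coDer_eq_zero [CharZero K] {k : ℤ} {D : ComTrias 𝒱 →ₗ[K] ComTrias 𝒱} (hD : D ∈ CoDer 𝒱 k)
    (hpr : comPr 𝒱 ∘ₗ D = 0) : D = 0 := by
  have key : ∀ (N : ℕ) (l l' : List (ℤ × V)), HomogList 𝒱 l → HomogList 𝒱 l' →
      l.length + l'.length < N → D (lmon 𝒱 l ⊗ₜ barMon 𝒱 (l'.map Prod.snd)) = 0 := by
    intro N
    induction N with
    | zero => intro l l' _ _ h; omega
    | succ N ih =>
      intro l l' hl hl' hN
      by_cases hne : l' = []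
      · subst hne
        simp [barMon]
      have hpos : 0 < l'.length := List.length_pos_iff.2 hne
      -- both factors of a term are shorter, so `D ⊗ 1 + 1 ⊗ D` kills it
      have hL : ∀ a b c d : List (ℤ × V), HomogList 𝒱 a → HomogList 𝒱 b → HomogList 𝒱 c →
          HomogList 𝒱 d → a.length + b.length + c.length + d.length ≤ N →
          leibniz 𝒱 k D ((lmon 𝒱 a ⊗ₜ barMon 𝒱 (b.map Prod.snd)) ⊗ₜ
            (lmon 𝒱 c ⊗ₜ barMon 𝒱 (d.map Prod.snd))) = 0 := by
        intro a b c d ha hb hc hd h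
        by_cases hb' : b = []
        · subst hb'; simp [barMon]
        by_cases hd' : d = []
        · subst hd'; simp [barMon]
        have hb'' := List.length_pos_iff.2 hb'
        have hd'' := List.length_pos_iff.2 hd'
        rw [leibniz, LinearMap.add_apply, TensorProduct.map_tmul, TensorProduct.map_tmul,
          ih a b ha hb (by omega), ih c d hc hd (by omega)]
        simp
      refine eq_zero_of_comul_eq_zero 𝒱 ?_ ?_ (LinearMap.congr_fun hpr _)
      · refine (LinearMap.congr_fun hD.2.1 _).trans ?_
        have hl'' : (barMon 𝒱 (l'.map Prod.snd) : GSym 𝒱) = lmon 𝒱 l' :=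
          coe_barMon 𝒱 (by simpa using hne)
        let Λ : (GSym 𝒱 ⊗[K] GSym 𝒱) ⊗[K] (GSym 𝒱 ⊗[K] GSym 𝒱) →ₗ[K]
            ComTrias 𝒱 ⊗[K] ComTrias 𝒱 := leibniz 𝒱 k D ∘ₗ
          TensorProduct.map (LinearMap.lTensor (GSym 𝒱) (symProj 𝒱))
            (LinearMap.lTensor (GSym 𝒱) (symProj 𝒱)) ∘ₗ midSwap 𝒱
        have hΛ : ∀ t ∈ lenTens 𝒱 l.length, ∀ s ∈ lenTens 𝒱 l'.length, Λ (t ⊗ₜ s) = 0 := by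
          intro t ht s hs
          refine (Submodule.span_le (p := LinearMap.ker (Λ ∘ₗ
            (TensorProduct.mk K _ (GSym 𝒱 ⊗[K] GSym 𝒱)).flip s))).2 ?_ ht
          rintro _ ⟨a, b, ha, hb, hab, rfl⟩
          refine (Submodule.span_le (p := LinearMap.ker (Λ ∘ₗ
            TensorProduct.mk K (GSym 𝒱 ⊗[K] GSym 𝒱) _ (lmon 𝒱 a ⊗ₜ lmon 𝒱 b)))).2 ?_ hs
          rintro _ ⟨c, d, hc, hd, hcd, rfl⟩
          change Λ _ = 0
          simp only [Λ, LinearMap.comp_apply, TensorProduct.mk_apply]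
          rw [midSwap_tmul 𝒱 _ _ hb.lmon_mem hc.lmon_mem, map_smul, map_smul]
          refine smul_eq_zero_of_right _ (hL a c b d ha hc hb hd ?_)
          omega
        rw [← hΛ _ (symComul_lmon_mem 𝒱 hl) _ (symComul_lmon_mem 𝒱 hl'), ← hl'']
        rfl
      · refine (LinearMap.congr_fun hD.2.2 _).trans ?_
        let Λ : (GSym 𝒱 ⊗[K] GSym 𝒱) ⊗[K] GSym 𝒱 →ₗ[K]
            ComTrias 𝒱 ⊗[K] ComTrias 𝒱 := leibniz 𝒱 k D ∘ₗ
          LinearMap.rTensor (ComTrias 𝒱) (LinearMap.lTensor (GSym 𝒱) (symProj 𝒱)) ∘ₗ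
            (TensorProduct.assoc K _ _ _).toLinearMap ∘ₗ
              (TensorProduct.mk K ((GSym 𝒱 ⊗[K] GSym 𝒱) ⊗[K] GSym 𝒱) (SymBar 𝒱)).flip
                (barMon 𝒱 (l'.map Prod.snd))
        have hΛ : ∀ t ∈ lenTens 𝒱 l.length, Λ (LinearMap.rTensor (GSym 𝒱) (symComul 𝒱) t) = 0 := by
          intro t ht
          refine (Submodule.span_le (p := LinearMap.ker (Λ ∘ₗ
            LinearMap.rTensor (GSym 𝒱) (symComul 𝒱)))).2 ?_ ht
          rintro _ ⟨a, b, ha, hb, hab, rfl⟩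
          refine (Submodule.span_le (p := LinearMap.ker (Λ ∘ₗ
            (TensorProduct.mk K _ (GSym 𝒱)).flip (lmon 𝒱 b)))).2 ?_ (symComul_lmon_mem 𝒱 ha)
          rintro _ ⟨c, d, hc, hd, hcd, rfl⟩
          exact hL c d b l' hc hd hb hl' (by omega)
        exact hΛ _ (symComul_lmon_mem 𝒱 hl)
  refine comTrias_ext_lmon 𝒱 fun l l' hl hl' _ => ?_
  exact key _ l l' hl hl' (Nat.lt_succ_self _)

theorem sndCoder_add (k : ℤ) (ρ ρ' : GSym 𝒱 ⊗[K] GSym 𝒱 →ₗ[K] V) :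
    sndCoder 𝒱 k (ρ + ρ') = sndCoder 𝒱 k ρ + sndCoder 𝒱 k ρ' := by
  simp only [sndCoder, sndInsert, LinearMap.comp_add, LinearMap.rTensor_add,
    TensorProduct.map_add_right, LinearMap.add_comp]

theorem sndCoder_smul (k : ℤ) (r : K) (ρ : GSym 𝒱 ⊗[K] GSym 𝒱 →ₗ[K] V) :
    sndCoder 𝒱 k (r • ρ) = r • sndCoder 𝒱 k ρ := by
  simp only [sndCoder, sndInsert, LinearMap.comp_smul, LinearMap.rTensor_smul,
    TensorProduct.map_smul_right, LinearMap.smul_comp]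

theorem symCoder_add (ρ ρ' : GSym 𝒱 →ₗ[K] V) :
    symCoder 𝒱 (ρ + ρ') = symCoder 𝒱 ρ + symCoder 𝒱 ρ' := by
  simp only [symCoder, LinearMap.comp_add, LinearMap.rTensor_add, LinearMap.add_comp]

theorem symCoder_smul (r : K) (ρ : GSym 𝒱 →ₗ[K] V) :
    symCoder 𝒱 (r • ρ) = r • symCoder 𝒱 ρ := by
  simp only [symCoder, LinearMap.comp_smul, LinearMap.rTensor_smul, LinearMap.smul_comp]

/-- `R ↦ Ψ(R)` as a linear map `Homᵏ → coDerᵏ`. -/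
noncomputable def psiHom (k : ℤ) : HomDeg 𝒱 k →ₗ[K] CoDer 𝒱 k where
  toFun R := ⟨psi 𝒱 k R, psi_mem 𝒱 R.2⟩
  map_add' R S := Subtype.ext <| by
    simp only [psi, tensCoder, Submodule.coe_add, LinearMap.add_comp, sndCoder_add, symCoder_add,
      LinearMap.rTensor_add, LinearMap.comp_add]
    abel
  map_smul' r R := Subtype.ext <| by
    simp only [psi, tensCoder, Submodule.coe_smul, LinearMap.smul_comp, sndCoder_smul,
      symCoder_smul, LinearMap.rTensor_smul, LinearMap.comp_smul, LinearMap.comp_add,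
      LinearMap.add_comp, smul_add, RingHom.id_apply]

/-- `Ψ` is bijective, with inverse `D ↦ pr ∘ D`. -/
theorem psiHom_bijective [CharZero K] (k : ℤ) : Function.Bijective (psiHom 𝒱 k) := by
  refine ⟨fun R S h => Subtype.ext ?_, fun D => ?_⟩
  · have h' : psi 𝒱 k R = psi 𝒱 k S := congrArg Subtype.val h
    rw [← comPr_comp_psi 𝒱 k R, h', comPr_comp_psi]
  · let R : HomDeg 𝒱 k := ⟨comPr 𝒱 ∘ₗ D, fun d c hc => comPr_mem 𝒱 (D.2.1 d c hc)⟩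
    have h : psi 𝒱 k (comPr 𝒱 ∘ₗ D) + (-1 : K) • (D : ComTrias 𝒱 →ₗ[K] ComTrias 𝒱) = 0 := by
      refine coDer_eq_zero 𝒱 (add_mem (psi_mem 𝒱 R.2) (Submodule.smul_mem _ _ D.2)) ?_
      refine LinearMap.ext fun c => ?_
      have := LinearMap.congr_fun (comPr_comp_psi 𝒱 k (comPr 𝒱 ∘ₗ D)) c
      simp only [LinearMap.comp_apply] at this
      simp [this]
    refine ⟨R, Subtype.ext (LinearMap.ext fun c => ?_)⟩
    have hc := LinearMap.congr_fun h c
    rw [LinearMap.add_apply, LinearMap.smul_apply, LinearMap.zero_apply] at hc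
    have h0 : ∀ b : ComTrias 𝒱, (-1 : K) • b + b = 0 := fun b => by
      nth_rw 2 [← one_smul K b]
      rw [← add_smul, neg_add_cancel, zero_smul]
    calc psi 𝒱 k (comPr 𝒱 ∘ₗ D) c
        = psi 𝒱 k (comPr 𝒱 ∘ₗ D) c + ((-1 : K) • (D : ComTrias 𝒱 →ₗ[K] ComTrias 𝒱) c +
          (D : ComTrias 𝒱 →ₗ[K] ComTrias 𝒱) c) := by rw [h0, add_zero]
      _ = (D : ComTrias 𝒱 →ₗ[K] ComTrias 𝒱) c := by rw [← add_assoc, hc, zero_add]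

end Cogeneration

/-! ### Coproducts of monomials -/

section Expansion

variable {K V : Type*} [Field K] [AddCommGroup V] [Module K V] (𝒱 : ℤ → Submodule K V)

section Colourings

variable {α : Type*} {n r : ℕ}

/-- The entries of `x` whose position has colour `j`, in their original order. -/
def colourClass (c : Fin n → Fin r) (j : Fin r) (x : Fin n → α) : List α :=
  ((List.finRange n).filter fun i => c i = j).map x

theorem colourClass_cons (c : Fin n → Fin r) (i j : Fin r) (x : Fin (n + 1) → α) :
    colourClass (Fin.cons i c : Fin (n + 1) → Fin r) j x =
      if i = j then x 0 :: colourClass c j (fun a => x a.succ)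
      else colourClass c j (fun a => x a.succ) := by
  have h : ((List.finRange n).map Fin.succ).filter
      (fun a => decide ((Fin.cons i c : Fin (n + 1) → Fin r) a = j)) =
      ((List.finRange n).filter fun a => decide (c a = j)).map Fin.succ := by
    rw [List.filter_map]
    rfl
  rw [colourClass, List.finRange_succ, List.filter_cons, h]
  split_ifs with h1 h2 h2 <;> simp_all [colourClass, Function.comp_def]

variable (K) in
/-- The Koszul sign of the unshuffle of a word along a colouring of its letters: the product of
`(-1)^{|x_a||x_b|}` over the pairs `a < b` whose colours are in decreasing order. -/
def colourSign (d : Fin n → ℤ) (c : Fin n → Fin r) : K :=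
  ∏ a : Fin n, ∏ b : Fin n, if a < b ∧ c b < c a then sgn K (d a * d b) else 1

/-- Recursion in the first letter, which is inverted with the later letters of smaller colour. -/
theorem colourSign_cons (d : Fin (n + 1) → ℤ) (i : Fin r) (c : Fin n → Fin r) :
    colourSign K d (Fin.cons i c : Fin (n + 1) → Fin r) =
      (∏ b : Fin n, if c b < i then sgn K (d 0 * d b.succ) else 1) *
        colourSign K (fun a => d a.succ) c := by
  simp [colourSign, Fin.prod_univ_succ]

theorem prod_sgn_colourClass (e : ℤ) (d : Fin n → ℤ) (c : Fin n → Fin r) (j : Fin r) :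
    (∏ b : Fin n, if c b = j then sgn K (e * d b) else 1) =
      sgn K (e * (colourClass c j d).sum) := by
  induction n with
  | zero => simp [colourClass]
  | succ n ih =>
    obtain ⟨i, c, rfl⟩ : ∃ i c', c = Fin.cons i c' := ⟨c 0, Fin.tail c, (Fin.cons_self_tail c).symm⟩
    rw [Fin.prod_univ_succ, colourClass_cons]
    simp only [Fin.cons_zero, Fin.cons_succ]
    rw [ih (fun a => d a.succ) c]
    split_ifs
    · rw [List.sum_cons, sgn_mul_sum_cons]
    · rw [one_mul]

theorem sum_colouring_succ {M : Type*} [AddCommMonoid M] (f : (Fin (n + 1) → Fin r) → M) :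
    ∑ c, f c = ∑ i : Fin r, ∑ c : Fin n → Fin r, f (Fin.cons i c) := by
  rw [← (Fin.consEquiv fun _ : Fin (n + 1) => Fin r).sum_comp, Fintype.sum_prod_type]
  rfl

end Colourings

section Monomials

variable [DirectSum.Decomposition 𝒱]

omit [DirectSum.Decomposition 𝒱] in
theorem mon_colourClass_mem {n r : ℕ} {x : Fin n → V} {d : Fin n → ℤ} (hx : ∀ i, x i ∈ 𝒱 (d i))
    (c : Fin n → Fin r) (j : Fin r) :
    mon 𝒱 (colourClass c j x) ∈ symGr 𝒱 (colourClass c j d).sum := by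
  refine Submodule.subset_span
    ⟨colourClass c j fun i => (d i, x i), ?_, ?_, ?_⟩
  · simp only [colourClass, List.mem_map]
    rintro _ ⟨i, -, rfl⟩
    exact hx i
  · simp [colourClass, Function.comp_def]
  · simp [colourClass, Function.comp_def]

/-- The coproduct of a monomial is the sum over all colourings of its letters by two colours. -/
theorem symComul_mon {n : ℕ} {x : Fin n → V} {d : Fin n → ℤ} (hx : ∀ i, x i ∈ 𝒱 (d i)) :
    symComul 𝒱 (mon 𝒱 (List.ofFn x)) = ∑ c : Fin n → Fin 2, colourSign K d c •
      (mon 𝒱 (colourClass c 0 x) ⊗ₜ[K] mon 𝒱 (colourClass c 1 x)) := by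
  induction n with
  | zero => simp [colourSign, colourClass]
  | succ n ih =>
    have hx' : ∀ i : Fin n, x i.succ ∈ 𝒱 (d i.succ) := fun i => hx _
    rw [List.ofFn_succ, mon_cons, symComul_symι_mul 𝒱 (hx 0), ih hx', map_sum, sum_colouring_succ,
      Fin.sum_univ_two, ← Finset.sum_add_distrib]
    refine Finset.sum_congr rfl fun c _ => ?_
    have e : ∀ b, (c b < (1 : Fin 2)) = (c b = 0) := fun b => by
      rw [Fin.lt_one_iff]
    simp only [map_smul, coact_tmul, lmul_apply, colourSign_cons, colourClass_cons,
      tw_of_mem 𝒱 _ (mon_colourClass_mem 𝒱 hx' c 0), smul_add, e, prod_sgn_colourClass (d 0) _ c 0]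
    simp [mul_smul, ← TensorProduct.smul_tmul', smul_comm (colourSign K _ _)]

/-- The iterated coproduct of a monomial is the sum over all colourings of its letters by three
colours. -/
theorem rTensor_symComul_mon {n : ℕ} {x : Fin n → V} {d : Fin n → ℤ} (hx : ∀ i, x i ∈ 𝒱 (d i)) :
    LinearMap.rTensor (GSym 𝒱) (symComul 𝒱) (symComul 𝒱 (mon 𝒱 (List.ofFn x))) =
      ∑ c : Fin n → Fin 3, colourSign K d c • ((mon 𝒱 (colourClass c 0 x) ⊗ₜ[K]
        mon 𝒱 (colourClass c 1 x)) ⊗ₜ[K] mon 𝒱 (colourClass c 2 x)) := by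
  induction n with
  | zero => simp [colourSign, colourClass]
  | succ n ih =>
    have hx' : ∀ i : Fin n, x i.succ ∈ 𝒱 (d i.succ) := fun i => hx _
    have h : LinearMap.rTensor (GSym 𝒱) (symComul 𝒱) ∘ₗ coact (tw 𝒱 (d 0)) (lmul 𝒱 (x 0)) =
        (TensorProduct.map (coact (tw 𝒱 (d 0)) (lmul 𝒱 (x 0))) LinearMap.id +
          TensorProduct.map (TensorProduct.map (tw 𝒱 (d 0)) (tw 𝒱 (d 0))) (lmul 𝒱 (x 0))) ∘ₗ
        LinearMap.rTensor (GSym 𝒱) (symComul 𝒱) := by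
      apply TensorProduct.ext'
      intro a b
      simp [symComul_symι_mul 𝒱 (hx 0), symComul_tw]
    have h' := LinearMap.congr_fun h (symComul 𝒱 (mon 𝒱 (List.ofFn fun i => x i.succ)))
    simp only [LinearMap.comp_apply] at h'
    rw [List.ofFn_succ, mon_cons, symComul_symι_mul 𝒱 (hx 0), h', ih hx', map_sum,
      sum_colouring_succ, Fin.sum_univ_three, ← Finset.sum_add_distrib, ← Finset.sum_add_distrib]
    refine Finset.sum_congr rfl fun c _ => ?_
    have e1 : ∀ b, (c b < (1 : Fin 3)) = (c b = 0) := fun b => by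
      rw [Fin.lt_one_iff]
    have e2 : ∀ (b : Fin n) (s : K), (if c b < (2 : Fin 3) then s else 1) =
        (if c b = 0 then s else 1) * (if c b = 1 then s else 1) := fun b s => by
      generalize c b = z
      fin_cases z <;> simp
    simp only [map_smul, LinearMap.add_apply, TensorProduct.map_tmul, LinearMap.id_apply,
      coact_tmul, lmul_apply, colourSign_cons, colourClass_cons,
      tw_of_mem 𝒱 _ (mon_colourClass_mem 𝒱 hx' c 0), tw_of_mem 𝒱 _ (mon_colourClass_mem 𝒱 hx' c 1),
      smul_add, e1, e2, Finset.prod_mul_distrib, prod_sgn_colourClass (d 0) _ c]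
    simp [mul_smul, ← TensorProduct.smul_tmul', smul_comm (colourSign K _ _),
      TensorProduct.add_tmul]
    rw [smul_comm (sgn K (d 0 * (colourClass c 1 fun i => d i.succ).sum))]

/-- The value of `Ψ(R)` on a monomial as a sum over colourings. -/
theorem psi_mon (k : ℤ) (R : ComTrias 𝒱 →ₗ[K] V) {n m : ℕ} (hm : 1 ≤ m) {x : Fin n → V}
    {dx : Fin n → ℤ} {y : Fin m → V} {dy : Fin m → ℤ} (hx : ∀ i, x i ∈ 𝒱 (dx i))
    (hy : ∀ i, y i ∈ 𝒱 (dy i)) :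
    psi 𝒱 k R (mon 𝒱 (List.ofFn x) ⊗ₜ[K] barMon 𝒱 (List.ofFn y)) =
      (∑ c : Fin n → Fin 3, colourSign K dx c • (mon 𝒱 (R (mon 𝒱 (colourClass c 0 x) ⊗ₜ
        barMon 𝒱 (colourClass c 1 x)) :: colourClass c 2 x) ⊗ₜ[K] barMon 𝒱 (List.ofFn y))) +
      ∑ c : Fin n → Fin 2, ∑ e : Fin m → Fin 2,
        (colourSign K dx c * colourSign K dy e * sgn K (k * (colourClass c 0 dx).sum)) •
          (mon 𝒱 (colourClass c 0 x) ⊗ₜ[K] barMon 𝒱 (R (mon 𝒱 (colourClass c 1 x) ⊗ₜ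
            barMon 𝒱 (colourClass e 0 y)) :: colourClass e 1 y)) := by
  have hne : List.ofFn y ≠ [] := by
    intro h
    have := congrArg List.length h
    simp at this
    omega
  have hb : ∀ l, symProj 𝒱 (mon 𝒱 l) = barMon 𝒱 l := fun _ => rfl
  have h1 : symCoder 𝒱 ((R ∘ₗ comProj 𝒱) ∘ₗ symComul 𝒱) (mon 𝒱 (List.ofFn x)) =
      ∑ c : Fin n → Fin 3, colourSign K dx c • mon 𝒱 (R (mon 𝒱 (colourClass c 0 x) ⊗ₜ
        barMon 𝒱 (colourClass c 1 x)) :: colourClass c 2 x) := by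
    rw [symCoder, ← LinearMap.comp_assoc (symComul 𝒱) _ (symι 𝒱), LinearMap.rTensor_comp]
    simp only [LinearMap.comp_apply, rTensor_symComul_mon 𝒱 hx, map_sum, map_smul,
      LinearMap.rTensor_tmul, LinearMap.mul'_apply, mon_cons, comProj_tmul, hb]
  have h2 : sndCoder 𝒱 k (R ∘ₗ comProj 𝒱) (mon 𝒱 (List.ofFn x) ⊗ₜ mon 𝒱 (List.ofFn y)) =
      ∑ c : Fin n → Fin 2, ∑ e : Fin m → Fin 2,
        (colourSign K dx c * colourSign K dy e * sgn K (k * (colourClass c 0 dx).sum)) •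
          (mon 𝒱 (colourClass c 0 x) ⊗ₜ[K] mon 𝒱 (R (mon 𝒱 (colourClass c 1 x) ⊗ₜ
            barMon 𝒱 (colourClass e 0 y)) :: colourClass e 1 y)) := by
    simp only [sndCoder, LinearMap.comp_apply, TensorProduct.map_tmul, symComul_mon 𝒱 hx,
      symComul_mon 𝒱 hy, TensorProduct.sum_tmul, TensorProduct.tmul_sum, map_sum]
    rw [Finset.sum_comm]
    refine Finset.sum_congr rfl fun c _ => Finset.sum_congr rfl fun e _ => ?_
    rw [TensorProduct.smul_tmul_smul, map_smul, sndInsert_tmul,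
      tw_of_mem 𝒱 _ (mon_colourClass_mem 𝒱 hx _ _), ← TensorProduct.smul_tmul', smul_smul,
      mon_cons, LinearMap.comp_apply, comProj_tmul, hb]
  rw [psi, LinearMap.comp_apply, LinearMap.comp_apply, comIncl_tmul, coe_barMon 𝒱 hne, tensCoder,
    LinearMap.add_apply, LinearMap.rTensor_tmul, h1, h2, map_add]
  congr 1
  · simp only [TensorProduct.sum_tmul, map_sum, ← TensorProduct.smul_tmul', map_smul, comProj_tmul,
      hb]
  · simp only [map_sum, map_smul, comProj_tmul, hb]

end Monomials

end Expansion

/-! ### Shuffles and colourings -/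

section ShuffleSums

variable {K V : Type*} [Field K] [AddCommGroup V] [Module K V] (𝒱 : ℤ → Submodule K V)

section Shuffles

variable {n r : ℕ}

/-- A permutation is a block shuffle for the block labelling `blk` of the positions if it increases
on each block. -/
def IsBlockShuffle (blk : Fin n → Fin r) (σ : Equiv.Perm (Fin n)) : Prop :=
  ∀ a b, a < b → blk a = blk b → σ a < σ b

/-- A block shuffle is the stable sort of the colouring that records the block of each letter. -/
theorem IsBlockShuffle.eq_sort {blk c : Fin n → Fin r} (hblk : Monotone blk)
    {σ : Equiv.Perm (Fin n)} (hσ : IsBlockShuffle blk σ) (hc : c ∘ σ = blk) : σ = Tuple.sort c := by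
  rw [Tuple.eq_sort_iff, hc]
  refine ⟨hblk, fun i j hij h => hσ i j hij ?_⟩
  rw [← hc]
  exact h

theorem isBlockShuffle_sort {blk c : Fin n → Fin r} (hc : c ∘ Tuple.sort c = blk) :
    IsBlockShuffle blk (Tuple.sort c) := by
  intro a b hab h
  rw [← hc] at h
  exact (Tuple.eq_sort_iff.1 rfl).2 a b hab h

/-- The Koszul sign of a block shuffle depends on the inversions of its colouring only. -/
theorem IsBlockShuffle.koszul_eq {blk c : Fin n → Fin r} (hblk : Monotone blk)
    {σ : Equiv.Perm (Fin n)} (hσ : IsBlockShuffle blk σ) (hc : c ∘ σ = blk) (d : Fin n → ℤ) :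
    koszul K d σ = colourSign K d c := by
  rw [koszul, colourSign, Finset.prod_comm, ← Equiv.prod_comp σ fun a => ∏ b : Fin n,
    if a < b ∧ c b < c a then sgn K (d a * d b) else 1]
  refine Finset.prod_congr rfl fun b _ => ?_
  rw [← Equiv.prod_comp σ fun a => if σ b < a ∧ c a < c (σ b) then sgn K (d (σ b) * d a) else 1]
  refine Finset.prod_congr rfl fun a _ => ?_
  have hc' : ∀ a, c (σ a) = blk a := fun a => congrFun hc a
  rw [hc', hc', mul_comm]
  refine if_congr ?_ rfl rfl
  constructor
  · rintro ⟨h1, h2⟩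
    refine ⟨h2, lt_of_le_of_ne (hblk h1.le) fun h => ?_⟩
    exact absurd (hσ a b h1 h) h2.asymm
  · rintro ⟨h1, h2⟩
    refine ⟨?_, h1⟩
    by_contra hab
    exact absurd (hblk (not_lt.1 hab)) (not_le.2 h2)

/-- The letters of colour `j` are those that a block shuffle moves to the block `j`. -/
theorem IsBlockShuffle.colourClass_eq {blk c : Fin n → Fin r} {σ : Equiv.Perm (Fin n)}
    (hσ : IsBlockShuffle blk σ) (hc : c ∘ σ = blk) {α : Type*} (x : Fin n → α) (j : Fin r) :
    colourClass c j x = ((List.finRange n).filter fun a => blk a = j).map fun a => x (σ a) := by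
  have h : ((List.finRange n).filter fun i => c i = j) =
      ((List.finRange n).filter fun a => blk a = j).map σ := by
    refine List.Perm.eq_of_pairwise (le := (· < ·)) (fun a b _ _ h1 h2 => absurd h1 h2.asymm)
      ?_ ?_ ?_
    · exact (List.pairwise_lt_finRange n).filter _
    · rw [List.pairwise_map, List.pairwise_filter]
      refine (List.pairwise_lt_finRange n).imp fun {a b} hab ha hb => hσ a b hab ?_
      rw [of_decide_eq_true ha, of_decide_eq_true hb]
    · have e : (fun a : Fin n => decide (blk a = j)) = (fun i => decide (c i = j)) ∘ σ := by
        ext a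
        rw [← hc]
        rfl
      rw [e, ← List.filter_map]
      refine List.Perm.filter _ ?_
      exact (Equiv.Perm.map_finRange_perm σ).symm
  rw [colourClass, h, List.map_map]
  rfl

/-- Sums over block shuffles are sums over the colourings with the given block sizes. -/
theorem sum_blockShuffle {M : Type*} [AddCommMonoid M] {blk : Fin n → Fin r} (hblk : Monotone blk)
    (S : Finset (Equiv.Perm (Fin n))) (hS : ∀ σ, σ ∈ S ↔ IsBlockShuffle blk σ)
    (T : Finset (Fin n → Fin r)) (hT : ∀ c, c ∈ T ↔ c ∘ Tuple.sort c = blk)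
    (f : Equiv.Perm (Fin n) → M) (g : (Fin n → Fin r) → M)
    (hfg : ∀ σ c, IsBlockShuffle blk σ → c ∘ σ = blk → f σ = g c) :
    ∑ σ ∈ S, f σ = ∑ c ∈ T, g c := by
  have h0 : ∀ σ : Equiv.Perm (Fin n), (blk ∘ σ.symm) ∘ σ = blk := fun σ => by
    ext a; simp
  have h1 : ∀ σ ∈ S, σ = Tuple.sort (blk ∘ σ.symm) := fun σ hσ =>
    ((hS σ).1 hσ).eq_sort hblk (h0 σ)
  refine Finset.sum_bij' (fun σ _ => blk ∘ σ.symm) (fun c _ => Tuple.sort c) ?_ ?_ ?_ ?_ ?_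
  · intro σ hσ
    rw [hT, ← h1 σ hσ, h0]
  · intro c hc
    exact (hS _).2 (isBlockShuffle_sort ((hT c).1 hc))
  · intro σ hσ
    exact (h1 σ hσ).symm
  · intro c hc
    rw [← (hT c).1 hc]
    ext a
    simp
  · intro σ hσ
    exact hfg σ _ ((hS σ).1 hσ) (h0 σ)

/-- The block labelling of `n` positions with a first block of size `p` and a second of size `q`. -/
def blockThree (n p q : ℕ) (a : Fin n) : Fin 3 :=
  if (a : ℕ) < p then 0 else if (a : ℕ) < p + q then 1 else 2

/-- The block labelling of `n` positions with a first block of size `p`. -/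
def blockTwo (n p : ℕ) (a : Fin n) : Fin 2 := if (a : ℕ) < p then 0 else 1

theorem monotone_blockThree (n p q : ℕ) : Monotone (blockThree n p q) := by
  intro a b hab
  have : (a : ℕ) ≤ b := hab
  unfold blockThree
  split_ifs <;> omega

theorem monotone_blockTwo (n p : ℕ) : Monotone (blockTwo n p) := by
  intro a b hab
  have : (a : ℕ) ≤ b := hab
  unfold blockTwo
  split_ifs <;> omega

theorem mem_shuffles {L : List ℕ} {σ : Equiv.Perm (Fin n)} :
    σ ∈ shuffles n L ↔ IsShuffle L σ := by
  classical simp [shuffles]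

theorem isShuffle_three {p q s : ℕ} (h : p + q + s = n) (σ : Equiv.Perm (Fin n)) :
    IsShuffle [p, q, s] σ ↔ IsBlockShuffle (blockThree n p q) σ := by
  have hs : [p, q, s].sum = n := by simp; omega
  simp only [IsShuffle, hs, true_and, IsBlockShuffle]
  refine forall_congr' fun a => forall_congr' fun b => forall_congr' fun hab => ?_
  refine imp_congr_left ?_
  have hab' : (a : ℕ) < b := hab
  have hb := b.2
  constructor
  · intro H
    have h1 := H 1
    have h2 := H 2
    simp only [List.take_succ_cons, List.take_zero, List.sum_cons, List.sum_nil] at h1 h2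
    unfold blockThree
    split_ifs <;> first | rfl | omega
  · intro H t
    unfold blockThree at H
    rcases t with _ | _ | _ | t
    · simp
    · simp only [List.take_succ_cons, List.take_zero, List.sum_cons, List.sum_nil]
      split_ifs at H <;> omega
    · simp only [List.take_succ_cons, List.take_zero, List.sum_cons, List.sum_nil]
      split_ifs at H <;> omega
    · simp only [List.take_succ_cons, List.take_nil, List.sum_cons, List.sum_nil]
      omega

theorem isShuffle_two {p s : ℕ} (h : p + s = n) (σ : Equiv.Perm (Fin n)) :
    IsShuffle [p, s] σ ↔ IsBlockShuffle (blockTwo n p) σ := by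
  have hs : [p, s].sum = n := by simp; omega
  simp only [IsShuffle, hs, true_and, IsBlockShuffle]
  refine forall_congr' fun a => forall_congr' fun b => forall_congr' fun hab => ?_
  refine imp_congr_left ?_
  have hab' : (a : ℕ) < b := hab
  have hb := b.2
  constructor
  · intro H
    have h1 := H 1
    simp only [List.take_succ_cons, List.take_zero, List.sum_cons, List.sum_nil] at h1
    unfold blockTwo
    split_ifs <;> first | rfl | omega
  · intro H t
    unfold blockTwo at H
    rcases t with _ | _ | t
    · simp
    · simp only [List.take_succ_cons, List.take_zero, List.sum_cons, List.sum_nil]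
      split_ifs at H <;> omega
    · simp only [List.take_succ_cons, List.take_nil, List.sum_cons, List.sum_nil]
      omega

theorem mem_take_finRange {p : ℕ} {a : Fin n} (h : a ∈ (List.finRange n).take p) : (a : ℕ) < p := by
  obtain ⟨i, hi, rfl⟩ := List.mem_take_iff_getElem.1 h
  simp at hi ⊢
  omega

theorem mem_drop_finRange {p : ℕ} {a : Fin n} (h : a ∈ (List.finRange n).drop p) : p ≤ (a : ℕ) := by
  obtain ⟨i, hi, rfl⟩ := List.mem_drop_iff_getElem.1 h
  simp

theorem filter_finRange_lt (p : ℕ) :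
    ((List.finRange n).filter fun a : Fin n => decide ((a : ℕ) < p)) =
      (List.finRange n).take p := by
  conv_lhs => rw [← List.take_append_drop p (List.finRange n)]
  rw [List.filter_append, List.filter_eq_self.2, List.filter_eq_nil_iff.2, List.append_nil]
  · intro a ha
    simpa using mem_drop_finRange ha
  · intro a ha
    simpa using mem_take_finRange ha

theorem filter_finRange_le (p : ℕ) :
    ((List.finRange n).filter fun a : Fin n => decide (p ≤ (a : ℕ))) =
      (List.finRange n).drop p := by
  conv_lhs => rw [← List.take_append_drop p (List.finRange n)]
  rw [List.filter_append, List.filter_eq_nil_iff.2, List.filter_eq_self.2, List.nil_append]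
  · intro a ha
    simpa using mem_drop_finRange ha
  · intro a ha
    simpa using mem_take_finRange ha

theorem filter_finRange_between (p q : ℕ) :
    ((List.finRange n).filter fun a : Fin n => decide (p ≤ (a : ℕ) ∧ (a : ℕ) < p + q)) =
      ((List.finRange n).drop p).take q := by
  have h : ((List.finRange n).filter fun a : Fin n => decide (p ≤ (a : ℕ) ∧ (a : ℕ) < p + q)) =
      (((List.finRange n).drop p).filter fun a : Fin n => decide ((a : ℕ) < p + q)) := by
    rw [← filter_finRange_le, List.filter_filter]
    refine List.filter_congr fun a _ => ?_
    rw [Bool.and_comm, Bool.decide_and]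
  rw [h]
  conv_lhs => rw [← List.take_append_drop q ((List.finRange n).drop p)]
  rw [List.filter_append, List.filter_eq_self.2, List.filter_eq_nil_iff.2, List.append_nil]
  · intro a ha
    rw [List.drop_drop] at ha
    simpa using mem_drop_finRange ha
  · intro a ha
    rw [List.take_drop] at ha
    simpa using mem_take_finRange (List.mem_of_mem_drop ha)

variable {α : Type*} {c : Fin n → Fin 3} {e : Fin n → Fin 2} {σ : Equiv.Perm (Fin n)}

theorem take_ofFn_eq_map (p : ℕ) (x : Fin n → α) :
    (List.ofFn x).take p = ((List.finRange n).take p).map x := by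
  rw [List.ofFn_eq_map, List.map_take]

theorem drop_ofFn_eq_map (p : ℕ) (x : Fin n → α) :
    (List.ofFn x).drop p = ((List.finRange n).drop p).map x := by
  rw [List.ofFn_eq_map, List.map_drop]

theorem take_shuffle_three {p q : ℕ} (hσ : IsBlockShuffle (blockThree n p q) σ)
    (hc : c ∘ σ = blockThree n p q) (x : Fin n → α) :
    (List.ofFn fun i => x (σ i)).take p = colourClass c 0 x := by
  rw [hσ.colourClass_eq hc, take_ofFn_eq_map, ← filter_finRange_lt]
  refine congrArg _ (List.filter_congr fun a _ => decide_eq_decide.2 ?_)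
  unfold blockThree
  split_ifs <;> simp_all

theorem drop_take_shuffle_three {p q : ℕ} (hσ : IsBlockShuffle (blockThree n p q) σ)
    (hc : c ∘ σ = blockThree n p q) (x : Fin n → α) :
    ((List.ofFn fun i => x (σ i)).drop p).take q = colourClass c 1 x := by
  rw [hσ.colourClass_eq hc, drop_ofFn_eq_map, ← List.map_take, ← filter_finRange_between]
  refine congrArg _ (List.filter_congr fun a _ => decide_eq_decide.2 ?_)
  unfold blockThree
  split_ifs <;> simp_all

theorem drop_shuffle_three {p q : ℕ} (hσ : IsBlockShuffle (blockThree n p q) σ)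
    (hc : c ∘ σ = blockThree n p q) (x : Fin n → α) :
    (List.ofFn fun i => x (σ i)).drop (p + q) = colourClass c 2 x := by
  rw [hσ.colourClass_eq hc, drop_ofFn_eq_map, ← filter_finRange_le]
  refine congrArg _ (List.filter_congr fun a _ => decide_eq_decide.2 ?_)
  unfold blockThree
  split_ifs <;> simp_all
  omega

theorem take_shuffle_two {p : ℕ} (hσ : IsBlockShuffle (blockTwo n p) σ)
    (hc : e ∘ σ = blockTwo n p) (x : Fin n → α) :
    (List.ofFn fun i => x (σ i)).take p = colourClass e 0 x := by
  rw [hσ.colourClass_eq hc, take_ofFn_eq_map, ← filter_finRange_lt]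
  refine congrArg _ (List.filter_congr fun a _ => decide_eq_decide.2 ?_)
  unfold blockTwo
  split_ifs <;> simp_all

theorem drop_shuffle_two {p : ℕ} (hσ : IsBlockShuffle (blockTwo n p) σ)
    (hc : e ∘ σ = blockTwo n p) (x : Fin n → α) :
    (List.ofFn fun i => x (σ i)).drop p = colourClass e 1 x := by
  rw [hσ.colourClass_eq hc, drop_ofFn_eq_map, ← filter_finRange_le]
  refine congrArg _ (List.filter_congr fun a _ => decide_eq_decide.2 ?_)
  unfold blockTwo
  split_ifs <;> simp_all

/-- The number of letters whose colour is at most `j`. -/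
def colourCount (c : Fin n → Fin r) (j : Fin r) : ℕ :=
  (Finset.univ.filter fun a => c (Tuple.sort c a) ≤ j).card

theorem colourCount_le (c : Fin n → Fin r) (j : Fin r) : colourCount c j ≤ n :=
  (Finset.card_filter_le _ _).trans (by simp)

theorem colourCount_mono (c : Fin n → Fin r) {i j : Fin r} (h : i ≤ j) :
    colourCount c i ≤ colourCount c j :=
  Finset.card_le_card (Finset.monotone_filter_right _ fun _ _ ha => le_trans ha h)

theorem lt_colourCount (c : Fin n → Fin r) (j : Fin r) (a : Fin n) :
    (a : ℕ) < colourCount c j ↔ c (Tuple.sort c a) ≤ j :=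
  Tuple.lt_card_le_iff_apply_le_of_monotone (f := c ∘ Tuple.sort c) (Tuple.monotone_sort c)

theorem card_filter_lt {p : ℕ} (hp : p ≤ n) :
    (Finset.univ.filter fun a : Fin n => (a : ℕ) < p).card = p := by
  rw [Fin.card_filter_val_lt]
  exact min_eq_right hp

/-- A colouring sorts to the blocks of sizes `p`, `q` and `n - p - q` exactly if these are the
numbers of letters of the three colours. -/
theorem comp_sort_eq_blockThree {p q : ℕ} (h : p + q ≤ n) :
    c ∘ Tuple.sort c = blockThree n p q ↔
      (colourCount c 0, colourCount c 1 - colourCount c 0) = (p, q) := by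
  constructor
  · intro hc
    have hc' : ∀ a, c (Tuple.sort c a) = blockThree n p q a := fun a => congrFun hc a
    have h0 : colourCount c 0 = p := by
      rw [← card_filter_lt (show p ≤ n by omega), colourCount]
      refine congrArg _ (Finset.filter_congr fun a _ => ?_)
      rw [hc', blockThree]
      split_ifs <;> simp_all
    have h1 : colourCount c 1 = p + q := by
      rw [← card_filter_lt h, colourCount]
      refine congrArg _ (Finset.filter_congr fun a _ => ?_)
      rw [hc', blockThree]
      split_ifs <;> simp_all
      omega
    rw [h0, h1, Nat.add_sub_cancel_left]
  · intro hpq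
    rw [Prod.mk.injEq] at hpq
    obtain ⟨h0, h1⟩ := hpq
    have hle := colourCount_mono c (show (0 : Fin 3) ≤ 1 by decide)
    have h1' : colourCount c 1 = p + q := by omega
    ext1 a
    have e0 := lt_colourCount c 0 a
    have e1 := lt_colourCount c 1 a
    rw [h0] at e0
    rw [h1'] at e1
    rw [Function.comp_apply, blockThree]
    generalize c (Tuple.sort c a) = z at e0 e1
    fin_cases z <;> split_ifs <;> simp_all

theorem comp_sort_eq_blockTwo {p : ℕ} (h : p ≤ n) :
    e ∘ Tuple.sort e = blockTwo n p ↔ colourCount e 0 = p := by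
  constructor
  · intro hc
    have hc' : ∀ a, e (Tuple.sort e a) = blockTwo n p a := fun a => congrFun hc a
    rw [← card_filter_lt h, colourCount]
    refine congrArg _ (Finset.filter_congr fun a _ => ?_)
    rw [hc', blockTwo]
    split_ifs <;> simp_all
  · intro h0
    ext1 a
    have e0 := lt_colourCount e 0 a
    rw [h0] at e0
    rw [Function.comp_apply, blockTwo]
    generalize e (Tuple.sort e a) = z at e0
    fin_cases z <;> split_ifs <;> simp_all

/-- A sum over `(p, q, n - p - q)`-shuffles as a sum over colourings; both are empty if `n < p + q`,
where the subtraction truncates. -/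
theorem sum_shuffles_three {M : Type*} [AddCommMonoid M] (p q : ℕ)
    (f : Equiv.Perm (Fin n) → M) (g : (Fin n → Fin 3) → M)
    (hfg : ∀ σ c, IsBlockShuffle (blockThree n p q) σ → c ∘ σ = blockThree n p q → f σ = g c) :
    ∑ σ ∈ shuffles n [p, q, n - p - q], f σ =
      ∑ c with (colourCount c 0, colourCount c 1 - colourCount c 0) = (p, q), g c := by
  by_cases h : p + q ≤ n
  · refine sum_blockShuffle (monotone_blockThree n p q) _ (fun σ => ?_) _ (fun c => ?_) f g hfg
    · rw [mem_shuffles, isShuffle_three (by omega)]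
    · rw [comp_sort_eq_blockThree h]
      simp
  · rw [Finset.sum_eq_zero, Finset.sum_eq_zero]
    · intro c hc
      rw [Finset.mem_filter, Prod.mk.injEq] at hc
      have := colourCount_le c 1
      have := colourCount_le c 0
      omega
    · intro σ hσ
      have := (mem_shuffles.1 hσ).1
      simp at this
      omega

/-- A sum over `(p, n - p)`-shuffles as a sum over colourings; both are empty if `n < p`. -/
theorem sum_shuffles_two {M : Type*} [AddCommMonoid M] {p s : ℕ} (hs : p ≤ n → s = n - p)
    (f : Equiv.Perm (Fin n) → M) (g : (Fin n → Fin 2) → M)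
    (hfg : ∀ σ c, IsBlockShuffle (blockTwo n p) σ → c ∘ σ = blockTwo n p → f σ = g c) :
    ∑ σ ∈ shuffles n [p, s], f σ = ∑ c with colourCount c 0 = p, g c := by
  by_cases h : p ≤ n
  · refine sum_blockShuffle (monotone_blockTwo n p) _ (fun σ => ?_) _ (fun c => ?_) f g hfg
    · have := hs h
      rw [mem_shuffles, isShuffle_two (by omega)]
    · rw [comp_sort_eq_blockTwo h]
      simp
  · rw [Finset.sum_eq_zero, Finset.sum_eq_zero]
    · intro c hc
      rw [Finset.mem_filter] at hc
      have := colourCount_le c 0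
      omega
    · intro σ hσ
      have := (mem_shuffles.1 hσ).1
      simp at this
      omega

end Shuffles

section HatSum

theorem sum_Icc_one_eq {M : Type*} [AddCommMonoid M] {F : ℕ → M} (N : ℕ) (h : F 0 = 0) :
    ∑ q ∈ Finset.Icc 1 N, F q = ∑ q ∈ Finset.range (N + 1), F q := by
  refine Finset.sum_subset (fun q hq => ?_) fun q hq hq' => ?_
  · rw [Finset.mem_Icc] at hq
    rw [Finset.mem_range]
    omega
  · rw [Finset.mem_range] at hq
    rw [Finset.mem_Icc] at hq'
    obtain rfl : q = 0 := by omega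
    exact h

/-- The shuffle formula, summed over all `p` and `q`, is a sum over all colourings of the letters:
`p` and `q` are the sizes of the colour classes. -/
theorem hatSum_eq_sum_colourings (k : ℤ) (R : ComTrias 𝒱 →ₗ[K] V) {n m : ℕ} (x : Fin n → V)
    (dx : Fin n → ℤ) (y : Fin m → V) (dy : Fin m → ℤ) :
    hatSum 𝒱 k R x dx y dy =
      (∑ c : Fin n → Fin 3, colourSign K dx c • (mon 𝒱 (R (mon 𝒱 (colourClass c 0 x) ⊗ₜ
        barMon 𝒱 (colourClass c 1 x)) :: colourClass c 2 x) ⊗ₜ[K] barMon 𝒱 (List.ofFn y))) +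
      ∑ c : Fin n → Fin 2, ∑ e : Fin m → Fin 2,
        (colourSign K dx c * colourSign K dy e * sgn K (k * (colourClass c 0 dx).sum)) •
          (mon 𝒱 (colourClass c 0 x) ⊗ₜ[K] barMon 𝒱 (R (mon 𝒱 (colourClass c 1 x) ⊗ₜ
            barMon 𝒱 (colourClass e 0 y)) :: colourClass e 1 y)) := by
  -- the terms with `q = 0` vanish, so that the sums over `q ≥ 1` may include them
  have hb : barMon 𝒱 ([] : List V) = 0 := by
    refine Subtype.ext ?_
    simp [barMon]
  simp only [hatSum, hat, Finset.sum_add_distrib]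
  congr 1
  · have h1 : ∀ p, ∑ q ∈ Finset.Icc 1 (max n m), ∑ σ ∈ shuffles n [p, q, n - p - q],
        koszul K dx σ • (mon 𝒱 (R (mon 𝒱 ((List.ofFn fun i => x (σ i)).take p) ⊗ₜ
          barMon 𝒱 (((List.ofFn fun i => x (σ i)).drop p).take q)) ::
            (List.ofFn fun i => x (σ i)).drop (p + q)) ⊗ₜ[K] barMon 𝒱 (List.ofFn y)) =
        ∑ q ∈ Finset.range (max n m + 1),
          ∑ c : Fin n → Fin 3 with (colourCount c 0, colourCount c 1 - colourCount c 0) = (p, q),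
          colourSign K dx c • (mon 𝒱 (R (mon 𝒱 (colourClass c 0 x) ⊗ₜ
            barMon 𝒱 (colourClass c 1 x)) :: colourClass c 2 x) ⊗ₜ[K] barMon 𝒱 (List.ofFn y)) := by
      intro p
      rw [sum_Icc_one_eq]
      · refine Finset.sum_congr rfl fun q _ => sum_shuffles_three p q _ _ fun σ c hσ hc => ?_
        rw [hσ.koszul_eq (monotone_blockThree n p q) hc, take_shuffle_three hσ hc,
          drop_take_shuffle_three hσ hc, drop_shuffle_three hσ hc]
      · refine Finset.sum_eq_zero fun σ _ => ?_
        rw [List.take_zero, hb]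
        simp
    rw [Finset.sum_congr rfl fun p _ => h1 p, ← Finset.sum_product']
    refine Finset.sum_fiberwise_of_maps_to
      (g := fun c : Fin n → Fin 3 => (colourCount c 0, colourCount c 1 - colourCount c 0)) ?_ _
    intro c _
    have := colourCount_le c 0
    have := colourCount_le c 1
    rw [Finset.mem_product, Finset.mem_range, Finset.mem_range]
    constructor <;> dsimp only <;> omega
  · have h2 : ∀ p ∈ Finset.range (n + 1), ∀ q,
        (∑ σ ∈ shuffles n [n - p, p], ∑ τ ∈ shuffles m [q, m - q],
          (koszul K dx σ * koszul K dy τ *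
            sgn K (k * ((List.ofFn fun i => dx (σ i)).take (n - p)).sum)) •
          (mon 𝒱 ((List.ofFn fun i => x (σ i)).take (n - p)) ⊗ₜ[K]
            barMon 𝒱 (R (mon 𝒱 ((List.ofFn fun i => x (σ i)).drop (n - p)) ⊗ₜ
              barMon 𝒱 ((List.ofFn fun j => y (τ j)).take q)) ::
                (List.ofFn fun j => y (τ j)).drop q))) =
        ∑ c : Fin n → Fin 2 with colourCount c 0 = n - p,
          ∑ e : Fin m → Fin 2 with colourCount e 0 = q,
          (colourSign K dx c * colourSign K dy e * sgn K (k * (colourClass c 0 dx).sum)) •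
          (mon 𝒱 (colourClass c 0 x) ⊗ₜ[K] barMon 𝒱 (R (mon 𝒱 (colourClass c 1 x) ⊗ₜ
            barMon 𝒱 (colourClass e 0 y)) :: colourClass e 1 y)) := by
      intro p hp q
      rw [Finset.mem_range] at hp
      refine sum_shuffles_two (fun _ => by omega) _ _ fun σ c hσ hc => ?_
      refine sum_shuffles_two (fun _ => rfl) _ _ fun τ e hτ he => ?_
      rw [hσ.koszul_eq (monotone_blockTwo n _) hc, hτ.koszul_eq (monotone_blockTwo m _) he,
        take_shuffle_two hσ hc, take_shuffle_two hσ hc, drop_shuffle_two hσ hc,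
        take_shuffle_two hτ he, drop_shuffle_two hτ he]
    have h3 : ∀ p ∈ Finset.range (n + 1), ∑ q ∈ Finset.Icc 1 (max n m),
        (∑ σ ∈ shuffles n [n - p, p], ∑ τ ∈ shuffles m [q, m - q],
          (koszul K dx σ * koszul K dy τ *
            sgn K (k * ((List.ofFn fun i => dx (σ i)).take (n - p)).sum)) •
          (mon 𝒱 ((List.ofFn fun i => x (σ i)).take (n - p)) ⊗ₜ[K]
            barMon 𝒱 (R (mon 𝒱 ((List.ofFn fun i => x (σ i)).drop (n - p)) ⊗ₜ
              barMon 𝒱 ((List.ofFn fun j => y (τ j)).take q)) ::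
                (List.ofFn fun j => y (τ j)).drop q))) =
        ∑ c : Fin n → Fin 2 with colourCount c 0 = n - p, ∑ e : Fin m → Fin 2,
          (colourSign K dx c * colourSign K dy e * sgn K (k * (colourClass c 0 dx).sum)) •
          (mon 𝒱 (colourClass c 0 x) ⊗ₜ[K] barMon 𝒱 (R (mon 𝒱 (colourClass c 1 x) ⊗ₜ
            barMon 𝒱 (colourClass e 0 y)) :: colourClass e 1 y)) := by
      intro p hp
      rw [sum_Icc_one_eq]
      · rw [Finset.sum_congr rfl fun q _ => h2 p hp q, Finset.sum_comm]
        refine Finset.sum_congr rfl fun c _ => ?_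
        refine Finset.sum_fiberwise_of_maps_to
          (g := fun e : Fin m → Fin 2 => colourCount e 0) (fun e _ => ?_) _
        have := colourCount_le e 0
        rw [Finset.mem_range]
        omega
      · refine Finset.sum_eq_zero fun σ _ => Finset.sum_eq_zero fun τ _ => ?_
        rw [List.take_zero, hb, TensorProduct.tmul_zero, map_zero, barMon, mon_cons, map_zero,
          zero_mul, map_zero, TensorProduct.tmul_zero, smul_zero]
    -- the first colour class has `n - p` letters, so the sum over `p` is reversed
    rw [Finset.sum_congr rfl h3]
    rw [← Finset.sum_range_reflect]
    rw [Finset.sum_congr rfl fun p hp => by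
      rw [show n - (n + 1 - 1 - p) = p by rw [Finset.mem_range] at hp; omega]]
    refine Finset.sum_fiberwise_of_maps_to
      (g := fun c : Fin n → Fin 2 => colourCount c 0) (fun c _ => ?_) _
    have := colourCount_le c 0
    rw [Finset.mem_range]
    omega

end HatSum

end ShuffleSums

end PostLie

/-! ### The isomorphism `Homᵏ ≃ coDerᵏ` -/

theorem mainTheorem10 {K V : Type*} [Field K] [CharZero K] [AddCommGroup V] [Module K V]
    (𝒱 : ℤ → Submodule K V) [DirectSum.Decomposition 𝒱] :
    ∃! Ψ : (k : ℤ) → (PostLie.HomDeg 𝒱 k ≃ₗ[K] PostLie.CoDer 𝒱 k),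
      ∀ (k : ℤ) (R : PostLie.HomDeg 𝒱 k) (n m : ℕ), 1 ≤ m →
        ∀ (x : Fin n → V) (dx : Fin n → ℤ) (y : Fin m → V) (dy : Fin m → ℤ),
          (∀ i, x i ∈ 𝒱 (dx i)) → (∀ j, y j ∈ 𝒱 (dy j)) →
            (Ψ k R : PostLie.ComTrias 𝒱 →ₗ[K] PostLie.ComTrias 𝒱)
                (PostLie.mon 𝒱 (List.ofFn x) ⊗ₜ[K] PostLie.barMon 𝒱 (List.ofFn y)) =
              PostLie.hatSum 𝒱 k (R : PostLie.ComTrias 𝒱 →ₗ[K] V) x dx y dy := by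
  refine ⟨fun k => LinearEquiv.ofBijective (PostLie.psiHom 𝒱 k) (PostLie.psiHom_bijective 𝒱 k),
    ?_, ?_⟩
  · intro k R n m hm x dx y dy hx hy
    exact (PostLie.psi_mon 𝒱 k R.1 hm hx hy).trans
      (PostLie.hatSum_eq_sum_colourings 𝒱 k R.1 x dx y dy).symm
  · intro Ψ hΨ
    funext k
    refine LinearEquiv.ext fun R => Subtype.ext
      (PostLie.comTrias_ext_lmon 𝒱 fun l l' hl hl' h => ?_)
    have e : ∀ l : List (ℤ × V), l.map Prod.snd = List.ofFn fun i => (l.get i).2 := fun l => by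
      conv_lhs => rw [← List.ofFn_get l, List.map_ofFn]
      rfl
    have hm : 1 ≤ l'.length := List.length_pos_iff.2 h
    have hx : ∀ i, (l.get i).2 ∈ 𝒱 (l.get i).1 := fun i => hl _ (List.get_mem l i)
    have hy : ∀ i, (l'.get i).2 ∈ 𝒱 (l'.get i).1 := fun i => hl' _ (List.get_mem l' i)
    rw [PostLie.lmon, e, e, hΨ k R _ _ hm _ _ _ _ hx hy]
    exact ((PostLie.psi_mon 𝒱 k R.1 hm hx hy).trans
      (PostLie.hatSum_eq_sum_colourings 𝒱 k R.1 _ _ _ _).symm).symm
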